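/- **Theorem 4.5 (gaps are protected).** Let $d\ge 2$, $\epsilon\in(0,1)$, $\gamma\ge 2$, $0<\omega_-<\omega_+<\tfrac14$, and let $\mu$ be a Borel probability measure on $[0,\infty)$ with $\mu([\omega_-,\omega_+])=1$. Let $\omega=(\omega_z)_{z\in\mathbb Z^d}$ be a family of independent random variables with common law $\mu$, that is, a random point of $[0,\infty)^{\mathbb Z^d}$ with law $\mathbb P=\mu^{\otimes\mathbb Z^d}$. For $r=(r_z)_{z\in\mathbb Z^d}$ and $c_z:=\epsilon z+(\tfrac\epsilon2,\dots,\tfrac\epsilon2)$, $z\in\mathbb Z^d$, put $$\mathcal I_r:=\bigcup_{z} B_{\epsilon r_z}(c_z),\qquad \mathcal L_r:=\bigcup_{z} B_{\epsilon r_z+\epsilon^\gamma/4}(c_z)\setminus B_{\epsilon r_z}(c_z),\qquad \mathcal M_r:=\mathbb R^d\setminus(\mathcal I_r\cup\mathcal L_r),$$ where $B_\rho(x)$ is the open Euclidean ball. Let $$a_r^\epsilon:=\begin{cases}1&\text{on }\mathcal M_r,\\ \epsilon^2&\text{on }\mathcal I_r,\\ 1-(1-\epsilon^2)\dfrac{\operatorname{dist}(\cdot,\mathcal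 M_r)}{\epsilon^\gamma/4}&\text{on }\mathcal L_r,\end{cases}\qquad \hat a_r^\epsilon:=\begin{cases}\epsilon^2&\text{on }\mathcal I_r,\\ 1&\text{on }\mathbb R^d\setminus \mathcal I_r,\end{cases}$$ and let $\mathcal A_r^\epsilon$ and $\hat{\mathcal A}_r^\epsilon$ be the self-adjoint operators in $L^2(\mathbb R^d)$ associated with the forms $\int_{\mathbb R^d} a_r^\epsilon\nabla u\cdot\overline{\nabla v}$ and $\int_{\mathbb R^d}\hat a_r^\epsilon\nabla u\cdot\overline{\nabla v}$, $u,v\in H^1(\mathbb R^d)$. Let $\delta:=\epsilon^\gamma/4$ be the thickness of the boundary layers, let $\mathbf e$ be the family with all entries equal to $1$, and let $I=(I_-,I_+)\subset\mathbb R$ be an interval. Suppose that for every $t\in[0,1]$ $$\sigma\big(\hat{\mathcal A}^\epsilon_{\omega+t\frac{\delta}{\epsilon}\mathbf e}\big)\cap I=\emptyset\quad\text{almost surely},$$ that is, almost surely $I$ misses the spectrum of the sharp-interface operator whose inclusions have the radii $\epsilon\omega_z+t\delta$. Then $$\sigma(\mathcal A^\epsilon_\omega)\cap I=\emptyset\quad\text{almost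 surely}.$$ -/

import Mathlib

open MeasureTheory
open scoped NNReal

namespace HighContrast

noncomputable section

open scoped ContDiff

/-- Euclidean space of dimension `d`. -/
abbrev Space (d : ℕ) : Type := EuclideanSpace ℝ (Fin d)

/-- The complex Hilbert space of square-integrable functions on Euclidean space. -/
abbrev L2 (d : ℕ) : Type := Lp ℂ 2 (volume : Measure (Space d))

/-- Square-integrable complex vector fields on Euclidean space. -/
abbrev L2Vec (d : ℕ) : Type :=
  Lp (EuclideanSpace ℂ (Fin d)) 2 (volume : Measure (Space d))

/-! ### The first-order Sobolev space and the weak gradient -/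

/-- `g` is a weak gradient of `u`: for every smooth compactly supported `φ` and every `i`,
`∫ φ gᵢ = - ∫ (∂ᵢ φ) u`. -/
def IsWeakGradient {d : ℕ} (u : L2 d) (g : L2Vec d) : Prop :=
  ∀ φ : Space d → ℝ, ContDiff ℝ ∞ φ → HasCompactSupport φ → ∀ i : Fin d,
    ∫ x, φ x • (g x) i = - ∫ x, (fderiv ℝ φ x (EuclideanSpace.single i (1 : ℝ))) • u x

/-- A component of a square-integrable vector field is locally integrable. -/
lemma locallyIntegrable_component {d : ℕ} (g : L2Vec d) (i : Fin d) :
    LocallyIntegrable (fun x => (g x) i) (volume : Measure (Space d)) := by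
  have h : MemLp (fun x => (EuclideanSpace.proj i : EuclideanSpace ℂ (Fin d) →L[ℂ] ℂ) (g x)) 2
      (volume : Measure (Space d)) :=
    (EuclideanSpace.proj i : EuclideanSpace ℂ (Fin d) →L[ℂ] ℂ).comp_memLp' (Lp.memLp g)
  exact h.locallyIntegrable (by norm_num)

/-- A square-integrable function is locally integrable. -/
lemma locallyIntegrable_L2 {d : ℕ} (u : L2 d) :
    LocallyIntegrable u (volume : Measure (Space d)) :=
  (Lp.memLp u).locallyIntegrable (by norm_num)

lemma integrable_test_smul {d : ℕ} {f : Space d → ℂ}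
    (hf : LocallyIntegrable f (volume : Measure (Space d))) {φ : Space d → ℝ}
    (hφ : Continuous φ) (hc : HasCompactSupport φ) :
    Integrable (fun x => φ x • f x) (volume : Measure (Space d)) :=
  hf.integrable_smul_left_of_hasCompactSupport hφ hc

lemma integrable_deriv_test_smul {d : ℕ} {f : Space d → ℂ}
    (hf : LocallyIntegrable f (volume : Measure (Space d))) {φ : Space d → ℝ}
    (hφ : ContDiff ℝ ∞ φ) (hc : HasCompactSupport φ) (e : Space d) :
    Integrable (fun x => (fderiv ℝ φ x e) • f x) (volume : Measure (Space d)) := by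
  refine integrable_test_smul hf ?_ (hc.fderiv_apply (𝕜 := ℝ) e)
  exact (hφ.continuous_fderiv (by simp)).clm_apply continuous_const

lemma IsWeakGradient.add {d : ℕ} {u v : L2 d} {g h : L2Vec d}
    (hu : IsWeakGradient u g) (hv : IsWeakGradient v h) : IsWeakGradient (u + v) (g + h) := by
  intro φ hφ hc i
  have e1 : (fun x => φ x • ((g + h : L2Vec d) x) i) =ᵐ[volume]
      fun x => φ x • (g x) i + φ x • (h x) i := by
    filter_upwards [Lp.coeFn_add g h] with x hx
    rw [hx]; simp
  have e2 : (fun x => (fderiv ℝ φ x (EuclideanSpace.single i (1 : ℝ))) • (u + v : L2 d) x)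
      =ᵐ[volume] fun x => (fderiv ℝ φ x (EuclideanSpace.single i (1 : ℝ))) • u x
        + (fderiv ℝ φ x (EuclideanSpace.single i (1 : ℝ))) • v x := by
    filter_upwards [Lp.coeFn_add u v] with x hx
    rw [hx]; simp
  rw [integral_congr_ae e1, integral_congr_ae e2, integral_add, integral_add,
    hu φ hφ hc i, hv φ hφ hc i, neg_add]
  · exact integrable_deriv_test_smul (locallyIntegrable_L2 u) hφ hc _
  · exact integrable_deriv_test_smul (locallyIntegrable_L2 v) hφ hc _
  · exact integrable_test_smul (locallyIntegrable_component g i) hφ.continuous hc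
  · exact integrable_test_smul (locallyIntegrable_component h i) hφ.continuous hc

lemma IsWeakGradient.smul {d : ℕ} {u : L2 d} {g : L2Vec d} (c : ℂ)
    (hu : IsWeakGradient u g) : IsWeakGradient (c • u) (c • g) := by
  intro φ hφ hc i
  have e1 : (fun x => φ x • ((c • g : L2Vec d) x) i) =ᵐ[volume]
      fun x => c * (φ x • (g x) i) := by
    filter_upwards [Lp.coeFn_smul c g] with x hx
    rw [hx]; simp; ring
  have e2 : (fun x => (fderiv ℝ φ x (EuclideanSpace.single i (1 : ℝ))) • (c • u : L2 d) x)
      =ᵐ[volume] fun x => c * ((fderiv ℝ φ x (EuclideanSpace.single i (1 : ℝ))) • u x) := by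
    filter_upwards [Lp.coeFn_smul c u] with x hx
    rw [hx]; simp; ring
  rw [integral_congr_ae e1, integral_congr_ae e2, integral_const_mul, integral_const_mul,
    hu φ hφ hc i, mul_neg]

lemma isWeakGradient_zero {d : ℕ} : IsWeakGradient (0 : L2 d) 0 := by
  intro φ hφ hc i
  have e1 : (fun x => φ x • ((0 : L2Vec d) x) i) =ᵐ[volume] fun _ => (0 : ℂ) := by
    filter_upwards [Lp.coeFn_zero (EuclideanSpace ℂ (Fin d)) 2
      (volume : Measure (Space d))] with x hx
    rw [hx]; simp
  have e2 : (fun x => (fderiv ℝ φ x (EuclideanSpace.single i (1 : ℝ))) • (0 : L2 d) x)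
      =ᵐ[volume] fun _ => (0 : ℂ) := by
    filter_upwards [Lp.coeFn_zero ℂ 2 (volume : Measure (Space d))] with x hx
    rw [hx]; simp
  rw [integral_congr_ae e1, integral_congr_ae e2]; simp

/-- Weak gradients are unique. -/
lemma IsWeakGradient.unique {d : ℕ} {u : L2 d} {g h : L2Vec d}
    (hg : IsWeakGradient u g) (hh : IsWeakGradient u h) : g = h := by
  apply Lp.ext
  have key : ∀ i : Fin d, ∀ᵐ x, (g x) i = (h x) i := fun i =>
    ae_eq_of_integral_contDiff_smul_eq (locallyIntegrable_component g i)
      (locallyIntegrable_component h i)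
      (fun φ hφ hc => by rw [hg φ hφ hc i, hh φ hφ hc i])
  filter_upwards [ae_all_iff.2 key] with x hx
  ext i
  exact hx i

/-- The Sobolev space `H¹`: square-integrable functions with a square-integrable weak
gradient. -/
def H1 (d : ℕ) : Submodule ℂ (L2 d) where
  carrier := {u | ∃ g : L2Vec d, IsWeakGradient u g}
  add_mem' := fun ⟨g, hg⟩ ⟨h, hh⟩ => ⟨g + h, hg.add hh⟩
  zero_mem' := ⟨0, isWeakGradient_zero⟩
  smul_mem' := fun c _ ⟨g, hg⟩ => ⟨c • g, hg.smul c⟩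

/-- The weak gradient of an element of `H¹`. -/
def grad {d : ℕ} : H1 d →ₗ[ℂ] L2Vec d where
  toFun u := u.2.choose
  map_add' u v := (u + v).2.choose_spec.unique (u.2.choose_spec.add v.2.choose_spec)
  map_smul' c u := (c • u).2.choose_spec.unique (u.2.choose_spec.smul c)

lemma isWeakGradient_grad {d : ℕ} (u : H1 d) : IsWeakGradient (u : L2 d) (grad u) :=
  u.2.choose_spec

/-! ### Divergence-form operators -/

/-- The integrand `a ∇u · conj (∇v)` of the sesquilinear form with coefficient `a`. -/
def formIntegrand {d : ℕ} (a : Space d → ℝ) (u v : H1 d) (x : Space d) : ℂ :=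
  (a x : ℂ) * inner ℂ (grad v x) (grad u x)

lemma formIntegrand_add {d : ℕ} (a : Space d → ℝ) (u u' v : H1 d) :
    formIntegrand a (u + u') v =ᵐ[volume] formIntegrand a u v + formIntegrand a u' v := by
  have h := Lp.coeFn_add (grad u) (grad u')
  rw [← map_add] at h
  filter_upwards [h] with x hx
  simp only [formIntegrand, hx, Pi.add_apply, inner_add_right, mul_add]

lemma formIntegrand_smul {d : ℕ} (a : Space d → ℝ) (c : ℂ) (u v : H1 d) :
    formIntegrand a (c • u) v =ᵐ[volume] c • formIntegrand a u v := by
  have h := Lp.coeFn_smul c (grad u)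
  rw [← map_smul] at h
  filter_upwards [h] with x hx
  simp only [formIntegrand, hx, Pi.smul_apply, inner_smul_right, smul_eq_mul]
  ring

lemma formIntegrand_zero {d : ℕ} (a : Space d → ℝ) (v : H1 d) :
    formIntegrand a 0 v =ᵐ[volume] 0 := by
  simpa using formIntegrand_smul a 0 0 v

/-- Graph of the operator associated with the form `∫ a ∇u · conj (∇v)`, `u, v ∈ H¹`: the pairs
`(u, f)` with `u ∈ H¹` and `∫ a ∇u · conj (∇v) = ∫ f conj v` for all `v ∈ H¹`. (The integrability
condition holds automatically when `a` is bounded and measurable.) -/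
def formGraph {d : ℕ} (a : Space d → ℝ) : Submodule ℂ (L2 d × L2 d) where
  carrier := {p | ∃ u : H1 d, (u : L2 d) = p.1 ∧ ∀ v : H1 d,
    Integrable (formIntegrand a u v) ∧ ∫ x, formIntegrand a u v x = inner ℂ (v : L2 d) p.2}
  add_mem' := by
    rintro ⟨_, f⟩ ⟨_, f'⟩ ⟨u, rfl, hu⟩ ⟨u', rfl, hu'⟩
    refine ⟨u + u', rfl, fun v => ?_⟩
    have e := formIntegrand_add a u u' v
    refine ⟨((hu v).1.add (hu' v).1).congr e.symm, ?_⟩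
    rw [integral_congr_ae e, integral_add' (hu v).1 (hu' v).1, (hu v).2, (hu' v).2]
    simp [inner_add_right]
  zero_mem' := by
    refine ⟨0, rfl, fun v => ?_⟩
    have e := formIntegrand_zero a v
    refine ⟨(integrable_zero _ _ _).congr e.symm, ?_⟩
    rw [integral_congr_ae e]
    simp
  smul_mem' := by
    rintro c ⟨_, f⟩ ⟨u, rfl, hu⟩
    refine ⟨c • u, rfl, fun v => ?_⟩
    have e := formIntegrand_smul a c u v
    refine ⟨((hu v).1.smul c).congr e.symm, ?_⟩
    rw [integral_congr_ae e]
    simp only [Pi.smul_apply]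
    rw [integral_smul, (hu v).2]
    simp [inner_smul_right]

/-- Every real test function belongs to `H¹`. -/
lemma exists_H1_of_test {d : ℕ} {φ : Space d → ℝ} (hφ : ContDiff ℝ ∞ φ)
    (hc : HasCompactSupport φ) :
    ∃ v : H1 d, ((v : L2 d) : Space d → ℂ) =ᵐ[volume] fun x => (φ x : ℂ) := by
  have hcont : Continuous fun x => (φ x : ℂ) := Complex.continuous_ofReal.comp hφ.continuous
  have hcs : HasCompactSupport fun x => (φ x : ℂ) :=
    hc.comp_left (g := fun t : ℝ => (t : ℂ)) Complex.ofReal_zero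
  have hm : MemLp (fun x => (φ x : ℂ)) 2 (volume : Measure (Space d)) :=
    hcont.memLp_of_hasCompactSupport hcs
  let G : Space d → EuclideanSpace ℂ (Fin d) := fun x => WithLp.toLp 2 fun i =>
    ((fderiv ℝ φ x (EuclideanSpace.single i (1 : ℝ)) : ℝ) : ℂ)
  have hGc : Continuous G := by
    refine (PiLp.continuous_toLp 2 _).comp (continuous_pi fun i => ?_)
    exact Complex.continuous_ofReal.comp
      ((hφ.continuous_fderiv (by simp)).clm_apply continuous_const)
  have hGs : HasCompactSupport G := by
    refine (hc.fderiv (𝕜 := ℝ)).mono fun x hx => ?_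
    rw [Function.mem_support] at hx ⊢
    intro h0
    apply hx
    ext i
    simp [G, h0]
  have hG : MemLp G 2 (volume : Measure (Space d)) := hGc.memLp_of_hasCompactSupport hGs
  refine ⟨⟨hm.toLp _, hG.toLp _, ?_⟩, hm.coeFn_toLp⟩
  intro ψ hψ hψc i
  set e : Space d := EuclideanSpace.single i (1 : ℝ)
  have e1 : (fun x => ψ x • ((hG.toLp G) x) i) =ᵐ[volume]
      fun x => ((ψ x * fderiv ℝ φ x e : ℝ) : ℂ) := by
    filter_upwards [hG.coeFn_toLp] with x hx
    rw [hx]; simp [G, e]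
  have e2 : (fun x => (fderiv ℝ ψ x e) • (hm.toLp (fun x => (φ x : ℂ))) x) =ᵐ[volume]
      fun x => ((fderiv ℝ ψ x e * φ x : ℝ) : ℂ) := by
    filter_upwards [hm.coeFn_toLp] with x hx
    rw [hx]; simp
  rw [integral_congr_ae e1, integral_congr_ae e2, integral_complex_ofReal, integral_complex_ofReal,
    ← Complex.ofReal_neg]
  congr 1
  have cφ := hφ.continuous
  have cψ := hψ.continuous
  have cφ1 : Continuous fun x => fderiv ℝ φ x e :=
    (hφ.continuous_fderiv (by simp)).clm_apply continuous_const
  have cψ1 : Continuous fun x => fderiv ℝ ψ x e :=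
    (hψ.continuous_fderiv (by simp)).clm_apply continuous_const
  refine integral_mul_fderiv_eq_neg_fderiv_mul_of_integrable ?_ ?_ ?_
    (fun x _ => (hψ.differentiable (by simp)) x) (fun x _ => (hφ.differentiable (by simp)) x)
  · exact (cψ1.mul cφ).integrable_of_hasCompactSupport hc.mul_left
  · exact (cψ.mul cφ1).integrable_of_hasCompactSupport hψc.mul_right
  · exact (cψ.mul cφ).integrable_of_hasCompactSupport hc.mul_left

/-- The graph is the graph of a function, because `H¹` is dense. -/
lemma formGraph_functional {d : ℕ} (a : Space d → ℝ) (p : L2 d × L2 d) (hp : p ∈ formGraph a)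
    (h0 : p.1 = 0) : p.2 = 0 := by
  obtain ⟨u, hu, h⟩ := hp
  have hu0 : u = 0 := Subtype.ext (hu.trans h0)
  subst hu0
  have hz : ∀ v : H1 d, inner ℂ (v : L2 d) p.2 = 0 := fun v => by
    rw [← (h v).2, integral_congr_ae (formIntegrand_zero a v)]; simp
  apply Lp.ext
  have key : ∀ᵐ x, (p.2 : Space d → ℂ) x = 0 := by
    refine ae_eq_zero_of_integral_contDiff_smul_eq_zero (locallyIntegrable_L2 p.2) ?_
    intro φ hφ hc
    obtain ⟨v, hv⟩ := exists_H1_of_test hφ hc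
    rw [← hz v, L2.inner_def]
    refine integral_congr_ae ?_
    filter_upwards [hv] with x hx
    rw [hx]; simp [mul_comm]
  filter_upwards [key, Lp.coeFn_zero ℂ 2 (volume : Measure (Space d))] with x hx h0
  rw [hx, h0]; rfl

/-- The operator `- div (a ∇ ·)` associated with the form `∫ a ∇u · conj (∇v)` on `H¹`. -/
def formOperator {d : ℕ} (a : Space d → ℝ) : L2 d →ₗ.[ℂ] L2 d :=
  (formGraph a).toLinearPMap

lemma formOperator_graph {d : ℕ} (a : Space d → ℝ) :
    (formOperator a).graph = formGraph a :=
  Submodule.toLinearPMap_graph_eq _ (formGraph_functional a)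

/-! ### Spectrum of an unbounded operator -/

/-- The resolvent set: those `z` for which `T - z` has an everywhere defined bounded two-sided
inverse `R`. -/
def resolventSet {H : Type*} [NormedAddCommGroup H] [NormedSpace ℂ H] (T : H →ₗ.[ℂ] H) : Set ℂ :=
  {z | ∃ R : H →L[ℂ] H,
    (∀ f : H, ∃ h : R f ∈ T.domain, T ⟨R f, h⟩ - z • R f = f) ∧
    (∀ u : T.domain, R (T u - z • (u : H)) = u)}

/-- The spectrum of an unbounded operator. -/
def opSpectrum {H : Type*} [NormedAddCommGroup H] [NormedSpace ℂ H] (T : H →ₗ.[ℂ] H) : Set ℂ :=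
  (resolventSet T)ᶜ

/-! ### The geometry and the coefficients

`r z` is the relative radius of the inclusion in the cell with index `z ∈ ℤᵈ`; its actual radius
is `ε * r z`. -/

/-- Centre of the cell `ε z + (0, ε)ᵈ`. -/
def cellCentre {d : ℕ} (ε : ℝ) (z : Fin d → ℤ) : Space d :=
  WithLp.toLp 2 fun i => ε * (z i : ℝ) + ε / 2

/-- The inclusions. -/
def inclusions {d : ℕ} (ε : ℝ) (r : (Fin d → ℤ) → ℝ) : Set (Space d) :=
  ⋃ z, Metric.ball (cellCentre ε z) (ε * r z)

/-- The boundary layers, of thickness `ε ^ γ / 4`. -/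
def layers {d : ℕ} (ε γ : ℝ) (r : (Fin d → ℤ) → ℝ) : Set (Space d) :=
  ⋃ z, Metric.ball (cellCentre ε z) (ε * r z + ε ^ γ / 4) \
    Metric.ball (cellCentre ε z) (ε * r z)

/-- The matrix: everything outside the inclusions and their layers. -/
def matrixPart {d : ℕ} (ε γ : ℝ) (r : (Fin d → ℤ) → ℝ) : Set (Space d) :=
  (inclusions ε r ∪ layers ε γ r)ᶜ

open scoped Classical in
/-- The coefficient with linear transition across the boundary layers. -/
def layerCoeff {d : ℕ} (ε γ : ℝ) (r : (Fin d → ℤ) → ℝ) (x : Space d) : ℝ :=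
  if x ∈ inclusions ε r then ε ^ 2
  else if x ∈ layers ε γ r then
    1 - (1 - ε ^ 2) * (Metric.infDist x (matrixPart ε γ r) / (ε ^ γ / 4))
  else 1

open scoped Classical in
/-- The coefficient with a sharp interface. -/
def sharpCoeff {d : ℕ} (ε : ℝ) (r : (Fin d → ℤ) → ℝ) (x : Space d) : ℝ :=
  if x ∈ inclusions ε r then ε ^ 2 else 1

/-- The high-contrast operator with boundary layers. -/
def layerOperator (d : ℕ) (ε γ : ℝ) (r : (Fin d → ℤ) → ℝ) : L2 d →ₗ.[ℂ] L2 d :=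
  formOperator (layerCoeff ε γ r)

/-- The high-contrast operator with sharp interfaces. -/
def sharpOperator (d : ℕ) (ε : ℝ) (r : (Fin d → ℤ) → ℝ) : L2 d →ₗ.[ℂ] L2 d :=
  formOperator (sharpCoeff ε r)

/-- The law of independent radii indexed by `ℤᵈ`, each with distribution `μ`. -/
def radiiLaw (d : ℕ) (μ : Measure ℝ≥0) [IsProbabilityMeasure μ] : Measure ((Fin d → ℤ) → ℝ≥0) :=
  Measure.infinitePi fun _ => μ

end

end HighContrast

/-! Enlarging the inclusions lowers the coefficient and therefore raises the resolvent. Fix `l` in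
the gap, a shift `m` with `l + m > 0`, and `μ = (l + m)⁻¹`. Write `T t` for the resolvent at `-m` of
the sharp operator with parameter `t`, minus `μ`. These operators increase with `t`, and the gap
hypothesis gives them a common gap `(-c, c)`. The layered coefficient lies between the sharp
coefficients for `t = 1` and `t = 0`, so its resolvent minus `μ`, called `S`, satisfies `T 0 ≤ S ≤ T
1`. It remains to show that `S` is invertible.

Order and the gaps at the two ends do not suffice, since spectrum could have crossed zero in
between; the gap has to be followed along the path. Let `P t` be the spectral projection of `T t` on
the positive axis. Then `S ≥ c` on the range of `P 0` and `S ≤ -c` on the kernel of `P 1`. If these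
two subspaces have dense sum, `S` is bounded below, hence invertible (`isUnit_of_chain`). Density
means that the kernel of `P 0` meets the range of `P 1` only in zero. This is clear with `P 0` in
place of `P 1`, and it survives every small step of the path (`IsSplitting.disjoint_step`) by the
Davis–Kahan estimate `IsSplitting.norm_apply_le_of_near`.

Small steps require norm continuity of the resolvents in the radii, uniformly over the cells. A
Sobolev function is pulled back by a dilation near each inclusion, which matches the two
coefficients at little cost in energy (`exists_cell_transport`, `exists_sharp_transport`). The
Dirichlet energy scales by `s ^ (2 - d) ≤ 1`, which is where `d ≥ 2` enters. The variational
principle turns this into a bound on the difference of resolvents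
(`IsWeakResolvent.re_inner_le_of_transport`). The path is discretised at rational parameters, so
only countably many null sets are discarded. -/

namespace HighContrast

noncomputable section

/-! ### Spectral splittings and the persistence of gaps along monotone chains -/

section SpectralSplitting

variable {H : Type*} [NormedAddCommGroup H] [InnerProductSpace ℂ H]

lemma re_inner_le_of_le {S T : H →L[ℂ] H} (h : S ≤ T) (x : H) :
    (inner ℂ (S x) x).re ≤ (inner ℂ (T x) x).re := by
  have := ((ContinuousLinearMap.le_def S T).1 h).re_inner_nonneg_left x
  simpa [inner_sub_left] using this

lemma re_inner_self' (x : H) : (inner ℂ x x).re = ‖x‖ ^ 2 := by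
  rw [inner_self_eq_norm_sq_to_K]; norm_cast

lemma re_inner_smul_self (r : ℝ) (x : H) : (inner ℂ (r • x) x).re = r * ‖x‖ ^ 2 := by
  rw [RCLike.real_smul_eq_coe_smul (K := ℂ), inner_smul_left, ← re_inner_self']
  simp [-inner_self_eq_norm_sq_to_K]

variable [CompleteSpace H]

/-- `P` is a projection commuting with `T`, such that `T ≥ c` on its range and `T ≤ -c` on its
kernel. -/
structure IsSplitting (T P : H →L[ℂ] H) (c M : ℝ) : Prop where
  selfAdjoint : IsSelfAdjoint P
  idem : P * P = P
  comm : T * P = P * T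
  pos : ∀ x, P x = x → c * ‖x‖ ^ 2 ≤ (inner ℂ (T x) x).re
  neg : ∀ x, P x = 0 → (inner ℂ (T x) x).re ≤ -c * ‖x‖ ^ 2
  shift : ∀ x, P x = 0 → ‖T x + (M : ℂ) • x‖ ≤ (M - c) * ‖x‖

/-- A self-adjoint operator with a spectral gap `(-c, c)` splits the space into a part where it is
at least `c` and a part where it is at most `-c`. -/
lemma exists_isSplitting {T : H →L[ℂ] H} (hT : IsSelfAdjoint T) {c M : ℝ} (hc : 0 < c)
    (hgap : ∀ s ∈ Set.Ioo (-c) c, IsUnit (T - (s : ℂ) • (1 : H →L[ℂ] H)))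
    (hM : ‖T‖ ≤ M) (hcM : c ≤ M) : ∃ P, IsSplitting T P c M := by
  have hspec : ∀ s ∈ spectrum ℝ T, c ≤ s ∨ s ≤ -c := by
    intro s hs
    by_contra! h
    apply hs
    rw [spectrum.mem_resolventSet_iff]
    have := (hgap s ⟨h.2, h.1⟩).neg
    have e : algebraMap ℝ (H →L[ℂ] H) s = (s : ℂ) • (1 : H →L[ℂ] H) := by
      rw [Algebra.algebraMap_eq_smul_one]; ext x; simp
    rwa [neg_sub, ← e] at this
  have hspecM : ∀ s ∈ spectrum ℝ T, -M ≤ s ∧ s ≤ M := by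
    intro s hs
    have h1 := spectrum.subset_closedBall_norm_mul (𝕜 := ℝ) T hs
    rw [mem_closedBall_zero_iff] at h1
    have h2 : ‖(1 : H →L[ℂ] H)‖ ≤ 1 := ContinuousLinearMap.norm_id_le
    have h3 : |s| ≤ M := h1.trans (by nlinarith [norm_nonneg T])
    exact abs_le.1 h3
  -- The jump of this step function lies in the gap, so it is continuous on the spectrum and the
  -- continuous functional calculus yields the positive spectral projection.
  let f : ℝ → ℝ := fun s => if 0 < s then 1 else 0
  have hf1 : ∀ s, c ≤ s → f s = 1 := fun s hs => if_pos (hc.trans_le hs)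
  have hf0 : ∀ s, s ≤ -c → f s = 0 := fun s hs => if_neg (by linarith)
  have hfc : ContinuousOn f (spectrum ℝ T) := by
    have h1 : ContinuousOn f (Set.Ici c) := continuousOn_const.congr fun s hs => hf1 s hs
    have h2 : ContinuousOn f (Set.Iic (-c)) := continuousOn_const.congr fun s hs => hf0 s hs
    exact (h1.union_of_isClosed h2 isClosed_Ici isClosed_Iic).mono fun s hs => hspec s hs
  have hid : cfc (fun s : ℝ => s) T = T := cfc_id' ℝ T
  have hTP : cfc (fun s => s * f s) T = T * cfc f T := by rw [cfc_mul _ _ T, hid]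
  have hQ : cfc (fun s => 1 - f s) T = 1 - cfc f T := by rw [cfc_sub _ _ T, cfc_const_one ℝ T]
  have hTQ : cfc (fun s => s * (1 - f s)) T = T * (1 - cfc f T) := by
    rw [cfc_mul _ _ T, hid, hQ]
  refine ⟨cfc f T, cfc_predicate f T, ?_, ?_, ?_, ?_, ?_⟩
  · rw [← cfc_mul _ _ T]
    refine cfc_congr fun s hs => ?_
    rcases hspec s hs with h | h
    · simp [hf1 s h]
    · simp [hf0 s h]
  · have := cfc_commute_cfc (fun s : ℝ => s) f T
    rwa [hid] at this
  · intro x hx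
    have h : cfc (fun s => c * f s) T ≤ cfc (fun s => s * f s) T := by
      refine cfc_mono fun s hs => ?_
      rcases hspec s hs with h | h
      · simp [hf1 s h, h]
      · simp [hf0 s h]
    rw [hTP, cfc_const_mul c f T] at h
    have := re_inner_le_of_le h x
    simpa [hx, re_inner_smul_self, re_inner_self', -inner_self_eq_norm_sq_to_K] using this
  · intro x hx
    have h : cfc (fun s => s * (1 - f s)) T ≤ cfc (fun s => (-c) * (1 - f s)) T := by
      refine cfc_mono fun s hs => ?_
      rcases hspec s hs with h | h
      · simp [hf1 s h]
      · simp [hf0 s h, h]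
    rw [hTQ, cfc_const_mul (-c) _ T, hQ] at h
    have := re_inner_le_of_le h x
    simpa [hx, re_inner_smul_self, re_inner_self', -neg_mul, -neg_smul, -inner_self_eq_norm_sq_to_K] using this
  · intro x hx
    -- The negative part of the spectrum lies in `[-M, -c]`, where `0 ≤ s + M ≤ M - c`; on the
    -- positive part the function vanishes.
    have h : ‖cfc (fun s => s * (1 - f s) + M * (1 - f s)) T‖ ≤ M - c := by
      refine norm_cfc_le (by linarith) fun s hs => ?_
      have := hspecM s hs
      rcases hspec s hs with h | h
      · simp [hf1 s h, hcM]
      · rw [hf0 s h, Real.norm_eq_abs, abs_le]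
        constructor <;> linarith
    rw [cfc_add T (fun s => s * (1 - f s)) (fun s => M * (1 - f s)), hTQ, cfc_const_mul M _ T, hQ]
      at h
    have := ContinuousLinearMap.le_of_opNorm_le _ h x
    simpa [hx] using this

variable {T T' P P' P₀ : H →L[ℂ] H} {c M : ℝ}

lemma IsSplitting.apply_apply (h : IsSplitting T P c M) (x : H) : P (P x) = P x :=
  congrArg (fun A : H →L[ℂ] H => A x) h.idem

lemma IsSplitting.apply_sub (h : IsSplitting T P c M) (x : H) : P (x - P x) = 0 := by
  rw [map_sub, h.apply_apply, sub_self]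

lemma IsSplitting.comm_apply (h : IsSplitting T P c M) (x : H) : T (P x) = P (T x) :=
  congrArg (fun A : H →L[ℂ] H => A x) h.comm

lemma IsSplitting.inner_apply (h : IsSplitting T P c M) (x y : H) :
    inner ℂ (P x) y = inner ℂ x (P y) := by
  rw [← ContinuousLinearMap.adjoint_inner_left, h.selfAdjoint.adjoint_eq]

lemma IsSplitting.norm_apply_le (h : IsSplitting T P c M) (x : H) : ‖P x‖ ≤ ‖x‖ := by
  have h1 : (inner ℂ (P x) x).re = ‖P x‖ ^ 2 := by
    rw [← re_inner_self', ← h.inner_apply, h.apply_apply]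
  have h2 := (Complex.re_le_norm _).trans (norm_inner_le_norm (𝕜 := ℂ) (P x) x)
  rw [h1] at h2
  by_contra! h3
  nlinarith [norm_nonneg x]

/-- If `T ≥ c` at `v` and `T ≤ -c` at `w`, then `T (v + w)` is bounded below. -/
lemma norm_add_le_of_definite (hT : IsSelfAdjoint T) (hc : 0 < c) {v w : H}
    (hv : c * ‖v‖ ^ 2 ≤ (inner ℂ (T v) v).re) (hw : (inner ℂ (T w) w).re ≤ -c * ‖w‖ ^ 2) :
    c / 2 * (‖v‖ + ‖w‖) ≤ ‖T (v + w)‖ := by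
  have hsym : (inner ℂ (T v) w).re = (inner ℂ (T w) v).re := by
    have : inner ℂ (T v) w = inner ℂ v (T w) := by
      rw [← ContinuousLinearMap.adjoint_inner_left, hT.adjoint_eq]
    rw [this, ← inner_conj_symm, Complex.conj_re]
  -- Testing against `v - w` cancels the cross terms and makes both diagonal terms positive.
  have h1 : (inner ℂ (T (v + w)) (v - w)).re
      = (inner ℂ (T v) v).re - (inner ℂ (T w) w).re := by
    simp only [map_add, inner_add_left, inner_sub_right, Complex.add_re, Complex.sub_re]
    linarith
  have h2 := (Complex.re_le_norm _).trans (norm_inner_le_norm (𝕜 := ℂ) (T (v + w)) (v - w))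
  have h3 : ‖v - w‖ ≤ ‖v‖ + ‖w‖ := norm_sub_le _ _
  have h4 : c * (‖v‖ ^ 2 + ‖w‖ ^ 2) ≤ ‖T (v + w)‖ * (‖v‖ + ‖w‖) := by
    have := mul_le_mul_of_nonneg_left h3 (norm_nonneg (T (v + w)))
    linarith
  rcases eq_or_lt_of_le (add_nonneg (norm_nonneg v) (norm_nonneg w)) with h | h
  · rw [← h, mul_zero]; exact norm_nonneg _
  · refine le_of_mul_le_mul_right ?_ h
    nlinarith [sq_nonneg (‖v‖ - ‖w‖)]

/-- The Davis–Kahan estimate for the product of opposite projections. -/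
lemma IsSplitting.norm_apply_le_of_near (h : IsSplitting T P c M) (h' : IsSplitting T' P' c M)
    (hc : 0 < c) (hcM : c ≤ M) {η : ℝ} (hη : ‖T' - T‖ ≤ η) {w : H} (hw : P w = 0) :
    ‖P' w‖ ≤ η / (2 * c) * ‖w‖ := by
  have hη0 : 0 ≤ η := (norm_nonneg _).trans hη
  -- `X` satisfies a Sylvester equation: with `q = z - P z`, `(T' + M) X z = X (T + M) q + P' (T' -
  -- T) q`. On the range of `P'` the operator `T' + M` is bounded below by `M + c`, and on the
  -- kernel of `P` the operator `T + M` is bounded by `M - c`. Hence `(M + c) ‖X‖ ≤ (M - c) ‖X‖ +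
  -- η`.
  set X : H →L[ℂ] H := P' * (1 - P) with hX
  have hlow : ∀ u, P' u = u → (M + c) * ‖u‖ ≤ ‖T' u + (M : ℂ) • u‖ := by
    intro u hu
    have h1 := h'.pos u hu
    have h2 := (Complex.re_le_norm _).trans (norm_inner_le_norm (𝕜 := ℂ) (T' u + (M : ℂ) • u) u)
    have h3 : (inner ℂ (T' u + (M : ℂ) • u) u).re = (inner ℂ (T' u) u).re + M * ‖u‖ ^ 2 := by
      rw [inner_add_left, inner_smul_left, Complex.add_re, Complex.conj_ofReal,
        Complex.re_ofReal_mul, re_inner_self']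
    rcases eq_or_lt_of_le (norm_nonneg u) with h | h
    · rw [← h, mul_zero]; exact norm_nonneg _
    · refine le_of_mul_le_mul_right ?_ h
      nlinarith
  have key : ∀ z, (M + c) * ‖X z‖ ≤ (‖X‖ * (M - c) + η) * ‖z‖ := by
    intro z
    set q := z - P z with hq
    have hPq : P q = 0 := h.apply_sub z
    have hXz : X z = P' q := by simp [hX, hq]
    have hXq : X (T q + (M : ℂ) • q) = P' (T q + (M : ℂ) • q) := by
      have : P (T q + (M : ℂ) • q) = 0 := by
        rw [map_add, map_smul, hPq, ← h.comm_apply, hPq]; simp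
      change P' (T q + (M : ℂ) • q - P (T q + (M : ℂ) • q)) = _
      rw [this, sub_zero]
    have hqz : ‖q‖ ≤ ‖z‖ := by
      have h1 : (inner ℂ q z).re = ‖q‖ ^ 2 := by
        rw [← re_inner_self']
        conv_rhs => rw [hq, inner_sub_right, ← h.inner_apply, ← hq, hPq, inner_zero_left, sub_zero]
      have h2 := (Complex.re_le_norm _).trans (norm_inner_le_norm (𝕜 := ℂ) q z)
      rw [h1] at h2
      by_contra! h3
      nlinarith [norm_nonneg z]
    have h1 := hlow (X z) (by rw [hXz, h'.apply_apply])
    have e : T' (X z) + (M : ℂ) • X z = X (T q + (M : ℂ) • q) + P' ((T' - T) q) := by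
      rw [hXq, hXz, h'.comm_apply, ← map_smul, ← map_add, ← map_add]
      congr 1
      simp only [sub_apply]
      abel
    rw [e] at h1
    have h2 : ‖X (T q + (M : ℂ) • q)‖ ≤ ‖X‖ * ((M - c) * ‖z‖) := by
      refine (X.le_opNorm _).trans (mul_le_mul_of_nonneg_left ((h.shift q hPq).trans ?_)
        (norm_nonneg _))
      exact mul_le_mul_of_nonneg_left hqz (by linarith)
    have h3 : ‖P' ((T' - T) q)‖ ≤ η * ‖z‖ := by
      refine (h'.norm_apply_le _).trans ((ContinuousLinearMap.le_of_opNorm_le _ hη q).trans ?_)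
      exact mul_le_mul_of_nonneg_left hqz hη0
    have h4 := norm_add_le (X (T q + (M : ℂ) • q)) (P' ((T' - T) q))
    linarith
  have hXn : ‖X‖ ≤ (‖X‖ * (M - c) + η) / (M + c) := by
    refine X.opNorm_le_bound (div_nonneg (add_nonneg (mul_nonneg (norm_nonneg _)
      (by linarith)) hη0) (by linarith)) fun z => ?_
    rw [div_mul_eq_mul_div, le_div_iff₀ (by linarith)]
    linarith [key z]
  have hXn' : ‖X‖ ≤ η / (2 * c) := by
    rw [le_div_iff₀ (by linarith)] at hXn ⊢
    linarith
  have hXw : X w = P' w := by simp [hX, hw]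
  rw [← hXw]
  exact ContinuousLinearMap.le_of_opNorm_le _ hXn' w

/-- Every vector is approximated by sums of a vector in the range of `P₀` and one in the kernel of
`P`, if the kernel of `P₀` and the range of `P` meet trivially. -/
lemma IsSplitting.exists_near (h₀ : IsSplitting T' P₀ c M) (h : IsSplitting T P c M)
    (hdis : ∀ x, P₀ x = 0 → P x = x → x = 0) (x : H) {ε : ℝ} (hε : 0 < ε) :
    ∃ v w, P₀ v = v ∧ P w = 0 ∧ ‖x - (v + w)‖ < ε := by
  let K : Submodule ℂ H := (P₀ : H →ₗ[ℂ] H).range ⊔ (P : H →ₗ[ℂ] H).ker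
  -- Both projections are self-adjoint, so a vector orthogonal to `K` is killed by `P₀` and fixed by
  -- `P`.
  have hK : K.topologicalClosure = ⊤ := by
    rw [Submodule.topologicalClosure_eq_top_iff, Submodule.eq_bot_iff]
    intro y hy
    rw [Submodule.mem_orthogonal] at hy
    apply hdis
    · have := hy (P₀ (P₀ y)) (Submodule.mem_sup_left ⟨P₀ y, rfl⟩)
      rw [h₀.inner_apply] at this
      exact inner_self_eq_zero.1 this
    · have := hy (y - P y) (Submodule.mem_sup_right (h.apply_sub y))
      have h2 : inner ℂ (y - P y) (P y) = 0 := by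
        rw [← h.inner_apply, h.apply_sub, inner_zero_left]
      have h3 : inner ℂ (y - P y) (y - P y) = 0 := by
        rw [inner_sub_right, this, h2, sub_zero]
      exact (sub_eq_zero.1 (inner_self_eq_zero.1 h3)).symm
  have hx : x ∈ closure (K : Set H) := by
    rw [← Submodule.topologicalClosure_coe, hK]; trivial
  obtain ⟨y, hy, hxy⟩ := Metric.mem_closure_iff.1 hx ε hε
  obtain ⟨v, ⟨v', rfl⟩, w, hw, rfl⟩ := Submodule.mem_sup.1 hy
  exact ⟨P₀ v', w, h₀.apply_apply v', hw, by rwa [← dist_eq_norm]⟩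

/-- One step of the continuation of a splitting along an increasing chain of operators. -/
lemma IsSplitting.disjoint_step {T₀ : H →L[ℂ] H} (h₀ : IsSplitting T₀ P₀ c M)
    (h : IsSplitting T P c M) (h' : IsSplitting T' P' c M) (hT : IsSelfAdjoint T)
    (h0T : T₀ ≤ T) (hM : ‖T‖ ≤ M) (hc : 0 < c) (hcM : c ≤ M) {η : ℝ} (hη : ‖T' - T‖ ≤ η)
    (hη' : η * M < c ^ 2) (hdis : ∀ x, P₀ x = 0 → P x = x → x = 0) :
    ∀ x, P₀ x = 0 → P' x = x → x = 0 := by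
  intro x hx0 hx'
  by_contra hne
  have hxn : 0 < ‖x‖ := norm_pos_iff.2 hne
  have hη0 : 0 ≤ η := (norm_nonneg _).trans hη
  have hM0 : 0 < M := hc.trans_le hcM
  -- Approximate `x` by `v + w` with `v` in the range of `P₀` and `w` in the kernel of `P`. Since `x
  -- ⊥ v`, `‖x‖²` is nearly `⟪x, w⟫ = ⟪x, P' w⟫`, and `P' w` is small by Davis–Kahan. The norm of
  -- `w` is controlled because `T ≥ T₀` is positive at `v` and negative at `w`. The constants `η /
  -- (2c)` and `2M / c` multiply to `ηM / c²`.
  have bound : ∀ ε, 0 < ε → ‖x‖ ^ 2 ≤ ‖x‖ * ε + η * M / c ^ 2 * ‖x‖ * (‖x‖ + ε) := by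
    intro ε hε
    obtain ⟨v, w, hv, hw, hvw⟩ := h₀.exists_near h hdis x hε
    have h1 := norm_add_le_of_definite hT hc ((h₀.pos v hv).trans (re_inner_le_of_le h0T v))
      (h.neg w hw)
    have h2 : ‖v + w‖ ≤ ‖x‖ + ε := by
      have := norm_sub_norm_le (v + w) x
      rw [norm_sub_rev] at this
      linarith
    have h3 : ‖w‖ ≤ 2 * M / c * (‖x‖ + ε) := by
      have h4 : ‖T (v + w)‖ ≤ M * (‖x‖ + ε) :=
        (ContinuousLinearMap.le_of_opNorm_le _ hM _).trans (mul_le_mul_of_nonneg_left h2 hM0.le)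
      rw [div_mul_eq_mul_div, le_div_iff₀ hc]
      nlinarith [mul_nonneg hc.le (norm_nonneg v)]
    have h4 : inner ℂ x v = 0 := by
      rw [← hv, ← h₀.inner_apply, hx0, inner_zero_left]
    have h5 : inner ℂ x w = inner ℂ x (P' w) := by rw [← h'.inner_apply, hx']
    have h6 : ‖(inner ℂ x w : ℂ)‖ ≤ ‖x‖ * (η / (2 * c) * (2 * M / c * (‖x‖ + ε))) := by
      rw [h5]
      refine (norm_inner_le_norm _ _).trans (mul_le_mul_of_nonneg_left ?_ hxn.le)
      exact (h.norm_apply_le_of_near h' hc hcM hη hw).trans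
        (mul_le_mul_of_nonneg_left h3 (by positivity))
    have h7 : ‖x‖ ^ 2 = (inner ℂ x (x - (v + w)) + inner ℂ x w).re := by
      rw [← re_inner_self', inner_sub_right, inner_add_right, h4]
      congr 1; ring
    have h8 : ‖(inner ℂ x (x - (v + w)) : ℂ)‖ ≤ ‖x‖ * ε :=
      (norm_inner_le_norm _ _).trans (mul_le_mul_of_nonneg_left hvw.le hxn.le)
    rw [h7]
    refine (Complex.re_le_norm _).trans ((norm_add_le _ _).trans (add_le_add h8 (h6.trans_eq ?_)))
    field_simp
  have hθ : η * M / c ^ 2 < 1 := by rwa [div_lt_one (by positivity)]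
  have hθ0 : 0 ≤ η * M / c ^ 2 := by positivity
  set θ := η * M / c ^ 2
  -- With this `ε` the right side is `(θ + (1 + θ)(1 - θ) / 4) ‖x‖²`, which is less than `‖x‖²`
  -- because `θ < 1`.
  have := bound ((1 - θ) * ‖x‖ / 4) (by have := sub_pos.2 hθ; positivity)
  nlinarith [mul_pos (sub_pos.2 hθ) (mul_pos hxn hxn)]

/-- The lower bound makes `S` antilipschitz, and the orthogonal complement of its range is its
kernel, which is trivial. -/
lemma isUnit_of_selfAdjoint_of_le_norm {S : H →L[ℂ] H} (hS : IsSelfAdjoint S) (hc : 0 < c)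
    (h : ∀ x, c * ‖x‖ ≤ ‖S x‖) : IsUnit S := by
  rw [ContinuousLinearMap.isUnit_iff_bijective,
    ContinuousLinearMap.bijective_iff_dense_range_and_antilipschitz]
  refine ⟨?_, (c⁻¹).toNNReal, ?_⟩
  · rw [Submodule.topologicalClosure_eq_top_iff, Submodule.eq_bot_iff]
    intro x hx
    have h0 : S x = 0 := by
      have := hx (S (S x)) ⟨S x, rfl⟩
      rw [← ContinuousLinearMap.adjoint_inner_right, hS.adjoint_eq] at this
      exact inner_self_eq_zero.1 this
    have := h x
    rw [h0, norm_zero] at this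
    exact norm_le_zero_iff.1 (by nlinarith)
  · refine ContinuousLinearMap.antilipschitz_of_bound _ fun x => ?_
    rw [Real.coe_toNNReal _ (by positivity), inv_mul_eq_div, le_div_iff₀ hc]
    linarith [h x]

/-- Gaps are preserved between the ends of an increasing chain of self-adjoint operators with
small steps, all of which have the gap `(-c, c)`. -/
theorem isUnit_of_chain {N : ℕ} {T : ℕ → H →L[ℂ] H} {S : H →L[ℂ] H} {c M η : ℝ} (hc : 0 < c)
    (hcM : c ≤ M) (hηM : η * M < c ^ 2)
    (hT : ∀ i ≤ N, IsSelfAdjoint (T i)) (hM : ∀ i ≤ N, ‖T i‖ ≤ M)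
    (hgap : ∀ i ≤ N, ∀ s ∈ Set.Ioo (-c) c, IsUnit (T i - (s : ℂ) • (1 : H →L[ℂ] H)))
    (hmono : ∀ i < N, T i ≤ T (i + 1)) (hη : ∀ i < N, ‖T (i + 1) - T i‖ ≤ η)
    (hS : IsSelfAdjoint S) (h0S : T 0 ≤ S) (hSN : S ≤ T N) : IsUnit S := by
  have hex : ∀ i ≤ N, ∃ P, IsSplitting (T i) P c M := fun i hi =>
    exists_isSplitting (hT i hi) hc (hgap i hi) (hM i hi) hcM
  choose! P hP using hex
  have hle : ∀ i ≤ N, T 0 ≤ T i := by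
    intro i
    induction i with
    | zero => exact fun _ => le_rfl
    | succ i ih => exact fun hi => (ih (by omega)).trans (hmono i (by omega))
  have hdis : ∀ i ≤ N, ∀ x, P 0 x = 0 → P i x = x → x = 0 := by
    intro i
    induction i with
    | zero => intro _ x h0 h1; rw [← h1, h0]
    | succ i ih =>
      intro hi
      exact (hP 0 (by omega)).disjoint_step (hP i (by omega)) (hP (i + 1) hi) (hT i (by omega))
        (hle i (by omega)) (hM i (by omega)) hc hcM (hη i (by omega)) hηM (ih (by omega))
  refine isUnit_of_selfAdjoint_of_le_norm hS (half_pos hc) fun x => ?_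
  refine le_of_forall_pos_le_add fun ε hε => ?_
  -- Replacing `x` by an approximation `y` costs `c / 2 * ‖x - y‖` on the left and `‖S‖ * ‖x - y‖`
  -- on the right.
  have hk : 0 < c / 2 + ‖S‖ := by positivity
  obtain ⟨v, w, hv, hw, hvw⟩ := (hP 0 (by omega)).exists_near (hP N le_rfl) (hdis N le_rfl) x
    (div_pos hε hk)
  -- No gap of `S` is used: positivity at `v` comes from `T 0 ≤ S`, negativity at `w` from `S ≤ T
  -- N`.
  have h1 := norm_add_le_of_definite hS hc
    (((hP 0 (by omega)).pos v hv).trans (re_inner_le_of_le h0S v))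
    ((re_inner_le_of_le hSN w).trans ((hP N le_rfl).neg w hw))
  have h2 : ‖x‖ ≤ ‖x - (v + w)‖ + (‖v‖ + ‖w‖) := by
    have := norm_add_le (x - (v + w)) (v + w)
    rw [sub_add_cancel] at this
    linarith [norm_add_le v w]
  have h3 : ‖S (v + w)‖ ≤ ‖S x‖ + ‖S‖ * ‖x - (v + w)‖ := by
    have e : S (v + w) = S x - S (x - (v + w)) := by rw [← map_sub, sub_sub_cancel]
    rw [e]
    exact (norm_sub_le _ _).trans (add_le_add_right (S.le_opNorm _) _)
  have h4 : (c / 2 + ‖S‖) * ‖x - (v + w)‖ ≤ ε := by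
    have := mul_le_mul_of_nonneg_left hvw.le hk.le
    rwa [mul_div_cancel₀ _ hk.ne'] at this
  nlinarith

end SpectralSplitting

section

open scoped ContDiff

/-! ### The resolvent of a divergence-form operator and its variational principle -/

section Resolvent

variable {d : ℕ}

/-- A measurable coefficient with values in `[κ, 1]`. -/
structure IsCoeff (a : Space d → ℝ) (κ : ℝ) : Prop where
  measurable : Measurable a
  ge : ∀ x, κ ≤ a x
  le : ∀ x, a x ≤ 1

lemma memLp_mul_of_bounded {a : Space d → ℝ} {κ : ℝ} (ha : IsCoeff a κ) (hκ : 0 < κ)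
    (g : L2Vec d) : MemLp (fun x => (a x : ℂ) • g x) 2 (volume : Measure (Space d)) := by
  refine (Lp.memLp g).of_le ?_ (Filter.Eventually.of_forall fun x => ?_)
  · exact (Complex.measurable_ofReal.comp ha.measurable).aestronglyMeasurable.smul
      (Lp.aestronglyMeasurable g)
  · rw [norm_smul, Complex.norm_real, Real.norm_of_nonneg (hκ.le.trans (ha.ge x))]
    exact mul_le_of_le_one_left (norm_nonneg _) (ha.le x)

/-- Multiplication of square-integrable fields by a bounded coefficient. -/
lemma exists_mulCoeff {a : Space d → ℝ} {κ : ℝ} (ha : IsCoeff a κ) (hκ : 0 < κ) :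
    ∃ A : L2Vec d →L[ℂ] L2Vec d, ∀ g, (A g : Space d → EuclideanSpace ℂ (Fin d)) =ᵐ[volume]
      fun x => (a x : ℂ) • g x := by
  have hm := fun g => memLp_mul_of_bounded ha hκ g
  refine ⟨LinearMap.mkContinuous
    { toFun := fun g => (hm g).toLp _
      map_add' := fun g h => ?_
      map_smul' := fun c g => ?_ } 1 fun g => ?_, fun g => (hm g).coeFn_toLp⟩
  · apply Lp.ext
    filter_upwards [(hm (g + h)).coeFn_toLp, (hm g).coeFn_toLp, (hm h).coeFn_toLp,
      Lp.coeFn_add g h, Lp.coeFn_add ((hm g).toLp _) ((hm h).toLp _)] with x h1 h2 h3 h4 h5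
    rw [h1, h5, Pi.add_apply, h2, h3, h4, Pi.add_apply, smul_add]
  · apply Lp.ext
    filter_upwards [(hm (c • g)).coeFn_toLp, (hm g).coeFn_toLp,
      Lp.coeFn_smul c g, Lp.coeFn_smul c ((hm g).toLp _)] with x h1 h2 h4 h5
    rw [h1, RingHom.id_apply, h5, Pi.smul_apply, h2, h4, Pi.smul_apply, smul_comm]
  · rw [one_mul]
    refine Lp.norm_le_norm_of_ae_le ?_
    filter_upwards [(hm g).coeFn_toLp] with x hx
    change ‖((hm g).toLp _ : Space d → _) x‖ ≤ _
    rw [hx, norm_smul, Complex.norm_real, Real.norm_of_nonneg (hκ.le.trans (ha.ge x))]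
    exact mul_le_of_le_one_left (norm_nonneg _) (ha.le x)

/-- Pairs of a function and its weak gradient. -/
def gradGraph (d : ℕ) : Submodule ℂ (WithLp 2 (L2 d × L2Vec d)) where
  carrier := {p | IsWeakGradient p.fst p.snd}
  add_mem' := fun hp hq => hp.add hq
  zero_mem' := isWeakGradient_zero
  smul_mem' := fun c _ hp => hp.smul c

/-- For each test function the relation equates two continuous functionals of the pair. Closedness
makes the graph a Hilbert space, as inverting a coercive form on it requires. -/
lemma isClosed_gradGraph (d : ℕ) : IsClosed (gradGraph d : Set (WithLp 2 (L2 d × L2Vec d))) := by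
  have e : (gradGraph d : Set (WithLp 2 (L2 d × L2Vec d))) =
      ⋂ (φ : Space d → ℝ) (_ : ContDiff ℝ ∞ φ) (_ : HasCompactSupport φ) (i : Fin d),
        {p | ∫ x, φ x • (p.snd x) i
          = - ∫ x, (fderiv ℝ φ x (EuclideanSpace.single i (1 : ℝ))) • p.fst x} := by
    ext p; simp [gradGraph, IsWeakGradient]
  rw [e]
  refine isClosed_iInter fun φ => isClosed_iInter fun hφ => isClosed_iInter fun hc =>
    isClosed_iInter fun i => ?_
  have hΦ : MemLp (fun x => EuclideanSpace.single i ((φ x : ℝ) : ℂ)) 2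
      (volume : Measure (Space d)) := by
    refine Continuous.memLp_of_hasCompactSupport ?_ ?_
    · have h : Isometry (fun t : ℂ => EuclideanSpace.single i t) :=
        Isometry.of_dist_eq fun s t => PiLp.dist_single_same 2 (fun _ : Fin d => ℂ) i s t
      exact h.continuous.comp (Complex.continuous_ofReal.comp hφ.continuous)
    · exact hc.comp_left (g := fun t : ℝ => EuclideanSpace.single i (t : ℂ)) (by simp)
  set e := EuclideanSpace.single i (1 : ℝ)
  have hΨ : MemLp (fun x => ((fderiv ℝ φ x e : ℝ) : ℂ)) 2 (volume : Measure (Space d)) := by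
    refine Continuous.memLp_of_hasCompactSupport ?_ ?_
    · exact Complex.continuous_ofReal.comp
        ((hφ.continuous_fderiv (by simp)).clm_apply continuous_const)
    · exact (hc.fderiv_apply (𝕜 := ℝ) e).comp_left (g := fun t : ℝ => (t : ℂ)) (by simp)
  have h1 : ∀ p : WithLp 2 (L2 d × L2Vec d),
      ∫ x, φ x • (p.snd x) i = inner ℂ (hΦ.toLp _) p.snd := by
    intro p
    rw [L2.inner_def]
    refine integral_congr_ae ?_
    filter_upwards [hΦ.coeFn_toLp] with x hx
    rw [hx, EuclideanSpace.inner_single_left]; simp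
  have h2 : ∀ p : WithLp 2 (L2 d × L2Vec d),
      ∫ x, (fderiv ℝ φ x e) • p.fst x = inner ℂ (hΨ.toLp _) p.fst := by
    intro p
    rw [L2.inner_def]
    refine integral_congr_ae ?_
    filter_upwards [hΨ.coeFn_toLp] with x hx
    rw [hx]; simp [mul_comm]
  simp_rw [h1, h2]
  refine isClosed_eq ?_ ?_
  · exact continuous_const.inner (WithLp.sndL 2 ℂ (L2 d) (L2Vec d)).continuous
  · exact (continuous_const.inner (WithLp.fstL 2 ℂ (L2 d) (L2Vec d)).continuous).neg

instance (d : ℕ) : CompleteSpace (gradGraph d) :=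
  (isClosed_gradGraph d).completeSpace_coe

/-- `R` solves the shifted equation: `(A + m) R f = f` in the weak sense. -/
def IsWeakResolvent (a : Space d → ℝ) (m : ℝ) (R : L2 d →L[ℂ] L2 d) : Prop :=
  ∀ f, ∃ u : H1 d, (u : L2 d) = R f ∧ ∀ v : H1 d,
    (∫ x, formIntegrand a u v x) + (m : ℂ) * inner ℂ (v : L2 d) (u : L2 d)
      = inner ℂ (v : L2 d) f

lemma formIntegrand_ae {a : Space d → ℝ} {A : L2Vec d →L[ℂ] L2Vec d}
    (hA : ∀ g, (A g : Space d → EuclideanSpace ℂ (Fin d)) =ᵐ[volume] fun x => (a x : ℂ) • g x)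
    (u v : H1 d) :
    (fun x => inner ℂ (grad v x) (A (grad u) x)) =ᵐ[volume] formIntegrand a u v := by
  filter_upwards [hA (grad u)] with x hx
  rw [hx, inner_smul_right, formIntegrand]

lemma integrable_formIntegrand {a : Space d → ℝ} {κ : ℝ} (ha : IsCoeff a κ) (hκ : 0 < κ)
    (u v : H1 d) : Integrable (formIntegrand a u v) := by
  obtain ⟨A, hA⟩ := exists_mulCoeff ha hκ
  exact (L2.integrable_inner (𝕜 := ℂ) (grad v) (A (grad u))).congr (formIntegrand_ae hA u v)

set_option maxHeartbeats 800000 in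
-- Lax–Milgram on the graph of the gradient. With `J` and `D` the projections to the function and
-- its gradient, `B = m J* J + D* A D` is coercive with constant `min κ m`, and `J B⁻¹ J*` is the
-- resolvent.
lemma exists_isWeakResolvent {a : Space d → ℝ} {κ m : ℝ} (ha : IsCoeff a κ) (hκ : 0 < κ)
    (hm : 0 < m) : ∃ R : L2 d →L[ℂ] L2 d, IsWeakResolvent a m R := by
  obtain ⟨A, hA⟩ := exists_mulCoeff ha hκ
  let J : gradGraph d →L[ℂ] L2 d := (WithLp.fstL 2 ℂ (L2 d) (L2Vec d)).comp (gradGraph d).subtypeL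
  let D : gradGraph d →L[ℂ] L2Vec d :=
    (WithLp.sndL 2 ℂ (L2 d) (L2Vec d)).comp (gradGraph d).subtypeL
  let B : gradGraph d →L[ℂ] gradGraph d :=
    (m : ℂ) • (ContinuousLinearMap.adjoint J).comp J +
      (ContinuousLinearMap.adjoint D).comp (A.comp D)
  have hB : ∀ p q, inner ℂ q (B p) = (m : ℂ) * inner ℂ (J q) (J p) + inner ℂ (D q) (A (D p)) := by
    intro p q
    have h1 := inner_smul_right (𝕜 := ℂ) q (ContinuousLinearMap.adjoint J (J p)) (m : ℂ)
    rw [ContinuousLinearMap.adjoint_inner_right] at h1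
    rw [← h1, ← ContinuousLinearMap.adjoint_inner_right D, ← inner_add_right]
    rfl
  have hnorm : ∀ p : gradGraph d, ‖p‖ ^ 2 = ‖J p‖ ^ 2 + ‖D p‖ ^ 2 := fun p =>
    WithLp.prod_norm_sq_eq_of_L2 (p : WithLp 2 (L2 d × L2Vec d))
  have hAκ : ∀ g, κ * ‖g‖ ^ 2 ≤ (inner ℂ g (A g)).re := by
    intro g
    rw [← re_inner_self', L2.inner_def, L2.inner_def]
    have i1 := L2.integrable_inner (𝕜 := ℂ) g g
    have i2 := L2.integrable_inner (𝕜 := ℂ) g (A g)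
    simp only [← RCLike.re_eq_complex_re]
    rw [← integral_re i1, ← integral_re i2, ← integral_const_mul]
    refine integral_mono_ae (i1.re.const_mul κ) i2.re ?_
    filter_upwards [hA g] with x hx
    simp only [hx, inner_smul_right, RCLike.re_eq_complex_re, Complex.re_ofReal_mul]
    refine mul_le_mul_of_nonneg_right (ha.ge x) ?_
    rw [re_inner_self']; positivity
  have hunit : IsUnit B := by
    have hκm : 0 < min κ m := lt_min hκ hm
    refine ContinuousLinearMap.isUnit_of_forall_le_norm_inner_map B (c := ⟨min κ m, hκm.le⟩) hκm
      fun p => ?_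
    rw [norm_inner_symm]
    refine le_trans ?_ (Complex.re_le_norm _)
    rw [hB, Complex.add_re, Complex.re_ofReal_mul, re_inner_self', hnorm]
    have h1 := hAκ (D p)
    have h2 : min κ m * ‖D p‖ ^ 2 ≤ κ * ‖D p‖ ^ 2 :=
      mul_le_mul_of_nonneg_right (min_le_left _ _) (by positivity)
    have h3 : min κ m * ‖J p‖ ^ 2 ≤ m * ‖J p‖ ^ 2 :=
      mul_le_mul_of_nonneg_right (min_le_right _ _) (by positivity)
    change (‖J p‖ ^ 2 + ‖D p‖ ^ 2) * min κ m ≤ _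
    linarith
  obtain ⟨U, hU⟩ := hunit
  let Binv : gradGraph d →L[ℂ] gradGraph d := ((U⁻¹ : (gradGraph d →L[ℂ] gradGraph d)ˣ) : _)
  have hinv : ∀ p, B (Binv p) = p := fun p => by
    rw [← hU]; exact congrArg (fun S : gradGraph d →L[ℂ] gradGraph d => S p) U.mul_inv
  refine ⟨J.comp (Binv.comp (ContinuousLinearMap.adjoint J)), fun f => ?_⟩
  set p := Binv (ContinuousLinearMap.adjoint J f) with hp
  let u : H1 d := ⟨J p, D p, p.2⟩
  have hu : grad u = D p := (isWeakGradient_grad u).unique p.2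
  refine ⟨u, rfl, fun v => ?_⟩
  let q : gradGraph d := ⟨WithLp.toLp 2 ((v : L2 d), grad v), isWeakGradient_grad v⟩
  have h1 := hB p q
  rw [hp, hinv, ContinuousLinearMap.adjoint_inner_right, ← hp, L2.inner_def (D q), ← hu] at h1
  rw [← integral_congr_ae (formIntegrand_ae hA u v), add_comm]
  exact h1.symm

lemma formIntegrand_conj (a : Space d → ℝ) (u v : H1 d) (x : Space d) :
    starRingEnd ℂ (formIntegrand a u v x) = formIntegrand a v u x := by
  rw [formIntegrand, map_mul, Complex.conj_ofReal, inner_conj_symm, formIntegrand]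

/-- The energy `∫ a |∇u|²`. -/
def energy (a : Space d → ℝ) (u : H1 d) : ℝ := ∫ x, a x * ‖grad u x‖ ^ 2

lemma formIntegrand_self (a : Space d → ℝ) (u : H1 d) (x : Space d) :
    formIntegrand a u u x = ((a x * ‖grad u x‖ ^ 2 : ℝ) : ℂ) := by
  rw [formIntegrand, inner_self_eq_norm_sq_to_K]; push_cast; rfl

lemma integral_formIntegrand_self (a : Space d → ℝ) (u : H1 d) :
    ∫ x, formIntegrand a u u x = (energy a u : ℂ) := by
  simp_rw [formIntegrand_self]
  rw [integral_complex_ofReal, energy]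

lemma integrable_energy {a : Space d → ℝ} {κ : ℝ} (ha : IsCoeff a κ) (hκ : 0 < κ)
    (u : H1 d) : Integrable fun x => a x * ‖grad u x‖ ^ 2 := by
  have := (integrable_formIntegrand ha hκ u u).re
  simp only [formIntegrand_self, RCLike.re_eq_complex_re, Complex.ofReal_re] at this
  exact this

lemma energy_nonneg {a : Space d → ℝ} {κ : ℝ} (ha : IsCoeff a κ) (hκ : 0 < κ) (u : H1 d) :
    0 ≤ energy a u :=
  integral_nonneg fun x => mul_nonneg (hκ.le.trans (ha.ge x)) (by positivity)

lemma energy_mono {a b : Space d → ℝ} {κ : ℝ} (ha : IsCoeff a κ) (hb : IsCoeff b κ) (hκ : 0 < κ)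
    (hab : ∀ x, a x ≤ b x) (u : H1 d) : energy a u ≤ energy b u :=
  integral_mono (integrable_energy ha hκ u) (integrable_energy hb hκ u) fun x =>
    mul_le_mul_of_nonneg_right (hab x) (by positivity)

lemma integral_formIntegrand_sub_left {a : Space d → ℝ} {κ : ℝ} (ha : IsCoeff a κ) (hκ : 0 < κ)
    (u u' v : H1 d) : ∫ x, formIntegrand a (u - u') v x
      = (∫ x, formIntegrand a u v x) - ∫ x, formIntegrand a u' v x := by
  have e := (formIntegrand_add a (u - u') u' v)
  rw [sub_add_cancel] at e
  rw [integral_congr_ae e, integral_add' (integrable_formIntegrand ha hκ _ _)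
    (integrable_formIntegrand ha hκ _ _), add_sub_cancel_right]

lemma integral_formIntegrand_conj (a : Space d → ℝ) (u v : H1 d) :
    starRingEnd ℂ (∫ x, formIntegrand a u v x) = ∫ x, formIntegrand a v u x := by
  rw [← integral_conj]
  simp_rw [formIntegrand_conj]

lemma energy_sub {a : Space d → ℝ} {κ : ℝ} (ha : IsCoeff a κ) (hκ : 0 < κ) (u w : H1 d) :
    energy a (u - w) = energy a u - 2 * (∫ x, formIntegrand a u w x).re + energy a w := by
  have h : (energy a (u - w) : ℂ) = (energy a u : ℂ) - (∫ x, formIntegrand a u w x)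
      - starRingEnd ℂ (∫ x, formIntegrand a u w x) + energy a w := by
    rw [← integral_formIntegrand_self, integral_formIntegrand_sub_left ha hκ,
      ← integral_formIntegrand_conj a (u - w) u, ← integral_formIntegrand_conj a (u - w) w,
      integral_formIntegrand_sub_left ha hκ, integral_formIntegrand_sub_left ha hκ,
      integral_formIntegrand_self, integral_formIntegrand_self, map_sub, map_sub,
      Complex.conj_ofReal, Complex.conj_ofReal, integral_formIntegrand_conj a w u]
    ring
  have := congrArg Complex.re h
  simp only [Complex.add_re, Complex.sub_re, Complex.ofReal_re, Complex.conj_re] at this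
  linarith

section WeakResolvent

variable {a b : Space d → ℝ} {κ m : ℝ} {R R' : L2 d →L[ℂ] L2 d}

lemma IsWeakResolvent.re_inner (hR : IsWeakResolvent a m R) {f : L2 d} {u : H1 d}
    (hu : (u : L2 d) = R f) : (inner ℂ (R f) f).re = energy a u + m * ‖R f‖ ^ 2 := by
  obtain ⟨u', hu', h⟩ := hR f
  obtain rfl : u = u' := Subtype.ext (hu.trans hu'.symm)
  rw [← hu, ← h u, integral_formIntegrand_self, Complex.add_re, Complex.re_ofReal_mul,
    re_inner_self', Complex.ofReal_re]

/-- The variational principle for the resolvent. -/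
lemma IsWeakResolvent.variational (hR : IsWeakResolvent a m R) (ha : IsCoeff a κ) (hκ : 0 < κ)
    (hm : 0 < m) (f : L2 d) (w : H1 d) :
    2 * (inner ℂ (w : L2 d) f).re - energy a w - m * ‖(w : L2 d)‖ ^ 2
      ≤ (inner ℂ (R f) f).re := by
  obtain ⟨u, hu, h⟩ := hR f
  rw [hR.re_inner hu, ← h w, ← hu, Complex.add_re, Complex.re_ofReal_mul]
  -- Completing the square: the two sides differ by `energy a (u - w) + m ‖u - w‖²`.
  have h1 := energy_nonneg ha hκ (u - w)
  rw [energy_sub ha hκ] at h1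
  have h2 : 0 ≤ ‖(u : L2 d) - w‖ ^ 2 := by positivity
  rw [@norm_sub_sq ℂ, ← inner_re_symm, RCLike.re_eq_complex_re] at h2
  nlinarith

/-- The equality case of the variational principle. -/
lemma IsWeakResolvent.re_inner_eq (hR : IsWeakResolvent a m R) {f : L2 d} {u : H1 d}
    (hu : (u : L2 d) = R f) : (inner ℂ (R f) f).re
      = 2 * (inner ℂ (u : L2 d) f).re - energy a u - m * ‖(u : L2 d)‖ ^ 2 := by
  have := hR.re_inner hu
  rw [hu]; linarith

lemma IsWeakResolvent.isSelfAdjoint (hR : IsWeakResolvent a m R) : IsSelfAdjoint R := by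
  rw [ContinuousLinearMap.isSelfAdjoint_iff_isSymmetric]
  intro f g
  obtain ⟨u, hu, h⟩ := hR f
  obtain ⟨w, hw, h'⟩ := hR g
  change inner ℂ (R f) g = inner ℂ f (R g)
  rw [← inner_conj_symm f, ← hu, ← hw, ← h' u, ← h w, map_add, map_mul, Complex.conj_ofReal,
    inner_conj_symm, integral_formIntegrand_conj]

lemma IsWeakResolvent.norm_apply_le (hR : IsWeakResolvent a m R) (ha : IsCoeff a κ) (hκ : 0 < κ)
    (hm : 0 < m) (f : L2 d) : ‖R f‖ ≤ m⁻¹ * ‖f‖ := by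
  obtain ⟨u, hu, -⟩ := hR f
  have h1 := hR.re_inner hu
  have h2 := energy_nonneg ha hκ u
  have h3 := (Complex.re_le_norm _).trans (norm_inner_le_norm (𝕜 := ℂ) (R f) f)
  rw [inv_mul_eq_div, le_div_iff₀ hm]
  by_contra! h4
  have h5 : 0 < ‖R f‖ := by
    by_contra! h6
    nlinarith [norm_nonneg f]
  nlinarith

lemma IsWeakResolvent.norm_le (hR : IsWeakResolvent a m R) (ha : IsCoeff a κ) (hκ : 0 < κ)
    (hm : 0 < m) : ‖R‖ ≤ m⁻¹ :=
  R.opNorm_le_bound (by positivity) (hR.norm_apply_le ha hκ hm)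

lemma le_of_re_inner_le {S T : L2 d →L[ℂ] L2 d} (hS : IsSelfAdjoint S) (hT : IsSelfAdjoint T)
    (h : ∀ x, (inner ℂ (S x) x).re ≤ (inner ℂ (T x) x).re) : S ≤ T := by
  rw [ContinuousLinearMap.le_def]
  refine ⟨(ContinuousLinearMap.isSelfAdjoint_iff_isSymmetric.1 (hT.sub hS)), fun x => ?_⟩
  rw [ContinuousLinearMap.reApplyInnerSelf_apply, sub_apply, inner_sub_left, map_sub]
  exact sub_nonneg.2 (h x)

/-- A larger coefficient has a smaller resolvent. -/
lemma IsWeakResolvent.anti (hR : IsWeakResolvent a m R) (hR' : IsWeakResolvent b m R')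
    (ha : IsCoeff a κ) (hb : IsCoeff b κ) (hκ : 0 < κ) (hm : 0 < m) (hab : ∀ x, a x ≤ b x) :
    R' ≤ R := by
  refine le_of_re_inner_le hR'.isSelfAdjoint hR.isSelfAdjoint fun f => ?_
  obtain ⟨u, hu, -⟩ := hR' f
  rw [hR'.re_inner_eq hu]
  -- The maximiser for the larger coefficient `b` serves as a competitor for the smaller one `a`.
  have h1 := hR.variational ha hκ hm f u
  have h2 := energy_mono ha hb hκ hab u
  linarith

lemma mem_formOperator_graph (ha : IsCoeff a κ) (hκ : 0 < κ) (p : L2 d × L2 d) :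
    p ∈ (formOperator a).graph ↔ ∃ u : H1 d, (u : L2 d) = p.1 ∧ ∀ v : H1 d,
      ∫ x, formIntegrand a u v x = inner ℂ (v : L2 d) p.2 := by
  rw [formOperator_graph]
  refine ⟨fun ⟨u, hu, h⟩ => ⟨u, hu, fun v => (h v).2⟩,
    fun ⟨u, hu, h⟩ => ⟨u, hu, fun v => ⟨integrable_formIntegrand ha hκ u v, h v⟩⟩⟩

lemma IsWeakResolvent.mem_graph (hR : IsWeakResolvent a m R) (ha : IsCoeff a κ) (hκ : 0 < κ)
    (f : L2 d) : (R f, f - (m : ℂ) • R f) ∈ (formOperator a).graph := by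
  rw [mem_formOperator_graph ha hκ]
  obtain ⟨u, hu, h⟩ := hR f
  refine ⟨u, hu, fun v => ?_⟩
  rw [inner_sub_right, inner_smul_right, ← h v, hu]
  ring

/-- Uniqueness of the weak solution: the difference of two solutions, tested against itself, has
zero energy and zero norm. -/
lemma IsWeakResolvent.apply_eq (hR : IsWeakResolvent a m R) (ha : IsCoeff a κ) (hκ : 0 < κ)
    (hm : 0 < m) {u f : L2 d} (h : (u, f) ∈ (formOperator a).graph) :
    R (f + (m : ℂ) • u) = u := by
  rw [mem_formOperator_graph ha hκ] at h
  obtain ⟨w, rfl, hw⟩ := h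
  obtain ⟨w', hw', h'⟩ := hR (f + (m : ℂ) • (w : L2 d))
  have h1 : energy a (w' - w) + m * ‖(w' : L2 d) - w‖ ^ 2 = 0 := by
    have e := h' (w' - w)
    rw [inner_add_right, ← hw (w' - w), inner_smul_right] at e
    have e2 : ((energy a (w' - w) + m * ‖(w' : L2 d) - w‖ ^ 2 : ℝ) : ℂ) = 0 := by
      have e3 := integral_formIntegrand_sub_left ha hκ w' w (w' - w)
      have e4 : inner ℂ ((w' : L2 d) - w) ((w' : L2 d) - w)
          = ((‖(w' : L2 d) - w‖ ^ 2 : ℝ) : ℂ) := by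
        rw [inner_self_eq_norm_sq_to_K]; push_cast; rfl
      rw [inner_sub_right] at e4
      rw [Submodule.coe_sub] at e
      push_cast at e4 ⊢
      rw [← integral_formIntegrand_self, e3, ← e4]
      linear_combination e
    exact_mod_cast e2
  have h2 := energy_nonneg ha hκ (w' - w)
  have h3 : ‖(w' : L2 d) - w‖ ^ 2 = 0 := by nlinarith [sq_nonneg ‖(w' : L2 d) - w‖]
  rw [← hw']
  exact sub_eq_zero.1 (norm_eq_zero.1 (pow_eq_zero_iff (two_ne_zero) |>.1 h3))

/-- The gap condition in terms of the bounded resolvent. -/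
lemma IsWeakResolvent.isUnit_of_mem_resolventSet (hR : IsWeakResolvent a m R) (ha : IsCoeff a κ)
    (hκ : 0 < κ) (hm : 0 < m) {z : ℂ} (hz : z + m ≠ 0) (h : z ∈ resolventSet (formOperator a)) :
    IsUnit (R - (z + m)⁻¹ • (1 : L2 d →L[ℂ] L2 d)) := by
  obtain ⟨S, h1, h2⟩ := h
  have hg : ∀ f, (S f, f + z • S f) ∈ (formOperator a).graph := by
    intro f
    obtain ⟨h, e⟩ := h1 f
    have := (formOperator a).mem_graph ⟨S f, h⟩
    rwa [sub_eq_iff_eq_add.1 e] at this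
  have hRS : ∀ f, R f + (z + m) • R (S f) = S f := by
    intro f
    have := hR.apply_eq ha hκ hm (hg f)
    rw [← map_smul, ← map_add, add_smul, ← add_assoc]
    exact this
  have hSR : ∀ f, S f - (z + m) • S (R f) = R f := by
    intro f
    have hf := hR.mem_graph ha hκ f
    obtain ⟨y, hy, e⟩ := (formOperator a).mem_graph_iff.1 hf
    have := h2 y
    rw [e, hy] at this
    rw [← map_smul, ← map_sub, add_smul]
    convert this using 2
    simp only
    abel
  set c := z + m
  -- Formally `R - c⁻¹ = -c⁻¹ (A - z) (A + m)⁻¹`, whose inverse is `-c (A + m) (A - z)⁻¹ = -c (1 + c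
  -- S)`.
  set V : L2 d →L[ℂ] L2 d := -(c • (1 : L2 d →L[ℂ] L2 d) + (c * c) • S) with hV
  rw [isUnit_iff_exists]
  refine ⟨V, ?_, ?_⟩
  · ext1 f
    have e : (R - c⁻¹ • (1 : L2 d →L[ℂ] L2 d)) (V f) = f := by
      have h3 : R (S f) = c⁻¹ • (S f - R f) := by
        rw [← hRS f, add_sub_cancel_left, smul_smul, hRS, inv_mul_cancel₀ hz, one_smul]
      have h4 : V f = -(c • f + (c * c) • S f) := rfl
      change R (V f) - c⁻¹ • V f = f
      rw [h4, map_neg, map_add, map_smul, map_smul, h3, smul_smul]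
      have : c * c * c⁻¹ = c := by field_simp
      rw [this, smul_neg, smul_add, smul_smul, smul_smul, inv_mul_cancel₀ hz, ← mul_assoc,
        inv_mul_cancel₀ hz, one_mul, one_smul, smul_sub]
      abel
    exact e
  · ext1 f
    have h3 : S (R f) = c⁻¹ • (S f - R f) := by
      rw [← hSR f, sub_sub_cancel, smul_smul, hSR, inv_mul_cancel₀ hz, one_smul]
    change -(c • (R f - c⁻¹ • f) + (c * c) • S (R f - c⁻¹ • f)) = f
    rw [map_sub, map_smul, h3, smul_sub, smul_sub, smul_smul, smul_smul, smul_smul]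
    have : c * c * c⁻¹ = c := by field_simp
    rw [this, mul_inv_cancel₀ hz, one_smul, smul_sub]
    abel

lemma IsWeakResolvent.mem_resolventSet_of_isUnit (hR : IsWeakResolvent a m R) (ha : IsCoeff a κ)
    (hκ : 0 < κ) (hm : 0 < m) {z : ℂ} (hz : z + m ≠ 0)
    (h : IsUnit (R - (z + m)⁻¹ • (1 : L2 d →L[ℂ] L2 d))) :
    z ∈ resolventSet (formOperator a) := by
  obtain ⟨V, h1, h2⟩ := isUnit_iff_exists.1 h
  set c := z + m with hc
  have h1' : ∀ f, R (V f) - c⁻¹ • V f = f := fun f =>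
    congrArg (fun S : L2 d →L[ℂ] L2 d => S f) h1
  have h2' : ∀ f, V (R f) - c⁻¹ • V f = f := fun f => by
    have := congrArg (fun S : L2 d →L[ℂ] L2 d => S f) h2
    change V (R f - c⁻¹ • f) = f at this
    rwa [map_sub, map_smul] at this
  -- The same identity read backwards: `A - z = -c (R - c⁻¹) (A + m)`, with `V` inverse to `R -
  -- c⁻¹`.
  refine ⟨-c⁻¹ • R.comp V, fun f => ?_, fun u => ?_⟩
  · have hg := hR.mem_graph ha hκ ((-c⁻¹) • V f)
    have e : (-c⁻¹ • R.comp V) f = R ((-c⁻¹) • V f) := by rw [map_smul]; rfl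
    obtain ⟨y, hy, hyf⟩ := (formOperator a).mem_graph_iff.1 hg
    have hd : (-c⁻¹ • R.comp V) f ∈ (formOperator a).domain := by
      rw [e]; simp only at hy; rw [← hy]; exact y.2
    refine ⟨hd, ?_⟩
    have hy' : (⟨(-c⁻¹ • R.comp V) f, hd⟩ : (formOperator a).domain) = y :=
      Subtype.ext (e.trans hy.symm)
    rw [hy', hyf, e]
    simp only
    rw [sub_sub, ← add_smul, add_comm (m : ℂ), ← hc, map_smul, smul_smul]
    have : c * -c⁻¹ = -1 := by field_simp
    rw [this, neg_one_smul, sub_neg_eq_add, neg_smul, add_comm, ← sub_eq_add_neg]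
    exact h1' f
  · have hu := hR.apply_eq ha hκ hm ((formOperator a).mem_graph u)
    set g := formOperator a u + (m : ℂ) • (u : L2 d) with hg
    have e : formOperator a u - z • (u : L2 d) = g - c • R g := by
      rw [hu, hc, hg, add_smul]; abel
    rw [e]
    change -c⁻¹ • R (V (g - c • R g)) = u
    have e2 : V (g - c • R g) = -c • g := by
      have := h2' g
      have h3 : V (R g) = g + c⁻¹ • V g := sub_eq_iff_eq_add.1 this
      rw [map_sub, map_smul, h3, smul_add, smul_smul, mul_inv_cancel₀ hz, one_smul, neg_smul]
      abel
    rw [e2, map_smul, smul_smul, hu]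
    have : -c⁻¹ * -c = 1 := by field_simp
    rw [this, one_smul]

end WeakResolvent

end Resolvent

/-! ### Calculus of weak gradients: products and dilations -/

section WeakGradients

variable {d : ℕ}

/-- The weak gradient relation for functions instead of classes. -/
def HasWeakGradient (u : Space d → ℂ) (g : Space d → EuclideanSpace ℂ (Fin d)) : Prop :=
  ∀ φ : Space d → ℝ, ContDiff ℝ ∞ φ → HasCompactSupport φ → ∀ i : Fin d,
    ∫ x, φ x • (g x) i = - ∫ x, (fderiv ℝ φ x (EuclideanSpace.single i (1 : ℝ))) • u x

lemma HasWeakGradient.congr {u u' : Space d → ℂ} {g g' : Space d → EuclideanSpace ℂ (Fin d)}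
    (h : HasWeakGradient u g) (hu : u =ᵐ[volume] u') (hg : g =ᵐ[volume] g') :
    HasWeakGradient u' g' := by
  intro φ hφ hc i
  have e1 : ∫ x, φ x • (g' x) i = ∫ x, φ x • (g x) i :=
    integral_congr_ae (by filter_upwards [hg] with x hx; rw [hx])
  have e2 : ∫ x, (fderiv ℝ φ x (EuclideanSpace.single i (1 : ℝ))) • u' x
      = ∫ x, (fderiv ℝ φ x (EuclideanSpace.single i (1 : ℝ))) • u x :=
    integral_congr_ae (by filter_upwards [hu] with x hx; rw [hx])
  rw [e1, e2, h φ hφ hc i]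

lemma exists_H1_of_hasWeakGradient {u : Space d → ℂ} {g : Space d → EuclideanSpace ℂ (Fin d)}
    (hu : MemLp u 2 (volume : Measure (Space d))) (hg : MemLp g 2 (volume : Measure (Space d)))
    (h : HasWeakGradient u g) :
    ∃ w : H1 d, ((w : L2 d) : Space d → ℂ) =ᵐ[volume] u ∧
      (grad w : Space d → EuclideanSpace ℂ (Fin d)) =ᵐ[volume] g := by
  have h' : IsWeakGradient (hu.toLp u) (hg.toLp g) :=
    h.congr hu.coeFn_toLp.symm hg.coeFn_toLp.symm
  let w : H1 d := ⟨hu.toLp u, hg.toLp g, h'⟩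
  refine ⟨w, hu.coeFn_toLp, ?_⟩
  rw [(isWeakGradient_grad w).unique h']
  exact hg.coeFn_toLp

lemma memLp_component {g : Space d → EuclideanSpace ℂ (Fin d)}
    (hg : MemLp g 2 (volume : Measure (Space d))) (i : Fin d) :
    MemLp (fun x => (g x) i) 2 (volume : Measure (Space d)) :=
  (EuclideanSpace.proj i : EuclideanSpace ℂ (Fin d) →L[ℂ] ℂ).comp_memLp' hg

lemma HasWeakGradient.add {u v : Space d → ℂ} {g h : Space d → EuclideanSpace ℂ (Fin d)}
    (hu : MemLp u 2 (volume : Measure (Space d))) (hv : MemLp v 2 (volume : Measure (Space d)))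
    (hg : MemLp g 2 (volume : Measure (Space d))) (hh : MemLp h 2 (volume : Measure (Space d)))
    (hug : HasWeakGradient u g) (hvh : HasWeakGradient v h) :
    HasWeakGradient (fun x => u x + v x) (fun x => g x + h x) := by
  intro φ hφ hc i
  have l2 : ∀ {f : Space d → ℂ}, MemLp f 2 (volume : Measure (Space d)) →
      LocallyIntegrable f (volume : Measure (Space d)) := fun hf => hf.locallyIntegrable (by norm_num)
  have e1 : ∀ x, φ x • (g x + h x) i = φ x • (g x) i + φ x • (h x) i := fun x => by
    rw [PiLp.add_apply, smul_add]
  simp_rw [e1, smul_add]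
  rw [integral_add, integral_add, hug φ hφ hc i, hvh φ hφ hc i, neg_add]
  · exact integrable_deriv_test_smul (l2 hu) hφ hc _
  · exact integrable_deriv_test_smul (l2 hv) hφ hc _
  · exact integrable_test_smul (l2 (memLp_component hg i)) hφ.continuous hc
  · exact integrable_test_smul (l2 (memLp_component hh i)) hφ.continuous hc

lemma HasWeakGradient.neg {u : Space d → ℂ} {g : Space d → EuclideanSpace ℂ (Fin d)}
    (h : HasWeakGradient u g) : HasWeakGradient (fun x => -u x) (fun x => -g x) := by
  intro φ hφ hc i
  simp only [PiLp.neg_apply, smul_neg, integral_neg]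
  rw [h φ hφ hc i]

/-- The gradient of a real function, as a complex field. -/
def gradReal (χ : Space d → ℝ) (x : Space d) : EuclideanSpace ℂ (Fin d) :=
  WithLp.toLp 2 fun i => ((fderiv ℝ χ x (EuclideanSpace.single i (1 : ℝ)) : ℝ) : ℂ)

lemma continuous_gradReal {χ : Space d → ℝ} (hχ : ContDiff ℝ ∞ χ) : Continuous (gradReal χ) := by
  refine (PiLp.continuous_toLp 2 _).comp (continuous_pi fun i => ?_)
  exact Complex.continuous_ofReal.comp
    ((hχ.continuous_fderiv (by simp)).clm_apply continuous_const)

lemma norm_gradReal (χ : Space d → ℝ) (x : Space d) : ‖gradReal χ x‖ = ‖fderiv ℝ χ x‖ := by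
  have h : ∀ i, fderiv ℝ χ x (EuclideanSpace.single i (1 : ℝ))
      = ((InnerProductSpace.toDual ℝ (Space d)).symm (fderiv ℝ χ x)) i := by
    intro i
    rw [← InnerProductSpace.toDual_symm_apply (𝕜 := ℝ), EuclideanSpace.inner_single_right]
    simp
  rw [← (InnerProductSpace.toDual ℝ (Space d)).symm.norm_map (fderiv ℝ χ x),
    EuclideanSpace.norm_eq, EuclideanSpace.norm_eq]
  congr 1
  refine Finset.sum_congr rfl fun i _ => ?_
  rw [← h i, gradReal]
  simp

/-- Product rule. -/
lemma HasWeakGradient.smul_smooth {u : Space d → ℂ} {g : Space d → EuclideanSpace ℂ (Fin d)}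
    (hu : MemLp u 2 (volume : Measure (Space d))) (hg : MemLp g 2 (volume : Measure (Space d)))
    (h : HasWeakGradient u g) {χ : Space d → ℝ} (hχ : ContDiff ℝ ∞ χ) :
    HasWeakGradient (fun x => χ x • u x) (fun x => χ x • g x + u x • gradReal χ x) := by
  intro φ hφ hc i
  set e := EuclideanSpace.single i (1 : ℝ)
  have lu : LocallyIntegrable u (volume : Measure (Space d)) := hu.locallyIntegrable (by norm_num)
  have lg : LocallyIntegrable (fun x => (g x) i) (volume : Measure (Space d)) :=
    (memLp_component hg i).locallyIntegrable (by norm_num)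
  have hφχ : ContDiff ℝ ∞ fun x => φ x * χ x := hφ.mul hχ
  have hcφχ : HasCompactSupport fun x => φ x * χ x := hc.mul_right
  have h1 : ∫ x, (φ x * χ x) • (g x) i = - ∫ x, fderiv ℝ (fun x => φ x * χ x) x e • u x :=
    h _ hφχ hcφχ i
  have hd : ∀ x, fderiv ℝ (fun x => φ x * χ x) x e = φ x * fderiv ℝ χ x e + χ x * fderiv ℝ φ x e := by
    intro x
    rw [fderiv_fun_mul ((hφ.differentiable (by simp)) x) ((hχ.differentiable (by simp)) x)]
    simp
  have i1 : Integrable fun x => (φ x * χ x) • (g x) i := integrable_test_smul lg hφχ.continuous hcφχ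
  have i2 : Integrable fun x => (φ x * fderiv ℝ χ x e) • u x :=
    integrable_test_smul lu (hφ.continuous.mul
      ((hχ.continuous_fderiv (by simp)).clm_apply continuous_const)) hc.mul_right
  have i3 : Integrable fun x => (χ x * fderiv ℝ φ x e) • u x :=
    integrable_test_smul lu (hχ.continuous.mul
      ((hφ.continuous_fderiv (by simp)).clm_apply continuous_const))
      (hc.fderiv_apply (𝕜 := ℝ) e).mul_left
  have e1 : ∀ x, φ x • (χ x • g x + u x • gradReal χ x) i
      = (φ x * χ x) • (g x) i + (φ x * fderiv ℝ χ x e) • u x := by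
    intro x
    simp [gradReal, e]; ring
  have e2 : ∀ x, fderiv ℝ φ x e • χ x • u x = (χ x * fderiv ℝ φ x e) • u x := by
    intro x
    simp; ring
  simp_rw [e1, e2]
  simp_rw [hd, add_smul] at h1
  rw [integral_add i1 i2, h1, integral_add i2 i3]
  ring

/-- The homothety with centre `c` and factor `s`. -/
def dilation (c : Space d) (s : ℝ) (x : Space d) : Space d := c + s • (x - c)

lemma dilation_inv {c : Space d} {s : ℝ} (hs : s ≠ 0) (x : Space d) :
    dilation c s⁻¹ (dilation c s x) = x := by
  simp [dilation, smul_smul, inv_mul_cancel₀ hs]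

lemma dilation_inv' {c : Space d} {s : ℝ} (hs : s ≠ 0) (x : Space d) :
    dilation c s (dilation c s⁻¹ x) = x := by
  simp [dilation, smul_smul, mul_inv_cancel₀ hs]

lemma dilation_sub (c : Space d) (s : ℝ) (x : Space d) : dilation c s x - c = s • (x - c) := by
  simp [dilation]

lemma continuous_dilation (c : Space d) (s : ℝ) : Continuous (dilation c s) := by
  unfold dilation; fun_prop

lemma hasFDerivAt_dilation (c : Space d) (s : ℝ) (x : Space d) :
    HasFDerivAt (dilation c s) (s • ContinuousLinearMap.id ℝ (Space d)) x :=
  (((hasFDerivAt_id x).sub_const c).const_smul s).const_add c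

lemma contDiff_dilation (c : Space d) (s : ℝ) : ContDiff ℝ ∞ (dilation c s) := by
  unfold dilation; fun_prop

/-- Dilations as homeomorphisms. -/
def dilationHomeo (c : Space d) {s : ℝ} (hs : s ≠ 0) : Space d ≃ₜ Space d where
  toFun := dilation c s
  invFun := dilation c s⁻¹
  left_inv := dilation_inv hs
  right_inv := dilation_inv' hs
  continuous_toFun := continuous_dilation c s
  continuous_invFun := continuous_dilation c s⁻¹

lemma map_dilation (c : Space d) {s : ℝ} (hs : 0 < s) :
    Measure.map (dilation c s) (volume : Measure (Space d))
      = ENNReal.ofReal (s ^ d)⁻¹ • (volume : Measure (Space d)) := by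
  have e : dilation c s = (fun x => c + x) ∘ (fun x => s • x) ∘ (fun x => x - c) := rfl
  rw [e, ← Measure.map_map (by fun_prop) (by fun_prop), ← Measure.map_map (by fun_prop) (by fun_prop),
    (measurePreserving_sub_right volume c).map_eq, Measure.map_addHaar_smul _ hs.ne',
    Measure.map_smul, map_add_left_eq_self, finrank_euclideanSpace_fin, abs_of_pos (by positivity)]

lemma integral_comp_dilation {E : Type*} [NormedAddCommGroup E] [NormedSpace ℝ E]
    (c : Space d) {s : ℝ} (hs : 0 < s) (F : Space d → E) :
    ∫ x, F (dilation c s x) = (s ^ d)⁻¹ • ∫ x, F x := by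
  have h := (dilationHomeo c hs.ne').measurableEmbedding.integral_map
    (μ := (volume : Measure (Space d))) F
  change ∫ y, F y ∂(Measure.map (dilation c s) volume) = ∫ x, F (dilation c s x) at h
  rw [← h, map_dilation c hs, integral_smul_measure, ENNReal.toReal_ofReal (by positivity)]

lemma lintegral_comp_dilation (c : Space d) {s : ℝ} (hs : 0 < s) (F : Space d → ENNReal) :
    ∫⁻ x, F (dilation c s x) = ENNReal.ofReal (s ^ d)⁻¹ * ∫⁻ x, F x := by
  have h := (dilationHomeo c hs.ne').measurableEmbedding.lintegral_map
    (μ := (volume : Measure (Space d))) F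
  change ∫⁻ y, F y ∂(Measure.map (dilation c s) volume) = ∫⁻ x, F (dilation c s x) at h
  rw [← h, map_dilation c hs, lintegral_smul_measure, smul_eq_mul]

lemma quasiMeasurePreserving_dilation (c : Space d) {s : ℝ} (hs : 0 < s) :
    Measure.QuasiMeasurePreserving (dilation c s) (volume : Measure (Space d)) volume := by
  refine ⟨(continuous_dilation c s).measurable, ?_⟩
  rw [map_dilation c hs]
  exact Measure.smul_absolutelyContinuous

lemma memLp_comp_dilation {E : Type*} [NormedAddCommGroup E] {F : Space d → E}
    (hF : MemLp F 2 (volume : Measure (Space d))) (c : Space d) {s : ℝ} (hs : 0 < s) :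
    MemLp (fun x => F (dilation c s x)) 2 (volume : Measure (Space d)) := by
  have h : MemLp F 2 (Measure.map (dilation c s) (volume : Measure (Space d))) := by
    rw [map_dilation c hs]
    exact hF.smul_measure ENNReal.ofReal_ne_top
  exact h.comp_of_map (continuous_dilation c s).aemeasurable

/-- A change of variables moves the dilation to the test function. Both sides acquire the same
Jacobian, and differentiating the dilated test function produces the factor `s`. -/
lemma HasWeakGradient.comp_dilation {u : Space d → ℂ} {g : Space d → EuclideanSpace ℂ (Fin d)}
    (h : HasWeakGradient u g) (c : Space d) {s : ℝ} (hs : 0 < s) :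
    HasWeakGradient (fun x => u (dilation c s x)) (fun x => s • g (dilation c s x)) := by
  intro φ hφ hc i
  set e := EuclideanSpace.single i (1 : ℝ)
  let ψ : Space d → ℝ := fun y => φ (dilation c s⁻¹ y)
  have hψ : ContDiff ℝ ∞ ψ := hφ.comp (contDiff_dilation c s⁻¹)
  have hψc : HasCompactSupport ψ := hc.comp_homeomorph (dilationHomeo c (inv_ne_zero hs.ne'))
  have hd : ∀ y, fderiv ℝ ψ y e = s⁻¹ * fderiv ℝ φ (dilation c s⁻¹ y) e := by
    intro y
    have h1 : HasFDerivAt ψ ((fderiv ℝ φ (dilation c s⁻¹ y)).comp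
        (s⁻¹ • ContinuousLinearMap.id ℝ (Space d))) y :=
      ((hφ.differentiable (by simp)) _).hasFDerivAt.comp y (hasFDerivAt_dilation c s⁻¹ y)
    rw [h1.fderiv]
    simp
  have h1 : ∫ x, ψ x • (g x) i = - ∫ x, fderiv ℝ ψ x e • u x := h ψ hψ hψc i
  have e1 := integral_comp_dilation c hs fun y => ψ y • (g y) i
  have e2 := integral_comp_dilation c hs fun y => (fderiv ℝ ψ y e) • u y
  simp only [hd] at e2
  simp only [ψ, dilation_inv hs.ne'] at e1 e2
  have e3 : ∀ x, φ x • (s • g (dilation c s x)) i = s • (φ x • (g (dilation c s x)) i) := by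
    intro x; simp; ring
  have e4 : ∀ x, (s⁻¹ * fderiv ℝ φ x e) • u (dilation c s x)
      = s⁻¹ • (fderiv ℝ φ x e • u (dilation c s x)) := fun x => by rw [mul_smul]
  simp_rw [e4] at e2
  simp_rw [e3]
  rw [integral_smul] at e2 ⊢
  simp only [hd] at h1
  simp only [ψ] at h1
  rw [e1, h1, smul_neg, smul_neg, ← e2, smul_smul, mul_inv_cancel₀ hs.ne', one_smul]

end WeakGradients

/-! ### Estimate of `u ∘ dilation - u` by the gradient -/

section DifferenceEstimate

lemma sq_lintegral_le {α : Type*} [MeasurableSpace α] {ν : Measure α} (hν : ν Set.univ ≤ 1)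
    {f : α → ENNReal} (hf : AEMeasurable f ν) : (∫⁻ x, f x ∂ν) ^ 2 ≤ ∫⁻ x, f x ^ 2 ∂ν := by
  have h := ENNReal.lintegral_mul_le_Lp_mul_Lq ν Real.HolderConjugate.two_two hf
    (aemeasurable_const (b := (1 : ENNReal)))
  simp only [Pi.mul_apply, mul_one, ENNReal.one_rpow, lintegral_const, one_mul] at h
  have h1 : ν Set.univ ^ (1 / 2 : ℝ) ≤ 1 := ENNReal.rpow_le_one hν (by norm_num)
  have h2 : ∫⁻ x, f x ∂ν ≤ (∫⁻ x, f x ^ (2 : ℝ) ∂ν) ^ (1 / 2 : ℝ) :=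
    h.trans (mul_le_of_le_one_right' h1)
  calc (∫⁻ x, f x ∂ν) ^ 2 ≤ ((∫⁻ x, f x ^ (2 : ℝ) ∂ν) ^ (1 / 2 : ℝ)) ^ 2 := by gcongr
    _ = ∫⁻ x, f x ^ 2 ∂ν := by
      rw [← ENNReal.rpow_natCast, ← ENNReal.rpow_mul]
      norm_num

lemma sq_lintegral_mul_le {α : Type*} [MeasurableSpace α] {μ : Measure α} {w f : α → ENNReal}
    (hw : Measurable w) (hw1 : ∫⁻ x, w x ∂μ ≤ 1) (hf : AEMeasurable f μ) :
    (∫⁻ x, w x * f x ∂μ) ^ 2 ≤ ∫⁻ x, w x * f x ^ 2 ∂μ := by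
  have h := sq_lintegral_le (ν := μ.withDensity w) (f := f)
    (by rwa [withDensity_apply _ MeasurableSet.univ, Measure.restrict_univ])
    (hf.mono_ac (withDensity_absolutelyContinuous _ _))
  rwa [lintegral_withDensity_eq_lintegral_mul₀ hw.aemeasurable hf,
    lintegral_withDensity_eq_lintegral_mul₀ hw.aemeasurable (hf.pow_const 2)] at h

variable {d : ℕ}

/-- The gradient of a smooth complex function. -/
def gradComplex (v : Space d → ℂ) (x : Space d) : EuclideanSpace ℂ (Fin d) :=
  WithLp.toLp 2 fun i => fderiv ℝ v x (EuclideanSpace.single i (1 : ℝ))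

lemma norm_fderiv_apply_le (v : Space d → ℂ) (x h : Space d) :
    ‖fderiv ℝ v x h‖ ≤ ‖gradComplex v x‖ * ‖h‖ := by
  have e : fderiv ℝ v x h = inner ℂ (WithLp.toLp 2 fun i => ((h i : ℝ) : ℂ)) (gradComplex v x) := by
    have h0 : h = ∑ i, h i • EuclideanSpace.single i (1 : ℝ) := by
      ext j
      simp [Pi.single_apply, Finset.sum_apply]
    conv_lhs => rw [h0]
    rw [map_sum, PiLp.inner_apply]
    refine Finset.sum_congr rfl fun i _ => ?_
    simp [gradComplex, mul_comm]
  have e2 : ‖(WithLp.toLp 2 fun i => ((h i : ℝ) : ℂ) : EuclideanSpace ℂ (Fin d))‖ = ‖h‖ := by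
    rw [EuclideanSpace.norm_eq, EuclideanSpace.norm_eq]
    simp
  rw [e, mul_comm, ← e2]
  exact norm_inner_le_norm _ _

lemma continuous_gradComplex {v : Space d → ℂ} (hv : ContDiff ℝ 1 v) :
    Continuous (gradComplex v) :=
  (PiLp.continuous_toLp 2 _).comp (continuous_pi fun _ =>
    (hv.continuous_fderiv (by simp)).clm_apply continuous_const)

lemma mem_ball_dilation {c x : Space d} {s R : ℝ} (hs : 0 < s) :
    dilation c s x ∈ Metric.ball c (s * R) ↔ x ∈ Metric.ball c R := by
  rw [mem_ball_iff_norm, mem_ball_iff_norm, dilation_sub, norm_smul, Real.norm_of_nonneg hs.le,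
    mul_lt_mul_iff_right₀ hs]

/-- Set integrals over balls do not grow under pull-back by an expansion. -/
lemma setLIntegral_comp_dilation_le (c : Space d) {s R : ℝ} (hs : 1 ≤ s)
    (F : Space d → ENNReal) :
    ∫⁻ x in Metric.ball c R, F (dilation c s x) ≤ ∫⁻ x in Metric.ball c (s * R), F x := by
  have hs0 : 0 < s := by linarith
  rw [← lintegral_indicator Metric.isOpen_ball.measurableSet,
    ← lintegral_indicator Metric.isOpen_ball.measurableSet]
  have e : ∀ x, (Metric.ball c R).indicator (fun x => F (dilation c s x)) x
      = (Metric.ball c (s * R)).indicator F (dilation c s x) := by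
    intro x
    by_cases hx : x ∈ Metric.ball c R
    · rw [Set.indicator_of_mem hx, Set.indicator_of_mem ((mem_ball_dilation hs0).2 hx)]
    · rw [Set.indicator_of_notMem hx, Set.indicator_of_notMem (mt (mem_ball_dilation hs0).1 hx)]
  simp_rw [e]
  rw [lintegral_comp_dilation c hs0]
  refine mul_le_of_le_one_left' ?_
  rw [← ENNReal.ofReal_one]
  exact ENNReal.ofReal_le_ofReal (inv_le_one_of_one_le₀ (one_le_pow₀ hs))

/-- The difference estimate for smooth functions. -/
lemma setLIntegral_sub_dilation_le_of_contDiff {v : Space d → ℂ} (hv : ContDiff ℝ 1 v)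
    (c : Space d) {s R : ℝ} (hs : 1 ≤ s) :
    ∫⁻ x in Metric.ball c R, ‖v (dilation c s x) - v x‖ₑ ^ 2
      ≤ ENNReal.ofReal (((s - 1) * R) ^ 2) *
        ∫⁻ x in Metric.ball c (s * R), ‖gradComplex v x‖ₑ ^ 2 := by
  rcases le_or_gt R 0 with hR | hR
  · simp [Metric.ball_eq_empty.2 hR]
  set K := ENNReal.ofReal (((s - 1) * R) ^ 2) with hK
  have hk : 0 ≤ (s - 1) * R := mul_nonneg (by linarith) hR.le
  -- A straight path from `x` to its image; its velocity `(s - 1) (x - c)` is at most `(s - 1) R` in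
  -- the ball.
  let D : ℝ → Space d → Space d := fun τ => dilation c (1 + τ * (s - 1))
  have hDc : Continuous fun p : ℝ × Space d => D p.1 p.2 := by
    simp only [D, dilation]; fun_prop
  have hgc := continuous_gradComplex hv
  have point : ∀ x ∈ Metric.ball c R, ‖v (dilation c s x) - v x‖ₑ ^ 2
      ≤ K * ∫⁻ τ in Set.Ioc (0 : ℝ) 1, ‖gradComplex v (D τ x)‖ₑ ^ 2 := by
    intro x hx
    have hder : ∀ τ ∈ Set.uIcc (0 : ℝ) 1, HasDerivAt (fun τ => v (D τ x))
        (fderiv ℝ v (D τ x) ((s - 1) • (x - c))) τ := by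
      intro τ _
      have h1 : HasDerivAt (fun τ : ℝ => D τ x) ((s - 1) • (x - c)) τ := by
        have := ((((hasDerivAt_id τ).mul_const (s - 1)).const_add 1).smul_const (x - c)).const_add c
        simpa [D, dilation] using this
      exact ((hv.differentiable (by simp)) (D τ x)).hasFDerivAt.comp_hasDerivAt τ h1
    have hcx : Continuous fun τ => D τ x := hDc.comp (continuous_id.prodMk continuous_const)
    have hcont : Continuous fun τ => fderiv ℝ v (D τ x) ((s - 1) • (x - c)) :=
      ((hv.continuous_fderiv (by simp)).comp hcx).clm_apply continuous_const
    have hint := intervalIntegral.integral_eq_sub_of_hasDerivAt hder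
      (hcont.intervalIntegrable 0 1)
    have e1 : D 1 x = dilation c s x := by simp [D]
    have e0 : D 0 x = x := by simp [D, dilation]
    rw [e1, e0, intervalIntegral.integral_of_le zero_le_one] at hint
    rw [← hint]
    have hb : ∀ τ, ‖fderiv ℝ v (D τ x) ((s - 1) • (x - c))‖ₑ
        ≤ ENNReal.ofReal ((s - 1) * R) * ‖gradComplex v (D τ x)‖ₑ := by
      intro τ
      rw [← ofReal_norm, ← ofReal_norm, ← ENNReal.ofReal_mul hk, mul_comm]
      refine ENNReal.ofReal_le_ofReal ((norm_fderiv_apply_le _ _ _).trans ?_)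
      refine mul_le_mul_of_nonneg_left ?_ (norm_nonneg _)
      rw [norm_smul, Real.norm_of_nonneg (by linarith)]
      exact mul_le_mul_of_nonneg_left (mem_ball_iff_norm.1 hx).le (by linarith)
    have hm : Measurable fun τ => ‖gradComplex v (D τ x)‖ₑ := (hgc.comp hcx).enorm.measurable
    calc ‖∫ τ in Set.Ioc (0 : ℝ) 1, fderiv ℝ v (D τ x) ((s - 1) • (x - c))‖ₑ ^ 2
        ≤ (∫⁻ τ in Set.Ioc (0 : ℝ) 1,
            ENNReal.ofReal ((s - 1) * R) * ‖gradComplex v (D τ x)‖ₑ) ^ 2 := by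
          gcongr
          exact (enorm_integral_le_lintegral_enorm _).trans (lintegral_mono hb)
      _ = K * (∫⁻ τ in Set.Ioc (0 : ℝ) 1, ‖gradComplex v (D τ x)‖ₑ) ^ 2 := by
          rw [lintegral_const_mul _ hm, mul_pow, hK, ENNReal.ofReal_pow hk]
      _ ≤ _ := by
          gcongr
          exact sq_lintegral_le (by simp) hm.aemeasurable
  have hmeas : Measurable fun p : Space d × ℝ => ‖gradComplex v (D p.2 p.1)‖ₑ ^ 2 :=
    ((hgc.comp (hDc.comp continuous_swap)).enorm.measurable).pow_const 2
  calc ∫⁻ x in Metric.ball c R, ‖v (dilation c s x) - v x‖ₑ ^ 2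
      ≤ ∫⁻ x in Metric.ball c R, K * ∫⁻ τ in Set.Ioc (0 : ℝ) 1, ‖gradComplex v (D τ x)‖ₑ ^ 2 :=
        setLIntegral_mono' Metric.isOpen_ball.measurableSet point
    _ = K * ∫⁻ x in Metric.ball c R, ∫⁻ τ in Set.Ioc (0 : ℝ) 1, ‖gradComplex v (D τ x)‖ₑ ^ 2 :=
        lintegral_const_mul' _ _ ENNReal.ofReal_ne_top
    _ = K * ∫⁻ τ in Set.Ioc (0 : ℝ) 1, ∫⁻ x in Metric.ball c R, ‖gradComplex v (D τ x)‖ₑ ^ 2 := by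
        rw [lintegral_lintegral_swap hmeas.aemeasurable]
    _ ≤ K * ∫⁻ τ in Set.Ioc (0 : ℝ) 1,
          ∫⁻ x in Metric.ball c (s * R), ‖gradComplex v x‖ₑ ^ 2 := by
        refine mul_le_mul_right (setLIntegral_mono' measurableSet_Ioc fun τ hτ => ?_) _
        have h1 : 1 ≤ 1 + τ * (s - 1) := by nlinarith [hτ.1]
        refine (setLIntegral_comp_dilation_le c h1 fun x => ‖gradComplex v x‖ₑ ^ 2).trans ?_
        refine lintegral_mono_set (Metric.ball_subset_ball ?_)
        refine mul_le_mul_of_nonneg_right ?_ hR.le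
        nlinarith [hτ.2]
    _ = _ := by simp

/-- Mollification by a bump function. -/
def mollify {E : Type*} [NormedAddCommGroup E] [NormedSpace ℝ E]
    (φ : ContDiffBump (0 : Space d)) (v : Space d → E) (x : Space d) : E :=
  ∫ t, φ.normed volume (x - t) • v t

variable {u : Space d → ℂ} {g : Space d → EuclideanSpace ℂ (Fin d)} (φ : ContDiffBump (0 : Space d))

lemma mollify_eq (x : Space d) :
    mollify φ u x = (convolution (φ.normed volume) u (ContinuousLinearMap.lsmul ℝ ℝ) volume) x := by
  rw [convolution_eq_swap]; rfl

lemma mollify_eq' :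
    mollify φ u = convolution u (φ.normed volume) (ContinuousLinearMap.lsmul ℝ ℝ).flip volume := by
  rw [convolution_flip]; exact funext (mollify_eq φ)

lemma contDiff_mollify (hu : LocallyIntegrable u (volume : Measure (Space d))) :
    ContDiff ℝ 1 (mollify φ u) := by
  rw [mollify_eq']
  exact φ.hasCompactSupport_normed.contDiff_convolution_right _ hu φ.contDiff_normed

/-- The derivative falls on the bump, and `t ↦ ρ (x - t)` is an admissible test function for the
weak gradient. The sign from reflecting the argument cancels the sign from integration by parts. -/
lemma gradComplex_mollify (hu : LocallyIntegrable u (volume : Measure (Space d)))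
    (hg : LocallyIntegrable g (volume : Measure (Space d))) (h : HasWeakGradient u g)
    (x : Space d) : gradComplex (mollify φ u) x = mollify φ g x := by
  have hρ : ContDiff ℝ ∞ (φ.normed (volume : Measure (Space d))) := φ.contDiff_normed
  have hρc := φ.hasCompactSupport_normed (μ := (volume : Measure (Space d)))
  set ρ := φ.normed (volume : Measure (Space d)) with hρdef
  let ψ : Space d → ℝ := fun t => ρ (x - t)
  have hψ : ContDiff ℝ ∞ ψ := hρ.comp (contDiff_const.sub contDiff_id)
  have hψc : HasCompactSupport ψ := hρc.comp_homeomorph (Homeomorph.subLeft x)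
  have hd : ∀ t e, fderiv ℝ ψ t e = - fderiv ℝ ρ (x - t) e := by
    intro t e
    have h1 : HasFDerivAt ψ ((fderiv ℝ ρ (x - t)).comp (-ContinuousLinearMap.id ℝ (Space d))) t :=
      ((hρ.differentiable (by simp)) _).hasFDerivAt.comp t ((hasFDerivAt_id t).const_sub x)
    rw [h1.fderiv]; simp
  ext i
  have h1 := (hρc.hasFDerivAt_convolution_right (ContinuousLinearMap.lsmul ℝ ℝ (E := ℂ)).flip hu
    (hρ.of_le (by simp)) x).fderiv
  have e0 : mollify φ u = convolution u ρ (ContinuousLinearMap.lsmul ℝ ℝ).flip volume :=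
    mollify_eq' φ
  rw [← e0] at h1
  set e := EuclideanSpace.single i (1 : ℝ)
  have h2 : gradComplex (mollify φ u) x i = ∫ t, fderiv ℝ ρ (x - t) e • u t := by
    change fderiv ℝ (mollify φ u) x e = _
    rw [h1, convolution_precompR_apply _ hu (hρc.fderiv (𝕜 := ℝ)) (hρ.continuous_fderiv (by simp))]
    rfl
  have h3 : ∫ t, ψ t • (g t) i = - ∫ t, fderiv ℝ ψ t e • u t := h ψ hψ hψc i
  simp_rw [hd, neg_smul, integral_neg, neg_neg] at h3
  rw [h2, ← h3]
  have hint : Integrable fun t => ψ t • g t :=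
    hg.integrable_smul_left_of_hasCompactSupport hψ.continuous hψc
  have := ((EuclideanSpace.proj i : EuclideanSpace ℂ (Fin d) →L[ℂ] ℂ).restrictScalars ℝ).integral_comp_comm
    hint
  simpa [mollify, ψ] using this

/-- Jensen's inequality for mollification, integrated over a ball. -/
lemma setLIntegral_mollify_le {E : Type*} [NormedAddCommGroup E] [NormedSpace ℝ E]
    {g : Space d → E} (hg : AEStronglyMeasurable g (volume : Measure (Space d)))
    (c : Space d) (r : ℝ) :
    ∫⁻ x in Metric.ball c r, ‖mollify φ g x‖ₑ ^ 2
      ≤ ∫⁻ x in Metric.ball c (r + φ.rOut), ‖g x‖ₑ ^ 2 := by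
  have hρ : Continuous (φ.normed (volume : Measure (Space d))) := φ.continuous_normed
  set ρ := φ.normed (volume : Measure (Space d)) with hρdef
  have hρ0 : ∀ x, 0 ≤ ρ x := φ.nonneg_normed
  have hρ1 : ∫⁻ x, ENNReal.ofReal (ρ x) = 1 := by
    rw [← ofReal_integral_eq_lintegral_ofReal φ.integrable_normed
      (Filter.Eventually.of_forall hρ0), φ.integral_normed, ENNReal.ofReal_one]
  have hw : Measurable fun p : Space d × Space d => ENNReal.ofReal (ρ (p.1 - p.2)) :=
    ((hρ.comp (continuous_fst.sub continuous_snd)).measurable).ennreal_ofReal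
  have hwt : ∀ t, Measurable fun x => ENNReal.ofReal (ρ (x - t)) := fun t =>
    (hρ.comp (continuous_id.sub continuous_const)).measurable.ennreal_ofReal
  have hgm : AEMeasurable (fun t => ‖g t‖ₑ) (volume : Measure (Space d)) := hg.enorm
  have point : ∀ x, ‖mollify φ g x‖ₑ ^ 2 ≤ ∫⁻ t, ENNReal.ofReal (ρ (x - t)) * ‖g t‖ₑ ^ 2 := by
    intro x
    have hwx : Measurable fun t => ENNReal.ofReal (ρ (x - t)) :=
      (hρ.comp (continuous_const.sub continuous_id)).measurable.ennreal_ofReal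
    have hw1 : ∫⁻ t, ENNReal.ofReal (ρ (x - t)) ≤ 1 := by
      rw [lintegral_sub_left_eq_self (fun t => ENNReal.ofReal (ρ t)), hρ1]
    have h1 : ‖mollify φ g x‖ₑ ≤ ∫⁻ t, ENNReal.ofReal (ρ (x - t)) * ‖g t‖ₑ := by
      refine (enorm_integral_le_lintegral_enorm _).trans_eq (lintegral_congr fun t => ?_)
      rw [enorm_smul, Real.enorm_of_nonneg (hρ0 _)]
    exact (pow_le_pow_left' h1 2).trans (sq_lintegral_mul_le hwx hw1 hgm)
  have hgm2 : AEMeasurable (fun t => ‖g t‖ₑ ^ 2) (volume : Measure (Space d)) := hgm.pow_const 2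
  calc ∫⁻ x in Metric.ball c r, ‖mollify φ g x‖ₑ ^ 2
      ≤ ∫⁻ x in Metric.ball c r, ∫⁻ t, ENNReal.ofReal (ρ (x - t)) * ‖g t‖ₑ ^ 2 :=
        lintegral_mono fun x => point x
    _ = ∫⁻ t, ∫⁻ x in Metric.ball c r, ENNReal.ofReal (ρ (x - t)) * ‖g t‖ₑ ^ 2 := by
        refine lintegral_lintegral_swap (hw.aemeasurable.mul ?_)
        exact hgm2.comp_quasiMeasurePreserving Measure.quasiMeasurePreserving_snd
    _ ≤ ∫⁻ t, (Metric.ball c (r + φ.rOut)).indicator (fun t => ‖g t‖ₑ ^ 2) t := by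
        refine lintegral_mono fun t => ?_
        by_cases ht : t ∈ Metric.ball c (r + φ.rOut)
        · rw [Set.indicator_of_mem ht, lintegral_mul_const _ (hwt t)]
          refine mul_le_of_le_one_left' ((setLIntegral_le_lintegral _ _).trans ?_)
          rw [lintegral_sub_right_eq_self (fun x => ENNReal.ofReal (ρ x)), hρ1]
        · rw [Set.indicator_of_notMem ht]
          refine le_of_eq ?_
          rw [setLIntegral_eq_zero_iff Metric.isOpen_ball.measurableSet
            ((hwt t).mul_const _)]
          refine Filter.Eventually.of_forall fun x hx => ?_
          have : ρ (x - t) = 0 := by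
            rw [← Function.notMem_support, φ.support_normed_eq, mem_ball_zero_iff, ← dist_eq_norm]
            intro hxt
            rw [Metric.mem_ball] at ht hx
            apply ht
            rw [dist_comm] at hxt
            linarith [dist_triangle t x c]
          rw [this]; simp
    _ = _ := lintegral_indicator Metric.isOpen_ball.measurableSet _

/-- The difference estimate for Sobolev functions. -/
lemma setLIntegral_sub_dilation_le (hu : MemLp u 2 (volume : Measure (Space d)))
    (hg : MemLp g 2 (volume : Measure (Space d))) (h : HasWeakGradient u g)
    (c : Space d) {s R R' : ℝ} (hs : 1 ≤ s) (hR : s * R < R') :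
    ∫⁻ x in Metric.ball c R, ‖u (dilation c s x) - u x‖ₑ ^ 2
      ≤ ENNReal.ofReal (((s - 1) * R) ^ 2) * ∫⁻ x in Metric.ball c R', ‖g x‖ₑ ^ 2 := by
  have lu : LocallyIntegrable u (volume : Measure (Space d)) := hu.locallyIntegrable (by norm_num)
  have lg : LocallyIntegrable g (volume : Measure (Space d)) := hg.locallyIntegrable (by norm_num)
  -- Mollification enlarges the ball of radius `s * R` by `r n`; the room up to `R'` absorbs this.
  -- Fatou's lemma then passes to the limit.
  let r : ℕ → ℝ := fun n => (R' - s * R) / (n + 1)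
  have hr0 : ∀ n, 0 < r n := fun n => div_pos (sub_pos.2 hR) (by positivity)
  let φ : ℕ → ContDiffBump (0 : Space d) := fun n =>
    ⟨r n / 2, r n, half_pos (hr0 n), half_lt_self (hr0 n)⟩
  have hr : Filter.Tendsto r Filter.atTop (nhds 0) := by
    have := (tendsto_one_div_add_atTop_nhds_zero_nat (𝕜 := ℝ)).const_mul (R' - s * R)
    simpa [r, div_eq_mul_inv] using this
  have hae : ∀ᵐ x, Filter.Tendsto (fun n => mollify (φ n) u x) Filter.atTop (nhds (u x)) := by
    have := ContDiffBump.ae_convolution_tendsto_right_of_locallyIntegrable (φ := φ)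
      (l := Filter.atTop) (K := 2) hr (Filter.Eventually.of_forall fun n => ?_) lu
    · simpa only [← mollify_eq] using this
    · change r n ≤ 2 * (r n / 2)
      linarith
  have hae' := (quasiMeasurePreserving_dilation c (by linarith : 0 < s)).ae hae
  have hcont := fun n => (contDiff_mollify (φ n) lu).continuous
  set C := ENNReal.ofReal (((s - 1) * R) ^ 2) * ∫⁻ x in Metric.ball c R', ‖g x‖ₑ ^ 2
  have bound : ∀ n, ∫⁻ x in Metric.ball c R,
      ‖mollify (φ n) u (dilation c s x) - mollify (φ n) u x‖ₑ ^ 2 ≤ C := by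
    intro n
    refine (setLIntegral_sub_dilation_le_of_contDiff (contDiff_mollify (φ n) lu) c hs).trans ?_
    simp_rw [gradComplex_mollify (φ n) lu lg h]
    refine mul_le_mul_right ((setLIntegral_mollify_le (φ n) hg.aestronglyMeasurable c _).trans ?_) _
    refine lintegral_mono_set (Metric.ball_subset_ball ?_)
    change s * R + (R' - s * R) / (n + 1) ≤ R'
    have : (R' - s * R) / (n + 1) ≤ R' - s * R := div_le_self (by linarith) (by linarith [n.cast_nonneg (α := ℝ)])
    linarith
  calc ∫⁻ x in Metric.ball c R, ‖u (dilation c s x) - u x‖ₑ ^ 2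
      = ∫⁻ x in Metric.ball c R, Filter.liminf (fun n =>
          ‖mollify (φ n) u (dilation c s x) - mollify (φ n) u x‖ₑ ^ 2) Filter.atTop := by
        refine lintegral_congr_ae (ae_restrict_of_ae ?_)
        filter_upwards [hae, hae'] with x h1 h2
        exact (((ENNReal.continuous_pow 2).tendsto _).comp (h2.sub h1).enorm).liminf_eq.symm
    _ ≤ Filter.liminf (fun n => ∫⁻ x in Metric.ball c R,
          ‖mollify (φ n) u (dilation c s x) - mollify (φ n) u x‖ₑ ^ 2) Filter.atTop :=
        lintegral_liminf_le' fun n => ((((hcont n).comp (continuous_dilation c s)).sub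
          (hcont n)).enorm.measurable.pow_const 2).aemeasurable
    _ ≤ Filter.liminf (fun _ : ℕ => C) Filter.atTop :=
        Filter.liminf_le_liminf (Filter.Eventually.of_forall bound)
    _ = C := Filter.liminf_const C

end DifferenceEstimate

/-! ### Transport of a Sobolev function within one cell -/

section CellTransport

variable {d : ℕ}

lemma integrable_norm_sq {E : Type*} [NormedAddCommGroup E] {f : Space d → E}
    (hf : MemLp f 2 (volume : Measure (Space d))) : Integrable fun x => ‖f x‖ ^ 2 :=
  hf.integrable_norm_pow two_ne_zero

lemma ofReal_setIntegral_norm_sq {E : Type*} [NormedAddCommGroup E] {f : Space d → E}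
    (hf : MemLp f 2 (volume : Measure (Space d))) (S : Set (Space d)) :
    ENNReal.ofReal (∫ x in S, ‖f x‖ ^ 2) = ∫⁻ x in S, ‖f x‖ₑ ^ 2 := by
  rw [ofReal_integral_eq_lintegral_ofReal (integrable_norm_sq hf).integrableOn
    (Filter.Eventually.of_forall fun x => by positivity)]
  refine lintegral_congr fun x => ?_
  rw [ENNReal.ofReal_pow (norm_nonneg _), ofReal_norm]

lemma setIntegral_sub_dilation_le {u : Space d → ℂ} {g : Space d → EuclideanSpace ℂ (Fin d)}
    (hu : MemLp u 2 (volume : Measure (Space d)))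
    (hg : MemLp g 2 (volume : Measure (Space d))) (h : HasWeakGradient u g)
    (c : Space d) {s R R' : ℝ} (hs : 1 ≤ s) (hR : s * R < R') :
    ∫ x in Metric.ball c R, ‖u (dilation c s x) - u x‖ ^ 2
      ≤ ((s - 1) * R) ^ 2 * ∫ x in Metric.ball c R', ‖g x‖ ^ 2 := by
  have hD : MemLp (fun x => u (dilation c s x) - u x) 2 (volume : Measure (Space d)) :=
    (memLp_comp_dilation hu c (by linarith)).sub hu
  have h0 : 0 ≤ ∫ x in Metric.ball c R', ‖g x‖ ^ 2 := integral_nonneg fun x => by positivity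
  rw [← ENNReal.ofReal_le_ofReal_iff (by positivity), ENNReal.ofReal_mul (by positivity),
    ofReal_setIntegral_norm_sq hD, ofReal_setIntegral_norm_sq hg]
  exact setLIntegral_sub_dilation_le hu hg h c hs hR

/-- Young's inequality. The weight suits a second term with `‖Y‖²` of order `k²`: the total loss is
then of order `k`. -/
lemma norm_add_sq_le_weighted {E : Type*} [NormedAddCommGroup E] (X Y : E) {k : ℝ} (hk : 0 < k) :
    ‖X + Y‖ ^ 2 ≤ (1 + k) * ‖X‖ ^ 2 + (1 + 1 / k) * ‖Y‖ ^ 2 := by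
  have h1 : ‖X + Y‖ ^ 2 ≤ (‖X‖ + ‖Y‖) ^ 2 := by gcongr; exact norm_add_le X Y
  have h2 : 2 * ‖X‖ * ‖Y‖ ≤ k * ‖X‖ ^ 2 + 1 / k * ‖Y‖ ^ 2 := by
    have h3 : k * ‖X‖ ^ 2 + 1 / k * ‖Y‖ ^ 2 - 2 * ‖X‖ * ‖Y‖ = (k * ‖X‖ - ‖Y‖) ^ 2 / k := by
      field_simp; ring
    have : 0 ≤ (k * ‖X‖ - ‖Y‖) ^ 2 / k := by positivity
    linarith
  nlinarith

/-- Convexity of the squared norm. Having no constant in front, it costs no energy where the cutoff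
is strictly between `0` and `1`. -/
lemma norm_convex_sq_le {E : Type*} [NormedAddCommGroup E] [NormedSpace ℝ E] (X Y : E) {t : ℝ}
    (h0 : 0 ≤ t) (h1 : t ≤ 1) :
    ‖X + t • (Y - X)‖ ^ 2 ≤ (1 - t) * ‖X‖ ^ 2 + t * ‖Y‖ ^ 2 := by
  have e : X + t • (Y - X) = (1 - t) • X + t • Y := by
    rw [smul_sub, sub_smul, one_smul]; abel
  have h2 : ‖X + t • (Y - X)‖ ≤ (1 - t) * ‖X‖ + t * ‖Y‖ := by
    rw [e]
    refine (norm_add_le _ _).trans_eq ?_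
    rw [norm_smul, norm_smul, Real.norm_of_nonneg h0, Real.norm_of_nonneg (sub_nonneg.2 h1)]
  calc ‖X + t • (Y - X)‖ ^ 2 ≤ ((1 - t) * ‖X‖ + t * ‖Y‖) ^ 2 := by gcongr
    _ ≤ _ := by nlinarith [mul_nonneg h0 (sub_nonneg.2 h1), sq_nonneg (‖X‖ - ‖Y‖),
        mul_nonneg (mul_nonneg h0 (sub_nonneg.2 h1)) (sq_nonneg (‖X‖ - ‖Y‖))]

/-- The constant in the transport estimate. -/
def transportConst (L R : ℝ) : ℝ := 1 + 2 * L * R + 2 * L ^ 2 * R ^ 2 + R ^ 2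

/-- Transport in a single ball: a function is modified inside a ball in such a way that its energy
for the coefficient `a` is almost bounded by the energy of the original function for the
coefficient `a'`, whose soft inclusion is a dilation of that of `a`. -/
lemma exists_cell_transport (hd : 2 ≤ d) (f : ContDiffBump (0 : Space d)) {L : ℝ}
    (hL : ∀ x, ‖fderiv ℝ f x‖ ≤ L) {a a' : Space d → ℝ} {κ : ℝ} (ha : IsCoeff a κ)
    (ha' : IsCoeff a' κ) (hκ : 0 < κ) {c : Space d} {R k s : ℝ} (hk0 : 0 < k) (hk1 : k ≤ 1)
    (hs : 1 ≤ s) (hsk : s ≤ 1 + k) (hR : s * f.rOut < R)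
    (hsame : ∀ x ∈ Metric.ball c R, f.rIn ≤ dist x c → a x ≤ a' x)
    (hdil : ∀ x ∈ Metric.ball c f.rOut, a x ≤ a' (dilation c s x)) (v : H1 d) :
    ∃ w : H1 d, (∀ᵐ x, x ∉ Metric.ball c R → (w : L2 d) x = (v : L2 d) x) ∧
      (∀ᵐ x, x ∉ Metric.ball c R → grad w x = grad v x) ∧
      ∫ x in Metric.ball c R, a x * ‖grad w x‖ ^ 2 ≤
        (∫ x in Metric.ball c R, a' x * ‖grad v x‖ ^ 2) +
          k * transportConst L R * ∫ x in Metric.ball c R, ‖grad v x‖ ^ 2 ∧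
      ∫ x in Metric.ball c R, ‖(w : L2 d) x - (v : L2 d) x‖ ^ 2 ≤
        k * transportConst L R * ∫ x in Metric.ball c R, ‖grad v x‖ ^ 2 := by
  have hs0 : 0 < s := by linarith
  have hL0 : 0 ≤ L := (norm_nonneg _).trans (hL 0)
  have hrR : f.rOut < R := lt_of_le_of_lt (by nlinarith [f.rOut_pos]) hR
  have hR0 : 0 < R := f.rOut_pos.trans hrR
  set u : Space d → ℂ := ((v : L2 d) : Space d → ℂ) with hu_def
  set g : Space d → EuclideanSpace ℂ (Fin d) := (grad v : Space d → EuclideanSpace ℂ (Fin d))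
    with hg_def
  have hu : MemLp u 2 (volume : Measure (Space d)) := Lp.memLp _
  have hg : MemLp g 2 (volume : Measure (Space d)) := Lp.memLp _
  have hug : HasWeakGradient u g := isWeakGradient_grad v
  let D := dilation c s
  let χ : Space d → ℝ := fun x => f (x - c)
  have hχ : ContDiff ℝ ∞ χ := f.contDiff.comp (contDiff_id.sub contDiff_const)
  have hχ0 : ∀ x, 0 ≤ χ x := fun x => f.nonneg
  have hχ1 : ∀ x, χ x ≤ 1 := fun x => f.le_one
  have hχin : ∀ x, dist x c ≤ f.rIn → χ x = 1 := fun x hx =>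
    f.one_of_mem_closedBall (by rwa [mem_closedBall_zero_iff, ← dist_eq_norm])
  have hχout : ∀ x, x ∉ Metric.ball c f.rOut → χ x = 0 := fun x hx =>
    f.zero_of_le_dist (by rwa [Metric.mem_ball, not_lt, dist_eq_norm, ← dist_zero_right] at hx)
  have hχlip : ∀ x y, χ x ≤ χ y + L * ‖x - y‖ := by
    intro x y
    have := Convex.norm_image_sub_le_of_norm_fderiv_le (𝕜 := ℝ) (f := f) (s := Set.univ)
      (fun z _ => (f.contDiff (n := 1)).differentiable (by simp) z) (fun z _ => hL z) convex_univ
      (Set.mem_univ (y - c)) (Set.mem_univ (x - c))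
    rw [sub_sub_sub_cancel_right] at this
    have h2 := (le_abs_self _).trans this
    change f (x - c) ≤ f (y - c) + _
    linarith
  have hχd : ∀ x, ‖gradReal χ x‖ ≤ L := by
    intro x
    rw [norm_gradReal]
    have : fderiv ℝ χ x = fderiv ℝ f (x - c) := by
      have h1 := (((f.contDiff (n := 1)).differentiable (by simp)) (x - c)).hasFDerivAt.comp x
        ((hasFDerivAt_id x).sub_const c)
      exact h1.fderiv
    rw [this]; exact hL _
  have hχd0 : ∀ x, x ∉ Metric.ball c f.rOut → gradReal χ x = 0 := by
    intro x hx
    have hmin : IsLocalMin χ x := Filter.Eventually.of_forall fun y => by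
      rw [hχout x hx]; exact hχ0 y
    rw [← norm_eq_zero, norm_gradReal, hmin.fderiv_eq_zero, norm_zero]
  -- The new function is `u + χ z`: it equals `u ∘ D` where `χ = 1` and `u` where `χ = 0`. Its
  -- gradient interpolates between `g` and `s • g ∘ D`, up to the term `z ∇χ`.
  let z : Space d → ℂ := fun x => u (D x) - u x
  let y : Space d → EuclideanSpace ℂ (Fin d) := fun x => s • g (D x) - g x
  have huD := memLp_comp_dilation hu c hs0
  have hgD := memLp_comp_dilation hg c hs0
  have hz : MemLp z 2 (volume : Measure (Space d)) := huD.sub hu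
  have hy : MemLp y 2 (volume : Measure (Space d)) := (hgD.const_smul s).sub hg
  have hzy : HasWeakGradient z y := by
    have := (hug.comp_dilation c hs0).add huD hu.neg (hgD.const_smul s) hg.neg hug.neg
    exact this.congr (Filter.Eventually.of_forall fun x => (sub_eq_add_neg _ _).symm)
      (Filter.Eventually.of_forall fun x => (sub_eq_add_neg _ _).symm)
  have hpq := hzy.smul_smooth hz hy hχ
  have hp : MemLp (fun x => χ x • z x) 2 (volume : Measure (Space d)) := by
    refine hz.of_le (hχ.continuous.aestronglyMeasurable.smul hz.aestronglyMeasurable)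
      (Filter.Eventually.of_forall fun x => ?_)
    rw [norm_smul, Real.norm_of_nonneg (hχ0 x)]
    exact mul_le_of_le_one_left (norm_nonneg _) (hχ1 x)
  have hq1 : MemLp (fun x => χ x • y x) 2 (volume : Measure (Space d)) := by
    refine hy.of_le (hχ.continuous.aestronglyMeasurable.smul hy.aestronglyMeasurable)
      (Filter.Eventually.of_forall fun x => ?_)
    rw [norm_smul, Real.norm_of_nonneg (hχ0 x)]
    exact mul_le_of_le_one_left (norm_nonneg _) (hχ1 x)
  have hq2 : MemLp (fun x => z x • gradReal χ x) 2 (volume : Measure (Space d)) := by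
    refine (hz.const_smul (L : ℝ)).of_le
      (hz.aestronglyMeasurable.smul (continuous_gradReal hχ).aestronglyMeasurable)
      (Filter.Eventually.of_forall fun x => ?_)
    rw [norm_smul, Pi.smul_apply, norm_smul, Real.norm_of_nonneg hL0, mul_comm]
    exact mul_le_mul_of_nonneg_right (hχd x) (norm_nonneg _)
  obtain ⟨w, hw, hwg⟩ := exists_H1_of_hasWeakGradient (hu.add hp) (hg.add (hq1.add hq2))
    (hug.add hu hp hg (hq1.add hq2) hpq)
  have hout : ∀ x, x ∉ Metric.ball c R → χ x = 0 ∧ gradReal χ x = 0 := fun x hx =>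
    have hx' := mt (fun h => Metric.ball_subset_ball hrR.le h) hx
    ⟨hχout x hx', hχd0 x hx'⟩
  set B := Metric.ball c R with hB
  have hBm : MeasurableSet B := Metric.isOpen_ball.measurableSet
  set B₁ := Metric.ball c f.rOut with hB₁
  have hB₁m : MeasurableSet B₁ := Metric.isOpen_ball.measurableSet
  set N := ∫ x in B, ‖g x‖ ^ 2 with hN
  have hN0 : 0 ≤ N := integral_nonneg fun x => by positivity
  -- Quadratic in `k`, hence still of order `k` after the factor `1 + 1 / k` of Young's inequality.
  have hZ : ∫ x in B₁, ‖z x‖ ^ 2 ≤ k ^ 2 * R ^ 2 * N := by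
    refine (setIntegral_sub_dilation_le hu hg hug c hs hR).trans
      (mul_le_mul_of_nonneg_right ?_ hN0)
    rw [mul_pow]
    have h1 : (s - 1) ^ 2 ≤ k ^ 2 := pow_le_pow_left₀ (by linarith) (by linarith) 2
    have h2 : f.rOut ^ 2 ≤ R ^ 2 := pow_le_pow_left₀ f.rOut_pos.le hrR.le 2
    exact mul_le_mul h1 h2 (by positivity) (by positivity)
  refine ⟨w, ?_, ?_, ?_, ?_⟩
  · filter_upwards [hw] with x hx hxB
    rw [hx]; simp [(hout x hxB).1, hu_def]
  · filter_upwards [hwg] with x hx hxB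
    rw [hx]; simp [(hout x hxB).1, (hout x hxB).2, hg_def]
  -- `G` is defined so that `G ∘ D` is the weighted energy density of `u ∘ D`, ready for a change of
  -- variables.
  · let G : Space d → ℝ := fun x => s ^ 2 * χ (dilation c s⁻¹ x) * (a' x * ‖g x‖ ^ 2)
    have ig : Integrable fun x => ‖g x‖ ^ 2 := integrable_norm_sq hg
    have iag : Integrable fun x => a' x * ‖g x‖ ^ 2 := integrable_energy ha' hκ v
    have iG : Integrable G := by
      have : Integrable fun x => χ (dilation c s⁻¹ x) * (a' x * ‖g x‖ ^ 2) := by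
        refine iag.mono ((hχ.continuous.comp (continuous_dilation c s⁻¹)).aestronglyMeasurable.mul
          iag.aestronglyMeasurable) (Filter.Eventually.of_forall fun x => ?_)
        rw [norm_mul, Real.norm_of_nonneg (hχ0 _)]
        exact mul_le_of_le_one_left (norm_nonneg _) (hχ1 _)
      simpa only [G, mul_assoc] using this.const_mul (s ^ 2)
    have iGD : Integrable fun x => G (D x) := by
      have h1 : Integrable G (Measure.map (dilation c s) (volume : Measure (Space d))) := by
        rw [map_dilation c hs0]
        exact iG.smul_measure ENNReal.ofReal_ne_top
      exact h1.comp_aemeasurable (continuous_dilation c s).aemeasurable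
    have i1 : Integrable fun x => (1 - χ x) * (a' x * ‖g x‖ ^ 2) := by
      refine iag.mono ((continuous_const.sub hχ.continuous).aestronglyMeasurable.mul
          iag.aestronglyMeasurable) (Filter.Eventually.of_forall fun x => ?_)
      rw [norm_mul, Real.norm_of_nonneg (sub_nonneg.2 (hχ1 _))]
      exact mul_le_of_le_one_left (norm_nonneg _) (by linarith [hχ0 x])
    have iz : Integrable (B₁.indicator fun x => ‖z x‖ ^ 2) := (integrable_norm_sq hz).indicator hB₁m
    have hG : ∀ x, G (D x) = s ^ 2 * χ x * (a' (D x) * ‖g (D x)‖ ^ 2) := fun x => by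
      simp only [G, D, dilation_inv hs0.ne']
    have point : ∀ᵐ x, x ∈ B → a x * ‖grad w x‖ ^ 2 ≤
        (1 + k) * ((1 - χ x) * (a' x * ‖g x‖ ^ 2) + G (D x))
          + (1 + 1 / k) * L ^ 2 * B₁.indicator (fun x => ‖z x‖ ^ 2) x := by
      filter_upwards [hwg] with x hx hxB
      have e : grad w x = (g x + χ x • (s • g (D x) - g x)) + z x • gradReal χ x := by
        rw [hx]; simp only [Pi.add_apply, y]; abel
      have ha0 : 0 ≤ a x := hκ.le.trans (ha.ge x)
      have h1 := norm_add_sq_le_weighted (g x + χ x • (s • g (D x) - g x)) (z x • gradReal χ x) hk0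
      have h2 := norm_convex_sq_le (g x) (s • g (D x)) (hχ0 x) (hχ1 x)
      have h3 : ‖z x • gradReal χ x‖ ^ 2 ≤ L ^ 2 * B₁.indicator (fun x => ‖z x‖ ^ 2) x := by
        by_cases hx1 : x ∈ B₁
        · rw [Set.indicator_of_mem hx1, norm_smul, mul_pow, mul_comm]
          exact mul_le_mul_of_nonneg_right (pow_le_pow_left₀ (norm_nonneg _) (hχd x) 2)
            (by positivity)
        · rw [Set.indicator_of_notMem hx1, hχd0 x hx1]; simp
      -- The coefficients are compared directly only outside the inner ball; inside it the weight `1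
      -- - χ` vanishes.
      have h4 : a x * ((1 - χ x) * ‖g x‖ ^ 2) ≤ (1 - χ x) * (a' x * ‖g x‖ ^ 2) := by
        rcases le_total (dist x c) f.rIn with h | h
        · rw [hχin x h]; simp
        · have := mul_le_mul_of_nonneg_right (hsame x hxB h)
            (mul_nonneg (sub_nonneg.2 (hχ1 x)) (sq_nonneg ‖g x‖))
          linarith
      have h5 : a x * (χ x * ‖s • g (D x)‖ ^ 2) ≤ G (D x) := by
        rw [hG, norm_smul, Real.norm_of_nonneg hs0.le]
        by_cases hx1 : x ∈ B₁
        · have := mul_le_mul_of_nonneg_right (hdil x hx1)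
            (mul_nonneg (mul_nonneg (sq_nonneg s) (hχ0 x)) (sq_nonneg ‖g (D x)‖))
          calc _ = a x * (s ^ 2 * χ x * ‖g (D x)‖ ^ 2) := by ring
            _ ≤ a' (D x) * (s ^ 2 * χ x * ‖g (D x)‖ ^ 2) := this
            _ = _ := by ring
        · rw [hχout x hx1]; simp
      have hk' : 0 < 1 / k := by positivity
      have h6 : 0 ≤ L ^ 2 * B₁.indicator (fun x => ‖z x‖ ^ 2) x := (sq_nonneg _).trans h3
      rw [e]
      calc a x * ‖(g x + χ x • (s • g (D x) - g x)) + z x • gradReal χ x‖ ^ 2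
          ≤ a x * ((1 + k) * ((1 - χ x) * ‖g x‖ ^ 2 + χ x * ‖s • g (D x)‖ ^ 2)
            + (1 + 1 / k) * (L ^ 2 * B₁.indicator (fun x => ‖z x‖ ^ 2) x)) := by
            refine mul_le_mul_of_nonneg_left (h1.trans ?_) ha0
            gcongr
        _ = (1 + k) * (a x * ((1 - χ x) * ‖g x‖ ^ 2) + a x * (χ x * ‖s • g (D x)‖ ^ 2))
            + a x * ((1 + 1 / k) * (L ^ 2 * B₁.indicator (fun x => ‖z x‖ ^ 2) x)) := by ring
        _ ≤ (1 + k) * ((1 - χ x) * (a' x * ‖g x‖ ^ 2) + G (D x))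
            + (1 + 1 / k) * (L ^ 2 * B₁.indicator (fun x => ‖z x‖ ^ 2) x) := by
            refine add_le_add (mul_le_mul_of_nonneg_left (add_le_add h4 h5) (by linarith)) ?_
            exact mul_le_of_le_one_left (by positivity) (ha.le x)
        _ = _ := by ring
    have hI2 : ∫ x in B, G (D x) ≤ ∫ x in B, χ (dilation c s⁻¹ x) * (a' x * ‖g x‖ ^ 2) := by
      have hGn : ∀ x, 0 ≤ G x := fun x => mul_nonneg (mul_nonneg (sq_nonneg s) (hχ0 _))
        (mul_nonneg (hκ.le.trans (ha'.ge x)) (sq_nonneg _))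
      have h1 : ∫ x in B, G (D x) ≤ ∫ x, G (D x) :=
        setIntegral_le_integral iGD (Filter.Eventually.of_forall fun x => hGn _)
      have h2 : ∫ x, G x = ∫ x in B, G x := by
        refine (setIntegral_eq_integral_of_forall_compl_eq_zero fun x hx => ?_).symm
        have : dilation c s⁻¹ x ∉ B₁ := by
          intro h
          apply hx
          have := (mem_ball_dilation (R := f.rOut) hs0).2 h
          rw [dilation_inv' hs0.ne'] at this
          exact Metric.ball_subset_ball hR.le this
        simp only [G, hχout _ this]; ring
      refine h1.trans ?_
      rw [integral_comp_dilation c hs0, h2, smul_eq_mul]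
      have e : ∫ x in B, G x = s ^ 2 * ∫ x in B, χ (dilation c s⁻¹ x) * (a' x * ‖g x‖ ^ 2) := by
        rw [← integral_const_mul]; simp only [G, mul_assoc]
      rw [e, ← mul_assoc]
      refine mul_le_of_le_one_left (integral_nonneg fun x => mul_nonneg (hχ0 _)
        (mul_nonneg (hκ.le.trans (ha'.ge x)) (sq_nonneg _))) ?_
      rw [inv_mul_le_iff₀ (by positivity), mul_one]
      -- Here `d ≥ 2` is needed: the gradient contributes `s ^ 2` and the Jacobian `(s ^ d)⁻¹`.
      exact pow_le_pow_right₀ hs hd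
    -- After the change of variables the weights `1 - χ x` and `χ (D⁻¹ x)` sum to at most `1 + L k
    -- R`, as `D⁻¹` moves points of the ball by at most `k R`.
    have hI12 : (∫ x in B, (1 - χ x) * (a' x * ‖g x‖ ^ 2)) + ∫ x in B, G (D x)
        ≤ (∫ x in B, a' x * ‖g x‖ ^ 2) + L * (k * R) * N := by
      have i2 : Integrable fun x => χ (dilation c s⁻¹ x) * (a' x * ‖g x‖ ^ 2) := by
        have := iG.const_mul ((s ^ 2)⁻¹)
        refine this.congr (Filter.Eventually.of_forall fun x => ?_)
        simp only [G]
        field_simp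
      have hle : (∫ x in B, (1 - χ x) * (a' x * ‖g x‖ ^ 2))
          + ∫ x in B, χ (dilation c s⁻¹ x) * (a' x * ‖g x‖ ^ 2)
          ≤ ∫ x in B, (a' x * ‖g x‖ ^ 2 + L * (k * R) * ‖g x‖ ^ 2) := by
        rw [← integral_add i1.integrableOn i2.integrableOn]
        refine setIntegral_mono_on (i1.add i2).integrableOn
          (iag.add (ig.const_mul _)).integrableOn hBm fun x hx => ?_
        have h1 : χ (dilation c s⁻¹ x) ≤ χ x + L * (k * R) := by
          refine (hχlip _ x).trans (add_le_add_right (mul_le_mul_of_nonneg_left ?_ hL0) _)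
          have e : dilation c s⁻¹ x - x = (s⁻¹ - 1) • (x - c) := by
            simp only [dilation, sub_smul, one_smul]; abel
          rw [e, norm_smul]
          refine mul_le_mul ?_ (mem_ball_iff_norm.1 hx).le (norm_nonneg _) hk0.le
          rw [Real.norm_eq_abs, abs_le]
          have h3 : s⁻¹ ≤ 1 := inv_le_one_of_one_le₀ hs
          have h4 : 1 - k ≤ s⁻¹ := by
            rw [← one_div, le_div_iff₀ hs0]
            nlinarith
          constructor <;> linarith
        have h2 : 0 ≤ a' x * ‖g x‖ ^ 2 := mul_nonneg (hκ.le.trans (ha'.ge x)) (sq_nonneg _)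
        have h3 : a' x * ‖g x‖ ^ 2 ≤ ‖g x‖ ^ 2 :=
          mul_le_of_le_one_left (sq_nonneg _) (ha'.le x)
        have h4 : 0 ≤ L * (k * R) := by positivity
        have h5 := mul_le_mul_of_nonneg_right h1 h2
        have h6 := mul_le_mul_of_nonneg_left h3 h4
        change (1 - χ x) * (a' x * ‖g x‖ ^ 2) + χ (dilation c s⁻¹ x) * (a' x * ‖g x‖ ^ 2)
          ≤ a' x * ‖g x‖ ^ 2 + L * (k * R) * ‖g x‖ ^ 2
        linarith
      rw [integral_add iag.integrableOn (ig.const_mul _).integrableOn, integral_const_mul] at hle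
      linarith
    have hZ' : ∫ x in B, B₁.indicator (fun x => ‖z x‖ ^ 2) x ≤ k ^ 2 * R ^ 2 * N := by
      rw [setIntegral_indicator hB₁m, Set.inter_eq_right.2 (Metric.ball_subset_ball hrR.le)]
      exact hZ
    have i12 : Integrable fun x => (1 + k) * ((1 - χ x) * (a' x * ‖g x‖ ^ 2) + G (D x)) :=
      (i1.add iGD).const_mul (1 + k)
    have iz' := iz.const_mul ((1 + 1 / k) * L ^ 2)
    have hint := setIntegral_mono_on_ae (integrable_energy ha hκ w).integrableOn
      (i12.add iz').integrableOn hBm point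
    refine hint.trans ?_
    rw [integral_add' i12.integrableOn iz'.integrableOn, integral_const_mul, integral_const_mul,
      integral_add i1.integrableOn iGD.integrableOn]
    have hE : ∫ x in B, a' x * ‖g x‖ ^ 2 ≤ N :=
      setIntegral_mono iag.integrableOn ig.integrableOn fun x =>
        mul_le_of_le_one_left (sq_nonneg _) (ha'.le x)
    -- In `transportConst`, `1` pays for the factor `1 + k` on the energy, `2 L R` for the shifted
    -- cutoff and `2 L² R²` for the term `z ∇χ`; `R²` is spent in the `L²` bound.
    have h1 := mul_le_mul_of_nonneg_left hI12 (by linarith : 0 ≤ 1 + k)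
    have h2 := mul_le_mul_of_nonneg_left hZ' (by positivity : 0 ≤ (1 + 1 / k) * L ^ 2)
    have h3 : (1 + 1 / k) * L ^ 2 * (k ^ 2 * R ^ 2 * N) = (k + 1) * k * (L ^ 2 * R ^ 2 * N) := by
      field_simp
    have h4 : (k + 1) * k * (L ^ 2 * R ^ 2 * N) ≤ 2 * k * (L ^ 2 * R ^ 2 * N) := by
      refine mul_le_mul_of_nonneg_right ?_ (by positivity)
      nlinarith
    have h5 : (1 + k) * (L * (k * R) * N) ≤ 2 * (L * (k * R) * N) :=
      mul_le_mul_of_nonneg_right (by linarith) (by positivity)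
    have h6 : k * (∫ x in B, a' x * ‖g x‖ ^ 2) ≤ k * N := mul_le_mul_of_nonneg_left hE hk0.le
    have h7 : 0 ≤ k * R ^ 2 * N := by positivity
    unfold transportConst
    linarith
  · have h1 : ∫ x in B, ‖(w : L2 d) x - u x‖ ^ 2 ≤ ∫ x in B, B₁.indicator (fun x => ‖z x‖ ^ 2) x := by
      refine setIntegral_mono_on_ae (integrable_norm_sq ((Lp.memLp _).sub hu)).integrableOn
        ((integrable_norm_sq hz).indicator hB₁m).integrableOn hBm ?_
      filter_upwards [hw] with x hx _
      rw [hx, Pi.add_apply, add_sub_cancel_left, norm_smul, Real.norm_of_nonneg (hχ0 x)]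
      by_cases hx1 : x ∈ B₁
      · rw [Set.indicator_of_mem hx1]
        exact pow_le_pow_left₀ (mul_nonneg (hχ0 x) (norm_nonneg _))
          (mul_le_of_le_one_left (norm_nonneg _) (hχ1 x)) 2
      · rw [Set.indicator_of_notMem hx1, hχout x hx1]; simp
    rw [setIntegral_indicator hB₁m, Set.inter_eq_right.2 (Metric.ball_subset_ball hrR.le)] at h1
    refine (h1.trans hZ).trans (mul_le_mul_of_nonneg_right ?_ hN0)
    unfold transportConst
    have h2 : k ^ 2 * R ^ 2 ≤ k * R ^ 2 :=
      mul_le_mul_of_nonneg_right (by nlinarith) (by positivity)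
    have h3 : 0 ≤ k * (1 + 2 * L * R + 2 * L ^ 2 * R ^ 2) := by positivity
    linarith

end CellTransport

/-! ### Combining the modifications of all cells -/

section GlobalTransport

variable {d : ℕ}

lemma norm_sq_eq_integral {E : Type*} [NormedAddCommGroup E] [InnerProductSpace ℂ E]
    (f : Lp E 2 (volume : Measure (Space d))) : ‖f‖ ^ 2 = ∫ x, ‖f x‖ ^ 2 := by
  have h : ((‖f‖ ^ 2 : ℝ) : ℂ) = ((∫ x, ‖f x‖ ^ 2 : ℝ) : ℂ) := by
    rw [← integral_complex_ofReal]
    have := L2.inner_def (𝕜 := ℂ) f f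
    rw [inner_self_eq_norm_sq_to_K] at this
    push_cast
    refine Eq.trans this (integral_congr_ae (Filter.Eventually.of_forall fun x => ?_))
    exact inner_self_eq_norm_sq_to_K (𝕜 := ℂ) (f x)
  exact_mod_cast h

/-- The estimate of a function `w` by a function `v` on a set `S`, with loss `η`. -/
def LocalTransport (a a' : Space d → ℝ) (η : ℝ) (S : Set (Space d)) (v w : H1 d) : Prop :=
  ∫ x in S, a x * ‖grad w x‖ ^ 2 ≤
      (∫ x in S, a' x * ‖grad v x‖ ^ 2) + η * ∫ x in S, ‖grad v x‖ ^ 2 ∧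
  ∫ x in S, ‖(w : L2 d) x - (v : L2 d) x‖ ^ 2 ≤ η * ∫ x in S, ‖grad v x‖ ^ 2

/-- Two Sobolev functions agree on a set, together with their gradients. -/
def AgreeOn (S : Set (Space d)) (v w : H1 d) : Prop :=
  ∀ᵐ x, x ∈ S → (w : L2 d) x = (v : L2 d) x ∧ grad w x = grad v x

lemma LocalTransport.congr {a a' : Space d → ℝ} {η : ℝ} {S : Set (Space d)} {v w v' w' : H1 d}
    (h : LocalTransport a a' η S v w) (hS : MeasurableSet S) (hv : AgreeOn S v v')
    (hw : AgreeOn S w w') : LocalTransport a a' η S v' w' := by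
  have e1 : ∫ x in S, a x * ‖grad w' x‖ ^ 2 = ∫ x in S, a x * ‖grad w x‖ ^ 2 :=
    setIntegral_congr_ae hS (hw.mono fun x hx hxS => by rw [(hx hxS).2])
  have e2 : ∫ x in S, a' x * ‖grad v' x‖ ^ 2 = ∫ x in S, a' x * ‖grad v x‖ ^ 2 :=
    setIntegral_congr_ae hS (hv.mono fun x hx hxS => by rw [(hx hxS).2])
  have e3 : ∫ x in S, ‖grad v' x‖ ^ 2 = ∫ x in S, ‖grad v x‖ ^ 2 :=
    setIntegral_congr_ae hS (hv.mono fun x hx hxS => by rw [(hx hxS).2])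
  have e4 : ∫ x in S, ‖(w' : L2 d) x - (v' : L2 d) x‖ ^ 2
      = ∫ x in S, ‖(w : L2 d) x - (v : L2 d) x‖ ^ 2 :=
    setIntegral_congr_ae hS (by
      filter_upwards [hv, hw] with x hx hx' hxS
      rw [(hx hxS).1, (hx' hxS).1])
  unfold LocalTransport
  rw [e1, e2, e3, e4]
  exact h

lemma AgreeOn.refl (S : Set (Space d)) (v : H1 d) : AgreeOn S v v :=
  Filter.Eventually.of_forall fun _ _ => ⟨rfl, rfl⟩

lemma AgreeOn.symm {S : Set (Space d)} {v w : H1 d} (h : AgreeOn S v w) : AgreeOn S w v :=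
  h.mono fun _ hx hxS => ⟨(hx hxS).1.symm, (hx hxS).2.symm⟩

lemma AgreeOn.subset {S T : Set (Space d)} {v w : H1 d} (h : AgreeOn S v w) (hT : T ⊆ S) :
    AgreeOn T v w := Filter.Eventually.mono h fun _ hx hxT => hx (hT hxT)

variable {ι : Type*} {B : ι → Set (Space d)} {a a' : Space d → ℝ} {η κ : ℝ}

/-- Local modifications in finitely many disjoint sets. -/
lemma exists_finset_transport (hBm : ∀ z, MeasurableSet (B z))
    (hB : Pairwise (Function.onFun Disjoint B))
    (hcell : ∀ z v, ∃ w, AgreeOn (B z)ᶜ v w ∧ LocalTransport a a' η (B z) v w)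
    (v : H1 d) (F : Finset ι) :
    ∃ w, AgreeOn (⋃ z ∈ F, B z)ᶜ v w ∧ ∀ z ∈ F, LocalTransport a a' η (B z) v w := by
  classical
  induction F using Finset.induction_on with
  | empty => exact ⟨v, AgreeOn.refl _ _, by simp⟩
  | insert z₀ F hz₀ ih =>
    obtain ⟨w, hw, hF⟩ := ih
    -- The cell estimate is applied to the function already modified elsewhere. By disjointness that
    -- function is still `v` on `B z₀`, and the new change leaves the earlier sets alone.
    obtain ⟨w', hw', h'⟩ := hcell z₀ w
    refine ⟨w', ?_, fun z hz => ?_⟩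
    · filter_upwards [hw, hw'] with x h1 h2 hx
      simp only [Finset.mem_insert, Set.iUnion_iUnion_eq_or_left, Set.compl_union,
        Set.mem_inter_iff] at hx
      exact ⟨(h2 hx.1).1.trans (h1 hx.2).1, (h2 hx.1).2.trans (h1 hx.2).2⟩
    · rcases Finset.mem_insert.1 hz with rfl | hzF
      · refine h'.congr (hBm z) (hw.subset ?_).symm (AgreeOn.refl _ _)
        rw [Set.subset_compl_iff_disjoint_right, Set.disjoint_iUnion₂_right]
        exact fun z' hz' => hB fun h => hz₀ (h ▸ hz')
      · refine (hF z hzF).congr (hBm z) (AgreeOn.refl _ _) (hw'.subset ?_)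
        rw [Set.subset_compl_iff_disjoint_right]
        exact hB fun h => hz₀ (h ▸ hzF)

/-- Local modifications in countably many disjoint sets, up to an arbitrarily small error. -/
lemma exists_global_transport [Countable ι] (hBm : ∀ z, MeasurableSet (B z))
    (hB : Pairwise (Function.onFun Disjoint B)) (ha : IsCoeff a κ) (ha' : IsCoeff a' κ)
    (hκ : 0 < κ) (haa' : ∀ x, x ∉ ⋃ z, B z → a x ≤ a' x) (hη : 0 ≤ η)
    (hcell : ∀ z v, ∃ w, AgreeOn (B z)ᶜ v w ∧ LocalTransport a a' η (B z) v w)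
    (v : H1 d) {θ : ℝ} (hθ : 0 < θ) :
    ∃ w : H1 d, energy a w ≤ energy a' v + η * ‖grad v‖ ^ 2 + θ ∧
      ‖(w : L2 d) - v‖ ^ 2 ≤ η * ‖grad v‖ ^ 2 := by
  classical
  set U := ⋃ z, B z with hU
  have hUm : MeasurableSet U := MeasurableSet.iUnion hBm
  have ig : Integrable fun x => ‖grad v x‖ ^ 2 := integrable_norm_sq (Lp.memLp (grad v))
  have iav := integrable_energy ha hκ v
  have iav' := integrable_energy ha' hκ v
  have hsg := hasSum_integral_iUnion hBm hB (f := fun x => ‖grad v x‖ ^ 2)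
    (μ := (volume : Measure (Space d))) ig.integrableOn
  -- Only finitely many sets are modified, so no infinite gluing is needed. The sets outside `F`
  -- carry less than `θ` of the squared gradient.
  obtain ⟨F, hF⟩ := (hsg.eventually (lt_mem_nhds (sub_lt_self _ hθ))).exists
  obtain ⟨w, hw, hwF⟩ := exists_finset_transport hBm hB hcell v F
  have hFU : Uᶜ ⊆ (⋃ z ∈ F, B z)ᶜ :=
    Set.compl_subset_compl.2 (Set.iUnion₂_subset fun z _ => Set.subset_iUnion B z)
  have hnot : ∀ z, z ∉ F → AgreeOn (B z) v w := by
    intro z hz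
    refine hw.subset ?_
    rw [Set.subset_compl_iff_disjoint_right, Set.disjoint_iUnion₂_right]
    exact fun z' hz' => hB fun h => hz (h ▸ hz')
  have hNU : ∫ x in U, ‖grad v x‖ ^ 2 ≤ ‖grad v‖ ^ 2 := by
    rw [norm_sq_eq_integral]
    exact setIntegral_le_integral ig (Filter.Eventually.of_forall fun x => by positivity)
  have iaw := integrable_energy ha hκ w
  have hg0 : ∀ z, 0 ≤ ∫ x in B z, ‖grad v x‖ ^ 2 := fun z =>
    integral_nonneg fun x => by positivity
  refine ⟨w, ?_, ?_⟩
  · have hout : ∫ x in Uᶜ, a x * ‖grad w x‖ ^ 2 ≤ ∫ x in Uᶜ, a' x * ‖grad v x‖ ^ 2 := by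
      refine setIntegral_mono_on_ae iaw.integrableOn iav'.integrableOn hUm.compl ?_
      filter_upwards [hw] with x hx hxU
      rw [(hx (hFU hxU)).2]
      exact mul_le_mul_of_nonneg_right (haa' x hxU) (by positivity)
    have hsw := hasSum_integral_iUnion hBm hB (μ := (volume : Measure (Space d))) iaw.integrableOn
    have hsv := hasSum_integral_iUnion hBm hB (μ := (volume : Measure (Space d))) iav'.integrableOn
    have hsF : HasSum (fun z => if z ∈ F then ∫ x in B z, ‖grad v x‖ ^ 2 else 0)
        (∑ z ∈ F, ∫ x in B z, ‖grad v x‖ ^ 2) := by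
      have := hasSum_sum_of_ne_finset_zero (s := F) (L := SummationFilter.unconditional ι)
        (f := fun z => if z ∈ F then ∫ x in B z, ‖grad v x‖ ^ 2 else 0)
        fun z hz => if_neg hz
      rwa [Finset.sum_congr rfl fun z hz => if_pos hz] at this
    -- The last summand is the squared gradient on the unmodified sets; it bounds their energy
    -- because `a ≤ 1`.
    have hle := hasSum_le (fun z => ?_) hsw ((hsv.add (hsg.mul_left η)).add (hsg.sub hsF))
    · rw [energy, energy, ← integral_add_compl hUm iaw, ← integral_add_compl hUm iav']
      have := mul_le_mul_of_nonneg_left hNU hη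
      linarith
    · have h0 := hg0 z
      by_cases hz : z ∈ F
      · rw [if_pos hz, sub_self, add_zero]
        exact (hwF z hz).1
      · rw [if_neg hz, sub_zero]
        have e : ∫ x in B z, a x * ‖grad w x‖ ^ 2 = ∫ x in B z, a x * ‖grad v x‖ ^ 2 :=
          setIntegral_congr_ae (hBm z) ((hnot z hz).mono fun x hx hxS => by rw [(hx hxS).2])
        have h1 : ∫ x in B z, a x * ‖grad v x‖ ^ 2 ≤ ∫ x in B z, ‖grad v x‖ ^ 2 :=
          setIntegral_mono iav.integrableOn ig.integrableOn fun x =>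
            mul_le_of_le_one_left (sq_nonneg _) (ha.le x)
        have h2 : 0 ≤ ∫ x in B z, a' x * ‖grad v x‖ ^ 2 :=
          integral_nonneg fun x => mul_nonneg (hκ.le.trans (ha'.ge x)) (sq_nonneg _)
        have h3 := mul_nonneg hη h0
        rw [e]
        linarith
  · have idw : Integrable fun x => ‖(w : L2 d) x - (v : L2 d) x‖ ^ 2 :=
      integrable_norm_sq ((Lp.memLp (w : L2 d)).sub (Lp.memLp (v : L2 d)))
    have e0 : ‖(w : L2 d) - v‖ ^ 2 = ∫ x, ‖(w : L2 d) x - (v : L2 d) x‖ ^ 2 := by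
      rw [norm_sq_eq_integral]
      refine integral_congr_ae ?_
      filter_upwards [Lp.coeFn_sub (w : L2 d) (v : L2 d)] with x hx
      rw [hx, Pi.sub_apply]
    have e1 : ∫ x in Uᶜ, ‖(w : L2 d) x - (v : L2 d) x‖ ^ 2 = 0 := by
      rw [setIntegral_congr_ae (g := fun _ => (0 : ℝ)) hUm.compl
        (hw.mono fun x hx hxU => by rw [(hx (hFU hxU)).1]; simp)]
      simp
    have hsw := hasSum_integral_iUnion hBm hB (μ := (volume : Measure (Space d))) idw.integrableOn
    have hle := hasSum_le (fun z => ?_) hsw (hsg.mul_left η)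
    · rw [e0, ← integral_add_compl hUm idw, e1, add_zero]
      exact hle.trans (mul_le_mul_of_nonneg_left hNU hη)
    · by_cases hz : z ∈ F
      · exact (hwF z hz).2
      · rw [setIntegral_congr_ae (g := fun _ => (0 : ℝ)) (hBm z)
          ((hnot z hz).mono fun x hx hxU => by rw [(hx hxU).1]; simp)]
        simpa using mul_nonneg hη (hg0 z)

end GlobalTransport

/-! ### Geometry of the cells and transport between sharp coefficients -/

section Geometry

variable {d : ℕ} {ε : ℝ}

lemma dist_cellCentre (hε : 0 < ε) {z z' : Fin d → ℤ} (h : z ≠ z') :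
    ε ≤ dist (cellCentre ε z) (cellCentre ε z') := by
  obtain ⟨i, hi⟩ := Function.ne_iff.1 h
  have h1 : (1 : ℝ) ≤ |(z i : ℝ) - z' i| := by
    have : 1 ≤ |z i - z' i| := Int.one_le_abs (sub_ne_zero.2 hi)
    exact_mod_cast this
  rw [dist_eq_norm]
  refine le_trans ?_ (PiLp.norm_apply_le (cellCentre ε z - cellCentre ε z') i)
  have e : (cellCentre ε z - cellCentre ε z') i = ε * ((z i : ℝ) - z' i) := by
    simp only [cellCentre, PiLp.sub_apply]; ring
  rw [e, Real.norm_eq_abs, abs_mul, abs_of_pos hε]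
  nlinarith

/-- The open ball inscribed in a cell. -/
def cellBall {d : ℕ} (ε : ℝ) (z : Fin d → ℤ) : Set (Space d) :=
  Metric.ball (cellCentre ε z) (ε / 2)

lemma disjoint_cellBall (hε : 0 < ε) :
    Pairwise (Function.onFun Disjoint (cellBall (d := d) ε)) := fun z z' h =>
  Metric.ball_disjoint_ball (by linarith [dist_cellCentre hε h])

lemma eq_of_mem_cellBall (hε : 0 < ε) {z z' : Fin d → ℤ} {x : Space d} (h : x ∈ cellBall ε z)
    (h' : x ∈ cellBall ε z') : z = z' := by
  by_contra hne
  exact Set.disjoint_left.1 (disjoint_cellBall hε hne) h h'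

variable {r r' : (Fin d → ℤ) → ℝ}

lemma ball_subset_cellBall (hε : 0 < ε) {ρ : ℝ} (hρ : ρ ≤ 1 / 2) (z : Fin d → ℤ) :
    Metric.ball (cellCentre ε z) (ε * ρ) ⊆ cellBall ε z :=
  Metric.ball_subset_ball (by nlinarith)

lemma isOpen_inclusions : IsOpen (inclusions (d := d) ε r) :=
  isOpen_iUnion fun _ => Metric.isOpen_ball

/-- Every inclusion stays in its own cell ball, and these balls are disjoint. -/
lemma mem_inclusions_iff (hε : 0 < ε) (hr : ∀ z, r z ≤ 1 / 2) {z : Fin d → ℤ} {x : Space d}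
    (hx : x ∈ cellBall ε z) :
    x ∈ inclusions ε r ↔ dist x (cellCentre ε z) < ε * r z := by
  rw [inclusions, Set.mem_iUnion]
  refine ⟨fun ⟨z', h⟩ => ?_, fun h => ⟨z, h⟩⟩
  rwa [eq_of_mem_cellBall hε hx (ball_subset_cellBall hε (hr z') z' h)]

lemma isCoeff_sharpCoeff (hε : 0 < ε) (hε1 : ε < 1) (r : (Fin d → ℤ) → ℝ) :
    IsCoeff (sharpCoeff (d := d) ε r) (ε ^ 2) := by
  have h1 : ε ^ 2 ≤ 1 := pow_le_one₀ hε.le hε1.le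
  refine ⟨?_, fun x => ?_, fun x => ?_⟩
  · exact Measurable.ite isOpen_inclusions.measurableSet measurable_const measurable_const
  · unfold sharpCoeff; split_ifs <;> linarith
  · unfold sharpCoeff; split_ifs <;> linarith

lemma sharpCoeff_anti (hε : 0 < ε) (hε1 : ε < 1) (h : ∀ z, r z ≤ r' z) (x : Space d) :
    sharpCoeff ε r' x ≤ sharpCoeff ε r x := by
  have h1 : ε ^ 2 ≤ 1 := pow_le_one₀ hε.le hε1.le
  have hsub : inclusions (d := d) ε r ⊆ inclusions ε r' :=
    Set.iUnion_mono fun z => Metric.ball_subset_ball (mul_le_mul_of_nonneg_left (h z) hε.le)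
  unfold sharpCoeff
  split_ifs with h2 h3 h3
  · exact le_rfl
  · exact h1
  · exact absurd (hsub h3) h2
  · exact le_rfl

/-- Transport between sharp coefficients with slightly different radii. -/
lemma exists_sharp_transport (hd : 2 ≤ d) (hε : 0 < ε) (hε1 : ε < 1) {rmax : ℝ} (hr0 : 0 < rmax)
    (hr1 : rmax < 1 / 2) : ∃ C, 0 < C ∧ ∀ k, 0 < k → k ≤ (1 / 2 - rmax) / 2 →
      ∀ r r' : (Fin d → ℤ) → ℝ, (∀ z, 0 < r z) → (∀ z, r z ≤ r' z) →
      (∀ z, r' z ≤ (1 + k) * r z) → (∀ z, r' z ≤ rmax) → ∀ v : H1 d, ∀ θ, 0 < θ →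
      ∃ w : H1 d, energy (sharpCoeff ε r) w
          ≤ energy (sharpCoeff ε r') v + k * C * ‖grad v‖ ^ 2 + θ ∧
        ‖(w : L2 d) - v‖ ^ 2 ≤ k * C * ‖grad v‖ ^ 2 := by
  -- The cutoff is `1` up to radius `ε * rmax`, beyond which both coefficients are `1` in the cell
  -- ball, and vanishes from halfway between that radius and `ε / 2`. One cutoff serves all cells,
  -- so the constant is uniform.
  let f : ContDiffBump (0 : Space d) :=
    ⟨ε * rmax, ε * ((rmax + 1 / 2) / 2), by positivity, by nlinarith⟩
  obtain ⟨L, hL⟩ := (((f.contDiff (n := 1)).continuous_fderiv (by simp))).bounded_above_of_compact_support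
    (f.hasCompactSupport.fderiv (𝕜 := ℝ))
  have hL0 : 0 ≤ L := (norm_nonneg _).trans (hL 0)
  have hC : 0 < transportConst L (ε / 2) := by unfold transportConst; positivity
  refine ⟨transportConst L (ε / 2), hC, ?_⟩
  intro k hk0 hk r r' hrpos hrr' hr'k hr'max v θ hθ
  have hr'2 : ∀ z, r' z ≤ 1 / 2 := fun z => (hr'max z).trans hr1.le
  have hr2 : ∀ z, r z ≤ 1 / 2 := fun z => (hrr' z).trans (hr'2 z)
  have hin : f.rIn = ε * rmax := rfl
  have hout : f.rOut = ε * ((rmax + 1 / 2) / 2) := rfl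
  have hκ : 0 < ε ^ 2 := by positivity
  have hε2 : ε ^ 2 ≤ 1 := pow_le_one₀ hε.le hε1.le
  refine exists_global_transport (B := cellBall ε) (κ := ε ^ 2)
    (fun z => Metric.isOpen_ball.measurableSet) (disjoint_cellBall hε)
    (isCoeff_sharpCoeff hε hε1 r) (isCoeff_sharpCoeff hε hε1 r') hκ ?_ (by positivity) ?_ v hθ
  · intro x hx
    have : x ∉ inclusions ε r' := by
      rw [inclusions, Set.mem_iUnion]
      rintro ⟨z, hz⟩
      exact hx (Set.mem_iUnion.2 ⟨z, ball_subset_cellBall hε (hr'2 z) z hz⟩)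
    rw [sharpCoeff, sharpCoeff, if_neg this]
    split_ifs <;> linarith
  · intro z v
    -- The dilation with this factor carries the smaller inclusion onto the larger one.
    set s := r' z / r z with hs_def
    have hsr : s * r z = r' z := div_mul_cancel₀ _ (hrpos z).ne'
    have hs : 1 ≤ s := (one_le_div (hrpos z)).2 (hrr' z)
    have hs0 : 0 < s := by linarith
    have hsk : s ≤ 1 + k := (div_le_iff₀ (hrpos z)).2 (hr'k z)
    have hsR : s * f.rOut < ε / 2 := by
      rw [hout]
      -- With `b = 1 / 2 - rmax` the left side is at most `(1 + b / 2) (1 - b) / 2`.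
      have h1 : s * ((rmax + 1 / 2) / 2) < 1 / 2 := by nlinarith
      nlinarith
    have hrR : f.rOut ≤ ε / 2 := le_trans (by nlinarith [f.rOut_pos]) hsR.le
    obtain ⟨w, h1, h2, h3, h4⟩ := exists_cell_transport hd f hL (isCoeff_sharpCoeff hε hε1 r)
      (isCoeff_sharpCoeff hε hε1 r') hκ (c := cellCentre ε z) hk0 (by linarith) hs hsk hsR
      (fun x hx hxr => by
        have : x ∉ inclusions ε r' := by
          rw [mem_inclusions_iff hε hr'2 hx, not_lt]
          refine le_trans ?_ hxr
          rw [hin]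
          exact mul_le_mul_of_nonneg_left (hr'max z) hε.le
        rw [sharpCoeff, sharpCoeff, if_neg this]
        split_ifs <;> linarith)
      (fun x hx => by
        have hxB : x ∈ cellBall ε z := Metric.ball_subset_ball hrR hx
        have hDx : dilation (cellCentre ε z) s x ∈ cellBall ε z :=
          Metric.ball_subset_ball hsR.le ((mem_ball_dilation hs0).2 hx)
        have : x ∈ inclusions ε r ↔ dilation (cellCentre ε z) s x ∈ inclusions ε r' := by
          rw [mem_inclusions_iff hε hr2 hxB, mem_inclusions_iff hε hr'2 hDx, dist_eq_norm,
            dist_eq_norm, dilation_sub, norm_smul, Real.norm_of_nonneg hs0.le, ← hsr,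
            mul_left_comm, mul_lt_mul_iff_right₀ hs0]
        unfold sharpCoeff
        by_cases h : x ∈ inclusions ε r
        · rw [if_pos h, if_pos (this.1 h)]
        · rw [if_neg h, if_neg (mt this.2 h)]) v
    refine ⟨w, ?_, h3, h4⟩
    filter_upwards [h1, h2] with x hx1 hx2 hx
    exact ⟨hx1 hx, hx2 hx⟩

end Geometry

end

/-! ### From transport of energies to closeness of resolvents -/

section ResolventDistance

variable {d : ℕ}

/-- The constant in the estimate of the distance of two resolvents. -/
def resolventConst (κ m : ℝ) : ℝ := 4 * √(κ * m)⁻¹ + (1 + m) * (κ * m)⁻¹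

/-- The transported copy `w` of `v = R' f` is a competitor in the variational principle for `R`. The
energy loss is of order `η`, the shift `‖w - v‖` of order `√η`, and ellipticity bounds `‖∇v‖` by
`‖f‖`. -/
lemma IsWeakResolvent.re_inner_le_of_transport {a a' : Space d → ℝ} {κ m η : ℝ}
    {R R' : L2 d →L[ℂ] L2 d} (hR : IsWeakResolvent a m R) (hR' : IsWeakResolvent a' m R')
    (ha : IsCoeff a κ) (ha' : IsCoeff a' κ) (hκ : 0 < κ) (hm : 0 < m) (hη0 : 0 ≤ η) (hη1 : η ≤ 1)
    (h : ∀ v : H1 d, ∀ θ, 0 < θ → ∃ w : H1 d,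
      energy a w ≤ energy a' v + η * ‖grad v‖ ^ 2 + θ ∧
        ‖(w : L2 d) - v‖ ^ 2 ≤ η * ‖grad v‖ ^ 2) (f : L2 d) :
    (inner ℂ (R' f) f).re ≤ (inner ℂ (R f) f).re + resolventConst κ m * √η * ‖f‖ ^ 2 := by
  refine le_of_forall_pos_le_add fun θ hθ => ?_
  obtain ⟨v, hv, -⟩ := hR' f
  obtain ⟨w, hw1, hw2⟩ := h v θ hθ
  set P := (κ * m)⁻¹ with hP
  have hP0 : 0 < P := by positivity
  have e1 := hR'.re_inner hv
  have e2 := hR'.re_inner_eq hv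
  have hRf := hR'.norm_apply_le ha' hκ hm f
  have hvar := hR.variational ha hκ hm f w
  have hgrad : ‖grad v‖ ^ 2 ≤ P * ‖f‖ ^ 2 := by
    have h1 : κ * ‖grad v‖ ^ 2 ≤ energy a' v := by
      rw [norm_sq_eq_integral, ← integral_const_mul, energy]
      exact integral_mono ((integrable_norm_sq (Lp.memLp (grad v))).const_mul κ)
        (integrable_energy ha' hκ v) fun x =>
          mul_le_mul_of_nonneg_right (ha'.ge x) (sq_nonneg _)
    have h2 := (Complex.re_le_norm _).trans (norm_inner_le_norm (𝕜 := ℂ) (R' f) f)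
    have h3 : ‖R' f‖ * ‖f‖ ≤ m⁻¹ * ‖f‖ * ‖f‖ := mul_le_mul_of_nonneg_right hRf (norm_nonneg _)
    have h4 : κ * ‖grad v‖ ^ 2 ≤ m⁻¹ * ‖f‖ ^ 2 := by
      nlinarith [mul_nonneg hm.le (sq_nonneg ‖R' f‖)]
    rw [hP, mul_inv, mul_assoc, ← div_eq_inv_mul, le_div_iff₀ hκ]
    linarith
  set σ := √η with hσ
  have hσ0 : 0 ≤ σ := Real.sqrt_nonneg _
  have hσ2 : σ ^ 2 = η := Real.sq_sqrt hη0
  have hσ1 : σ ≤ 1 := Real.sqrt_le_one.2 hη1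
  have hη' : η ≤ σ := by nlinarith
  have hdist2 : ‖(w : L2 d) - v‖ ^ 2 ≤ η * (P * ‖f‖ ^ 2) :=
    hw2.trans (mul_le_mul_of_nonneg_left hgrad hη0)
  have hdist : ‖(w : L2 d) - v‖ ≤ σ * √P * ‖f‖ := by
    refine le_of_sq_le_sq ?_ (by positivity)
    rw [mul_pow, mul_pow, hσ2, Real.sq_sqrt hP0.le]
    linarith
  have hinner : (inner ℂ (v : L2 d) f).re - σ * √P * ‖f‖ ^ 2 ≤ (inner ℂ (w : L2 d) f).re := by
    have h1 := (Complex.re_le_norm _).trans (norm_inner_le_norm (𝕜 := ℂ) ((v : L2 d) - w) f)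
    rw [inner_sub_left, Complex.sub_re, norm_sub_rev] at h1
    have h2 := mul_le_mul_of_nonneg_right hdist (norm_nonneg f)
    linarith
  have hnorm : m * ‖(w : L2 d)‖ ^ 2 ≤ m * ‖(v : L2 d)‖ ^ 2
      + 2 * (σ * √P) * ‖f‖ ^ 2 + m * η * P * ‖f‖ ^ 2 := by
    have h1 : ‖(w : L2 d)‖ ≤ ‖(v : L2 d)‖ + ‖(w : L2 d) - v‖ := by
      have := norm_add_le (v : L2 d) ((w : L2 d) - v)
      rwa [add_sub_cancel] at this
    have h2 : ‖(w : L2 d)‖ ^ 2 ≤ (‖(v : L2 d)‖ + ‖(w : L2 d) - v‖) ^ 2 :=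
      pow_le_pow_left₀ (norm_nonneg _) h1 2
    have h3 : m * ‖(v : L2 d)‖ ≤ ‖f‖ := by
      rw [hv]
      calc m * ‖R' f‖ ≤ m * (m⁻¹ * ‖f‖) := mul_le_mul_of_nonneg_left hRf hm.le
        _ = ‖f‖ := by field_simp
    have h4 : m * ‖(v : L2 d)‖ * ‖(w : L2 d) - v‖ ≤ ‖f‖ * (σ * √P * ‖f‖) :=
      mul_le_mul h3 hdist (norm_nonneg _) (norm_nonneg _)
    have h5 := mul_le_mul_of_nonneg_left h2 hm.le
    have h6 := mul_le_mul_of_nonneg_left hdist2 hm.le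
    linarith
  -- The pairing with `f` and the squared norm lose `2 σ √P` each, which gives the `4` in
  -- `resolventConst`; the remaining losses are of order `η ≤ σ`.
  have hloss : η * P * (1 + m) * ‖f‖ ^ 2 ≤ σ * P * (1 + m) * ‖f‖ ^ 2 := by gcongr
  have hgrad' := mul_le_mul_of_nonneg_left hgrad hη0
  unfold resolventConst
  rw [← hP]
  linarith

/-- For a nonnegative operator an upper bound on the quadratic form is a norm bound. -/
lemma norm_sub_le_of_re_inner_le {R R' : L2 d →L[ℂ] L2 d} (hR : IsSelfAdjoint R)
    (hR' : IsSelfAdjoint R') (hle : R ≤ R') {K : ℝ} (hK : 0 ≤ K)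
    (h : ∀ f, (inner ℂ (R' f) f).re ≤ (inner ℂ (R f) f).re + K * ‖f‖ ^ 2) : ‖R' - R‖ ≤ K := by
  rw [CStarAlgebra.norm_le_iff_le_algebraMap (R' - R) hK (sub_nonneg.2 hle)]
  refine le_of_re_inner_le (hR'.sub hR) ((IsSelfAdjoint.all K).algebraMap _) fun x => ?_
  have e : (algebraMap ℝ (L2 d →L[ℂ] L2 d) K) x = (K : ℂ) • x := by
    rw [Algebra.algebraMap_eq_smul_one]
    exact RCLike.real_smul_eq_coe_smul (K := ℂ) K x
  refine le_trans ?_ (le_of_eq (congrArg (fun y : L2 d => (inner ℂ y x).re) e.symm))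
  change _ ≤ (inner ℂ ((K : ℂ) • x) x).re
  rw [inner_smul_left, Complex.conj_ofReal, Complex.re_ofReal_mul, re_inner_self', sub_apply,
    inner_sub_left, Complex.sub_re]
  linarith [h x]

end ResolventDistance

/-! ### The layered coefficient between two sharp ones -/

section Layer

variable {d : ℕ} {ε γ : ℝ} {r : (Fin d → ℤ) → ℝ}

/-- The radial projection of `x` to the outer sphere of its layer lies in the matrix: the sphere is
not part of the open ball and, being inside the cell ball, avoids all other layers and inclusions.
-/
lemma infDist_matrixPart_le (hε : 0 < ε) (hr0 : ∀ z, 0 < r z)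
    (hr1 : ∀ z, ε * r z + ε ^ γ / 4 < ε / 2) {x : Space d} (hx : x ∈ layers ε γ r) :
    Metric.infDist x (matrixPart ε γ r) ≤ ε ^ γ / 4 := by
  obtain ⟨z, hxz, hxz'⟩ := Set.mem_iUnion.1 hx
  have hδ : 0 < ε ^ γ / 4 := by positivity
  set c := cellCentre ε z
  set ρ := ε * r z + ε ^ γ / 4 with hρ
  have hρ0 : 0 < ρ := add_pos (mul_pos hε (hr0 z)) hδ
  have hxc : ε * r z ≤ ‖x - c‖ := by
    rwa [mem_ball_iff_norm, not_lt] at hxz'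
  have hxc' : ‖x - c‖ < ρ := mem_ball_iff_norm.1 hxz
  have hxc0 : 0 < ‖x - c‖ := lt_of_lt_of_le (mul_pos hε (hr0 z)) hxc
  set p := dilation c (ρ / ‖x - c‖) x
  have hpc : dist p c = ρ := by
    rw [dist_eq_norm, dilation_sub, norm_smul, Real.norm_of_nonneg (by positivity),
      div_mul_cancel₀ _ hxc0.ne']
  have hpball : ∀ z', p ∉ Metric.ball (cellCentre ε z') (ε * r z' + ε ^ γ / 4) := by
    intro z' hz'
    have h1 : p ∈ cellBall ε z := by
      rw [cellBall, Metric.mem_ball, hpc]; exact hr1 z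
    have h2 : p ∈ cellBall ε z' := Metric.ball_subset_ball (hr1 z').le hz'
    obtain rfl := eq_of_mem_cellBall hε h1 h2
    rw [Metric.mem_ball, hpc] at hz'
    exact lt_irrefl _ hz'
  have hp : p ∈ matrixPart ε γ r := by
    rw [matrixPart, Set.mem_compl_iff, Set.mem_union, not_or]
    constructor
    · intro h
      obtain ⟨z', hz'⟩ := Set.mem_iUnion.1 h
      exact hpball z' (Metric.ball_subset_ball (by linarith) hz')
    · intro h
      obtain ⟨z', hz'⟩ := Set.mem_iUnion.1 h
      exact hpball z' hz'.1
  refine (Metric.infDist_le_dist_of_mem hp).trans ?_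
  have e : x - p = (1 - ρ / ‖x - c‖) • (x - c) := by
    simp only [p, dilation, sub_smul, one_smul]; abel
  have h1 : 1 ≤ ρ / ‖x - c‖ := (one_le_div hxc0).2 hxc'.le
  rw [dist_eq_norm, e, norm_smul, Real.norm_of_nonpos (by linarith), neg_sub, sub_mul,
    div_mul_cancel₀ _ hxc0.ne', one_mul]
  linarith

lemma layerCoeff_le_one (hε : 0 < ε) (hε1 : ε < 1) (x : Space d) : layerCoeff ε γ r x ≤ 1 := by
  have h1 : ε ^ 2 ≤ 1 := pow_le_one₀ hε.le hε1.le
  have h2 : 0 ≤ (1 - ε ^ 2) * (Metric.infDist x (matrixPart ε γ r) / (ε ^ γ / 4)) :=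
    mul_nonneg (by linarith) (div_nonneg Metric.infDist_nonneg (by positivity))
  unfold layerCoeff
  split_ifs <;> linarith

lemma le_layerCoeff (hε : 0 < ε) (hε1 : ε < 1) (hr0 : ∀ z, 0 < r z)
    (hr1 : ∀ z, ε * r z + ε ^ γ / 4 < ε / 2) (x : Space d) : ε ^ 2 ≤ layerCoeff ε γ r x := by
  have h1 : ε ^ 2 ≤ 1 := pow_le_one₀ hε.le hε1.le
  unfold layerCoeff
  split_ifs with h2 h3
  · exact le_rfl
  · have h4 : Metric.infDist x (matrixPart ε γ r) / (ε ^ γ / 4) ≤ 1 :=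
      (div_le_one (by positivity)).2 (infDist_matrixPart_le hε hr0 hr1 h3)
    nlinarith
  · exact h1

lemma isCoeff_layerCoeff (hε : 0 < ε) (hε1 : ε < 1) (hr0 : ∀ z, 0 < r z)
    (hr1 : ∀ z, ε * r z + ε ^ γ / 4 < ε / 2) :
    IsCoeff (layerCoeff (d := d) ε γ r) (ε ^ 2) := by
  refine ⟨?_, le_layerCoeff hε hε1 hr0 hr1, layerCoeff_le_one hε hε1⟩
  have hl : MeasurableSet (layers (d := d) ε γ r) := MeasurableSet.iUnion fun z =>
    Metric.isOpen_ball.measurableSet.diff Metric.isOpen_ball.measurableSet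
  refine Measurable.ite isOpen_inclusions.measurableSet measurable_const
    (Measurable.ite hl ?_ measurable_const)
  exact ((continuous_const.sub (continuous_const.mul
    ((Metric.continuous_infDist_pt _).div_const _)))).measurable

lemma layerCoeff_le_sharpCoeff (hε : 0 < ε) (hε1 : ε < 1) (x : Space d) :
    layerCoeff ε γ r x ≤ sharpCoeff ε r x := by
  by_cases h : x ∈ inclusions ε r
  · rw [layerCoeff, sharpCoeff, if_pos h, if_pos h]
  · rw [sharpCoeff, if_neg h]
    exact layerCoeff_le_one hε hε1 x

/-- Inside the inflated inclusions the sharp coefficient takes the least value `ε ^ 2`; outside them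
both coefficients are `1`. -/
lemma sharpCoeff_le_layerCoeff (hε : 0 < ε) (hε1 : ε < 1) (hr0 : ∀ z, 0 < r z)
    (hr1 : ∀ z, ε * r z + ε ^ γ / 4 < ε / 2) {r' : (Fin d → ℤ) → ℝ}
    (hr' : ∀ z, ε * r' z = ε * r z + ε ^ γ / 4) (x : Space d) :
    sharpCoeff ε r' x ≤ layerCoeff ε γ r x := by
  by_cases h : x ∈ inclusions ε r'
  · rw [sharpCoeff, if_pos h]
    exact le_layerCoeff hε hε1 hr0 hr1 x
  · have hδ : 0 < ε ^ γ / 4 := by positivity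
    have h1 : ∀ z, x ∉ Metric.ball (cellCentre ε z) (ε * r z + ε ^ γ / 4) := fun z hz =>
      h (Set.mem_iUnion.2 ⟨z, by rwa [hr' z]⟩)
    have h2 : x ∉ inclusions ε r := fun h2 => by
      obtain ⟨z, hz⟩ := Set.mem_iUnion.1 h2
      exact h1 z (Metric.ball_subset_ball (by linarith) hz)
    have h3 : x ∉ layers ε γ r := fun h3 => by
      obtain ⟨z, hz⟩ := Set.mem_iUnion.1 h3
      exact h1 z hz.1
    rw [sharpCoeff, if_neg h, layerCoeff, if_neg h2, if_neg h3]

end Layer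

/-! ### Persistence of the gap for a fixed configuration -/

section Deterministic

variable {d : ℕ}

lemma isSelfAdjoint_sub_real {R : L2 d →L[ℂ] L2 d} (hR : IsSelfAdjoint R) (s : ℝ) :
    IsSelfAdjoint (R - (s : ℂ) • (1 : L2 d →L[ℂ] L2 d)) :=
  hR.sub (IsSelfAdjoint.smul (Complex.conj_ofReal s) (IsSelfAdjoint.one _))

/-- For a fixed configuration of radii, a gap of the sharp operators for all rational layers is a
gap of the operator with transition layers. -/
theorem mem_resolventSet_layerOperator (hd : 2 ≤ d) {ε γ δ : ℝ} (hε0 : 0 < ε) (hε1 : ε < 1)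
    (hγ : 2 ≤ γ) (hδ : δ = ε ^ γ / 4) {ωmin ωmax : ℝ} (hω0 : 0 < ωmin) (hω2 : ωmax < 1 / 4)
    {ω : (Fin d → ℤ) → ℝ} (hω : ∀ z, ω z ∈ Set.Icc ωmin ωmax) {lo hi : ℝ}
    (hgap : ∀ q : ℚ, (q : ℝ) ∈ Set.Icc (0 : ℝ) 1 → ∀ s ∈ Set.Ioo lo hi,
      (s : ℂ) ∈ resolventSet (sharpOperator d ε (fun z => ω z + q * (δ / ε))))
    {l : ℝ} (hl : l ∈ Set.Ioo lo hi) :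
    (l : ℂ) ∈ resolventSet (layerOperator d ε γ ω) := by
  have hδ0 : 0 < δ := by rw [hδ]; positivity
  have hδε0 : 0 < δ / ε := by positivity
  -- With radii below `1 / 4`, this keeps all inflated inclusions strictly inside their cell balls.
  have hδε : δ / ε ≤ 1 / 4 := by
    have : ε ^ γ ≤ ε ^ (1 : ℝ) := Real.rpow_le_rpow_of_exponent_ge hε0 hε1.le (by linarith)
    rw [Real.rpow_one] at this
    rw [div_le_iff₀ hε0, hδ]; linarith
  set rmax := ωmax + δ / ε with hrmax
  have hrmax1 : rmax < 1 / 2 := by linarith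
  have hωmax : ωmin ≤ ωmax := (hω 0).1.trans (hω 0).2
  have hrmax0 : 0 < rmax := by linarith
  have hκ : 0 < ε ^ 2 := by positivity
  obtain ⟨C, hC, htrans⟩ := exists_sharp_transport hd hε0 hε1 hrmax0 hrmax1
  set m := |l| + 1 with hm_def
  have hm : 0 < m := by positivity
  have hlm : 0 < l + m := by linarith [neg_abs_le l]
  set μ := (l + m)⁻¹ with hμ
  have hμ0 : 0 < μ := by positivity
  -- The map `λ ↦ (λ + m)⁻¹` takes `l` to `μ`; a neighbourhood of `μ` pulls back into the gap.
  obtain ⟨c, hc, hcgap⟩ : ∃ c > 0, ∀ s ∈ Set.Ioo (-c) c,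
      0 < μ + s ∧ (μ + s)⁻¹ - m ∈ Set.Ioo lo hi := by
    have h1 : Filter.Tendsto (fun s : ℝ => μ + s) (nhds 0) (nhds μ) := by
      have : Continuous fun s : ℝ => μ + s := by fun_prop
      simpa using this.tendsto 0
    have h2 : Filter.Tendsto (fun s : ℝ => (μ + s)⁻¹ - m) (nhds 0) (nhds l) := by
      have := (h1.inv₀ hμ0.ne').sub_const m
      rwa [hμ, inv_inv, add_sub_cancel_right] at this
    have h3 := (h1.eventually (lt_mem_nhds hμ0)).and (h2.eventually (Ioo_mem_nhds hl.1 hl.2))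
    obtain ⟨c, hc, hcs⟩ := Metric.eventually_nhds_iff.1 h3
    refine ⟨c, hc, fun s hs => hcs ?_⟩
    rw [dist_zero_right, Real.norm_eq_abs, abs_lt]
    exact hs
  -- The first two terms bound the norm of a resolvent minus `μ`; adding `c` ensures `c ≤ M`.
  set M := m⁻¹ + μ + c with hM_def
  have hM0 : 0 < M := by positivity
  set K := resolventConst (ε ^ 2) m with hK_def
  have hK0 : 0 < K := by
    have : 0 < (ε ^ 2 * m)⁻¹ := by positivity
    rw [hK_def, resolventConst]; positivity
  obtain ⟨k, hk0, hk1, hkC, hkη⟩ : ∃ k > 0, k ≤ (1 / 2 - rmax) / 2 ∧ k * C ≤ 1 ∧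
      K * √(k * C) * M < c ^ 2 := by
    have t1 : Filter.Tendsto (fun k : ℝ => k * C) (nhds 0) (nhds 0) := by
      have : Continuous fun k : ℝ => k * C := by fun_prop
      simpa using this.tendsto 0
    have t2 : Filter.Tendsto (fun k : ℝ => K * √(k * C) * M) (nhds 0) (nhds 0) := by
      have : Continuous fun k : ℝ => K * √(k * C) * M := by fun_prop
      simpa using this.tendsto 0
    have h1 := (t1.eventually (gt_mem_nhds one_pos)).and
      ((t2.eventually (gt_mem_nhds (by positivity : 0 < c ^ 2))).and
        (gt_mem_nhds (by linarith : 0 < (1 / 2 - rmax) / 2)))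
    obtain ⟨k, ⟨hk1, hk2, hk3⟩, hk0⟩ := ((h1.filter_mono nhdsWithin_le_nhds).and
      (self_mem_nhdsWithin : Set.Ioi (0 : ℝ) ∈ nhdsWithin 0 (Set.Ioi 0))).exists
    exact ⟨k, hk0, le_of_lt hk3, hk1.le, hk2⟩
  -- With this many steps consecutive radii differ by at most `k * ωmin`, so their ratio is at most
  -- `1 + k`. A positive lower bound on the radii makes this uniform in the cells.
  obtain ⟨N, hN⟩ := exists_nat_gt (δ / ε / (k * ωmin))
  have hkω : 0 < k * ωmin := by positivity
  have hN0 : (0 : ℝ) < N := lt_trans (by positivity) hN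
  have hNk : (1 / N : ℝ) * (δ / ε) ≤ k * ωmin := by
    rw [one_div, inv_mul_le_iff₀ hN0]
    rw [div_lt_iff₀ hkω] at hN
    exact hN.le
  let q : ℕ → ℚ := fun i => (i : ℚ) / N
  have hq : ∀ i, ((q i : ℚ) : ℝ) = (i : ℝ) / N := fun i => by simp [q]
  let r : ℕ → (Fin d → ℤ) → ℝ := fun i z => ω z + (q i : ℝ) * (δ / ε)
  have hq01 : ∀ i ≤ N, (q i : ℝ) ∈ Set.Icc (0 : ℝ) 1 := by
    intro i hi
    rw [hq]
    exact ⟨by positivity, (div_le_one hN0).2 (by exact_mod_cast hi)⟩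
  have hsc := fun i => isCoeff_sharpCoeff (d := d) hε0 hε1 (r i)
  choose R hR using fun i => exists_isWeakResolvent (hsc i) hκ hm
  have hr0 : ∀ z, 0 < ω z := fun z => hω0.trans_le (hω z).1
  have hr1 : ∀ z, ε * ω z + ε ^ γ / 4 < ε / 2 := by
    intro z
    have h1 : ε * (ω z + δ / ε) < ε * (1 / 2) :=
      mul_lt_mul_of_pos_left (lt_of_le_of_lt (add_le_add_left (hω z).2 _) hrmax1) hε0
    rw [mul_add, mul_div_cancel₀ _ hε0.ne', hδ] at h1
    linarith
  have hlc := isCoeff_layerCoeff (d := d) (γ := γ) hε0 hε1 hr0 hr1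
  obtain ⟨S, hS⟩ := exists_isWeakResolvent hlc hκ hm
  have hsucc : ∀ i z, r (i + 1) z = r i z + 1 / N * (δ / ε) := by
    intro i z
    simp only [r, hq]
    push_cast
    ring
  have hrpos : ∀ i z, ωmin ≤ r i z := by
    intro i z
    have : 0 ≤ (q i : ℝ) * (δ / ε) := mul_nonneg (by rw [hq]; positivity) hδε0.le
    have h2 := (hω z).1
    simp only [r]; linarith
  have hrsucc : ∀ i z, r i z ≤ r (i + 1) z := by
    intro i z
    rw [hsucc]
    have : 0 ≤ (1 / N : ℝ) * (δ / ε) := by positivity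
    linarith
  have hmono : ∀ i, R i ≤ R (i + 1) := fun i =>
    (hR (i + 1)).anti (hR i) (hsc _) (hsc _) hκ hm (sharpCoeff_anti hε0 hε1 (hrsucc i))
  have hstep : ∀ i < N, ‖R (i + 1) - R i‖ ≤ K * √(k * C) := by
    intro i hi
    refine norm_sub_le_of_re_inner_le (hR i).isSelfAdjoint (hR (i + 1)).isSelfAdjoint (hmono i)
      (by positivity) ?_
    refine (hR i).re_inner_le_of_transport (hR (i + 1)) (hsc i) (hsc (i + 1)) hκ hm (by positivity)
      hkC ?_
    refine htrans k hk0 hk1 (r i) (r (i + 1)) (fun z => hω0.trans_le (hrpos i z)) (hrsucc i)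
      (fun z => ?_) (fun z => ?_)
    · rw [hsucc]
      have := mul_le_mul_of_nonneg_left (hrpos i z) hk0.le
      linarith
    · have h1 := mul_le_mul_of_nonneg_right (hq01 (i + 1) hi).2 hδε0.le
      have h2 := (hω z).2
      simp only [r]; linarith
  have hunit : IsUnit (S - (μ : ℂ) • (1 : L2 d →L[ℂ] L2 d)) := by
    refine isUnit_of_chain (N := N) (T := fun i => R i - (μ : ℂ) • (1 : L2 d →L[ℂ] L2 d))
      (c := c) (M := M) hc ?_ hkη ?_ ?_ ?_ ?_ ?_ ?_ ?_ ?_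
    · have : 0 < m⁻¹ := by positivity
      linarith
    · exact fun i _ => isSelfAdjoint_sub_real (hR i).isSelfAdjoint μ
    · intro i _
      have h1 : ‖(μ : ℂ) • (1 : L2 d →L[ℂ] L2 d)‖ ≤ μ := by
        rw [norm_smul, Complex.norm_real, Real.norm_of_nonneg hμ0.le]
        exact mul_le_of_le_one_right hμ0.le ContinuousLinearMap.norm_id_le
      have h2 := (hR i).norm_le (hsc i) hκ hm
      exact (norm_sub_le _ _).trans (by linarith)
    · intro i hi s hs
      obtain ⟨h1, h2⟩ := hcgap s hs
      -- The point `μ + s` of the resolvent corresponds to the spectral parameter `(μ + s)⁻¹ - m`,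
      -- which lies in the gap.
      have e : (((μ + s)⁻¹ - m : ℝ) : ℂ) + (m : ℂ) = ((μ + s)⁻¹ : ℝ) := by push_cast; ring
      have h3 := (hR i).isUnit_of_mem_resolventSet (hsc i) hκ hm
        (z := (((μ + s)⁻¹ - m : ℝ) : ℂ)) (by
          rw [e]; exact_mod_cast (inv_pos.2 h1).ne') (hgap (q i) (hq01 i hi) _ h2)
      rw [e, ← Complex.ofReal_inv, inv_inv, Complex.ofReal_add, add_smul, ← sub_sub] at h3
      exact h3
    · exact fun i _ => sub_le_sub_right (hmono i) _
    · intro i hi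
      rw [sub_sub_sub_cancel_right]
      exact hstep i hi
    · exact isSelfAdjoint_sub_real hS.isSelfAdjoint μ
    · refine sub_le_sub_right (hS.anti (hR 0) hlc (hsc 0) hκ hm fun x => ?_) _
      have : r 0 = ω := by funext z; simp [r, q]
      rw [this]
      exact layerCoeff_le_sharpCoeff hε0 hε1 x
    · refine sub_le_sub_right ((hR N).anti hS (hsc N) hlc hκ hm
        (sharpCoeff_le_layerCoeff hε0 hε1 hr0 hr1 fun z => ?_)) _
      simp only [r, hq]
      rw [div_self hN0.ne', one_mul, mul_add, mul_div_cancel₀ _ hε0.ne', hδ]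
  have e : (l : ℂ) + (m : ℂ) = ((l + m : ℝ) : ℂ) := by push_cast; ring
  refine hS.mem_resolventSet_of_isUnit hlc hκ hm (z := (l : ℂ)) ?_ ?_
  · rw [e]; exact_mod_cast hlm.ne'
  · rw [e, ← Complex.ofReal_inv]
    exact hunit

end Deterministic

end

end HighContrast

/-! ### From fixed configurations to almost every one -/

theorem theorem4p5 (d : ℕ) (hd : 2 ≤ d) (ε γ δ : ℝ) (hε0 : 0 < ε) (hε1 : ε < 1) (hγ : 2 ≤ γ)
    (hδ : δ = ε ^ γ / 4)
    (ωmin ωmax : ℝ≥0) (hω0 : 0 < ωmin) (hω1 : ωmin < ωmax) (hω2 : ωmax < 1 / 4)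
    (μ : Measure ℝ≥0) [IsProbabilityMeasure μ] (hμ : μ (Set.Icc ωmin ωmax) = 1)
    (Imin Imax : ℝ)
    (hgap : ∀ t ∈ Set.Icc (0 : ℝ) 1, ∀ᵐ ω ∂(HighContrast.radiiLaw d μ),
      HighContrast.opSpectrum
          (HighContrast.sharpOperator d ε (fun z => (ω z : ℝ) + t * (δ / ε))) ∩
        Complex.ofReal '' Set.Ioo Imin Imax = ∅) :
    ∀ᵐ ω ∂(HighContrast.radiiLaw d μ),
      HighContrast.opSpectrum (HighContrast.layerOperator d ε γ (fun z => (ω z : ℝ))) ∩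
        Complex.ofReal '' Set.Ioo Imin Imax = ∅ := by
  have hrange : ∀ᵐ ω ∂(HighContrast.radiiLaw d μ), ∀ z, ω z ∈ Set.Icc ωmin ωmax := by
    rw [ae_all_iff]
    intro z
    have h1 : ∀ᵐ x ∂μ, x ∈ Set.Icc ωmin ωmax := by
      rw [← mem_ae_iff_prob_eq_one measurableSet_Icc] at hμ
      exact hμ
    exact (measurePreserving_eval_infinitePi (fun _ : Fin d → ℤ => μ) z).quasiMeasurePreserving.ae
      h1
  -- The exceptional null set may depend on `t`; restricting to rational `t` leaves a countable
  -- union.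
  have hrat : ∀ᵐ ω ∂(HighContrast.radiiLaw d μ), ∀ q : ℚ, (q : ℝ) ∈ Set.Icc (0 : ℝ) 1 →
      HighContrast.opSpectrum
          (HighContrast.sharpOperator d ε (fun z => (ω z : ℝ) + q * (δ / ε))) ∩
        Complex.ofReal '' Set.Ioo Imin Imax = ∅ := by
    rw [ae_all_iff]
    intro q
    by_cases hq : (q : ℝ) ∈ Set.Icc (0 : ℝ) 1
    · filter_upwards [hgap q hq] with ω hω _ using hω
    · exact Filter.Eventually.of_forall fun ω h => absurd h hq
  filter_upwards [hrange, hrat] with ω h1 h2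
  rw [← Set.disjoint_iff_inter_eq_empty, Set.disjoint_right]
  rintro _ ⟨l, hl, rfl⟩
  rw [HighContrast.opSpectrum, Set.notMem_compl_iff]
  refine HighContrast.mem_resolventSet_layerOperator hd hε0 hε1 hγ hδ (ωmin := ωmin)
    (ωmax := ωmax) (by exact_mod_cast hω0) ?_ (fun z => ⟨?_, ?_⟩) (fun q hq s hs => ?_) hl
  · have : ((ωmax : ℝ≥0) : ℝ) < ((1 / 4 : ℝ≥0) : ℝ) := NNReal.coe_lt_coe.2 hω2
    simpa using this
  · exact NNReal.coe_le_coe.2 (h1 z).1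
  · exact NNReal.coe_le_coe.2 (h1 z).2
  · have h3 := h2 q hq
    rw [← Set.disjoint_iff_inter_eq_empty, Set.disjoint_right] at h3
    have := h3 ⟨s, hs, rfl⟩
    rwa [HighContrast.opSpectrum, Set.notMem_compl_iff] at this
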